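/- Let $N$ be a lattice of rank $n$ with dual lattice $M=\mathrm{Hom}(N,\mathbb Z)$, and let $\Delta$ be a complete fan of strongly convex rational polyhedral cones in $N_{\mathbb R}$. For an $n$-dimensional rational polyhedral cone $\sigma\subset N_{\mathbb R}$ with dual cone $\sigma^*$, let $\mathrm{Hilb}(\sigma)=\sum_{u\in\sigma^*\cap M}x^u$, viewed as a rational function on the torus $T=\mathrm{Spec}\,\mathbb Q[M]$. The principal part at the identity $1_T$ of a quotient $p/q$ of Laurent polynomials is the quotient $p_\circ/q_\circ$ of their leading forms at $1_T$, where $p_\circ\in \mathrm{Sym}^d(M)\cong I^d/I^{d+1}$ is the class of $p$ if $p$ vanishes to order $d$ at $1_T$; here $I\subset\mathbb Z[M]$ is the ideal of $1_T$, and $x^u-1\in I$ corresponds to $u\in M$. Set $e_\sigma=(-1)^n\,\mathrm{Hilb}(\sigma)_\circ$. For a face $\tau$ of a maximal cone $\sigma\in\Delta$ let $e_{\sigma,\tau}=e_{\overline\sigma}$, where $\overline\sigma$ is the image of $\sigma$ in $\big(N/(N\cap\mathrm{Span}\,\tau)\big)_{\mathbb R}$; it is regarded as an element of the fraction field of $\mathrm{Sym}^*(M)$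 through $\mathrm{Sym}^*(\tau^\perp\cap M)\subset\mathrm{Sym}^*(M)$. Let $k\ge 0$ and let $f\in PP^k(\Delta)$ be a homogeneous piecewise polynomial of degree $k$, that is, a continuous function $f:N_{\mathbb R}\to\mathbb R$ whose restriction $f_\sigma$ to each maximal cone $\sigma$ is a polynomial in $\mathrm{Sym}^k(M)$. Then for every cone $\tau\in\Delta$ of codimension $k$, $$c(\tau)=\sum_{\sigma\succeq\tau}e_{\sigma,\tau}\,f_\sigma\qquad(\text{sum over the maximal cones }\sigma\in\Delta\text{ containing }\tau)$$ is an integer, and these integers form a Minkowski weight of codimension $k$ on $\Delta$: for every cone $\gamma\in\Delta$ of codimension $k+1$, $$\sum_{\tau\succeq\gamma}c(\tau)\,v_{\tau/\gamma}=0\quad\text{in } N/(N\cap\mathrm{Span}\,\gamma),$$ where the sum is over the codimension $k$ cones $\tau\in\Delta$ containing $\gamma$, and $v_{\tau/\gamma}$ is the primitive generator of the image of $\tau$ in $\big(N/(N\cap\mathrm{Span}\,\gamma)\big)_{\mathbb R}$. -/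

import Mathlib

open scoped TensorProduct

noncomputable section

namespace Toric

section Lattice

/-! ### Lattices, dual lattices, polynomials and rational functions

`N` is a lattice (a finitely generated free abelian group) and `M = Hom(N, ℤ)`. -/

/-- The real vector space `N_ℝ = ℝ ⊗ N`. -/
abbrev RealSpace (N : Type*) [AddCommGroup N] : Type _ := ℝ ⊗[ℤ] N

/-- The inclusion `N → N_ℝ`, `v ↦ 1 ⊗ v`. -/
def latticeMap (N : Type*) [AddCommGroup N] : N →ₗ[ℤ] RealSpace N :=
  TensorProduct.mk ℤ ℝ N 1

/-- The dual lattice `M = Hom(N, ℤ)`. -/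
abbrev DualLattice (N : Type*) [AddCommGroup N] : Type _ := Module.Dual ℤ N

/-- The ring `Sym^*(M)` of polynomials with integer coefficients on `N`. -/
abbrev Poly (N : Type*) [AddCommGroup N] : Type _ := SymmetricAlgebra ℤ (DualLattice N)

/-- The fraction field of `Sym^*(M)`. It contains the ring `Sym^±(M)` obtained from `Sym^*(M)` by
inverting the nonzero homogeneous elements, and identities between elements of `Sym^±(M)`
are identities in this field. -/
abbrev RatFun (N : Type*) [AddCommGroup N] : Type _ := FractionRing (Poly N)

/-- The ring `ℤ[M]` of Laurent polynomials: the monomial `x^u` is `AddMonoidAlgebra.single u 1`. -/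
abbrev Laurent (N : Type*) [AddCommGroup N] : Type _ := AddMonoidAlgebra ℤ (DualLattice N)

variable {N : Type*} [AddCommGroup N]

/-- The extension of `u : N → ℤ` to a real linear function `N_ℝ → ℝ`. -/
def realPairing (u : DualLattice N) : RealSpace N →ₗ[ℝ] ℝ :=
  LinearMap.liftBaseChange ℝ ((Algebra.linearMap ℤ ℝ).comp u)

lemma realPairing_tmul (u : DualLattice N) (r : ℝ) (v : N) :
    realPairing u (r ⊗ₜ[ℤ] v) = r * (u v : ℝ) := by
  simp [realPairing]

lemma realPairing_add (u w : DualLattice N) :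
    realPairing (u + w) = realPairing u + realPairing w := by
  ext v
  simp [realPairing]

lemma realPairing_smul (m : ℤ) (u : DualLattice N) :
    realPairing (m • u) = m • realPairing u := by
  ext v
  simp [realPairing]

/-- Evaluation of a polynomial at a point of `N_ℝ`. -/
def evalAt (v : RealSpace N) : Poly N →ₐ[ℤ] ℝ :=
  SymmetricAlgebra.lift
    { toFun := fun u => realPairing u v
      map_add' := fun u w => by simp [realPairing_add]
      map_smul' := fun m u => by simp [realPairing_smul] }

/-- `Sym^k(M)`, the homogeneous polynomials of degree `k`. -/
def homogeneousPoly (N : Type*) [AddCommGroup N] (k : ℕ) : Submodule ℤ (Poly N) :=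
  (LinearMap.range (SymmetricAlgebra.ι ℤ (DualLattice N))) ^ k

/-- The ideal of Laurent polynomials that vanish at the identity `1_T` of the torus
(where every monomial `x^u` takes the value one). -/
def identityIdeal (N : Type*) [AddCommGroup N] : Ideal (Laurent N) :=
  RingHom.ker (AddMonoidAlgebra.lift ℤ ℤ (DualLattice N) 1)

/-- `F` is the leading form at `1_T` of the Laurent polynomial `p`. With `I` the ideal of `1_T`,
`I / I ^ 2` is `M` through `x^u - 1 ↔ u`, and `I ^ d / I ^ (d + 1)` is `Sym^d(M)`. If `p ≠ 0`
vanishes to order `d`, the leading form is the class of `p` in `I ^ d / I ^ (d + 1)`,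
viewed in `Sym^d(M)`: modulo `I ^ (d + 1)`, `p` is a homogeneous
form `G` of degree `d` in elements `x^u - 1`, and `F` is `G` with each `x^u - 1` replaced
by `u`. The leading form of zero is zero. -/
def IsLeadingForm (p : Laurent N) (F : Poly N) : Prop :=
  (p = 0 ∧ F = 0) ∨
    (F ≠ 0 ∧ ∃ (d : ℕ) (G : MvPolynomial (DualLattice N) ℤ), G.IsHomogeneous d ∧
      p - MvPolynomial.aeval
        (fun u : DualLattice N => (AddMonoidAlgebra.single u 1 - 1 : Laurent N)) G
          ∈ identityIdeal N ^ (d + 1) ∧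
      MvPolynomial.aeval (fun u : DualLattice N => SymmetricAlgebra.ι ℤ (DualLattice N) u) G = F)

open Classical in
/-- The leading form `p_∘` of a Laurent polynomial at `1_T`. -/
def leadingForm (p : Laurent N) : Poly N :=
  if h : ∃ F, IsLeadingForm p F then h.choose else 0

end Lattice

section Multiplicity

/-! ### Hilbert series and equivariant multiplicities -/

variable {N : Type*} [AddCommGroup N]

/-- The coefficients of the formal series `∑_{u ∈ σ^* ∩ M} x^u`, where `σ^*` is the dual cone. -/
def hilbertCoeff (σ : PointedCone ℝ (RealSpace N)) (u : DualLattice N) : ℤ :=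
  open Classical in if ∀ v ∈ σ, 0 ≤ realPairing u v then 1 else 0

/-- The coefficients of the product of a Laurent polynomial `q` and the formal series
`∑_u S u x^u`. -/
def mulSeries (q : Laurent N) (S : DualLattice N → ℤ) (u : DualLattice N) : ℤ :=
  q.coeff.sum fun w a => a * S (u - w)

open Classical in
/-- `Hilb(σ) = ∑_{u ∈ σ^* ∩ M} x^u` as a rational function: the fraction `p / q` of Laurent
polynomials such that `q * ∑_{u ∈ σ^* ∩ M} x^u = p` as formal series. -/
def hilb (σ : PointedCone ℝ (RealSpace N)) : FractionRing (Laurent N) :=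
  if h : ∃ a : Laurent N × nonZeroDivisors (Laurent N),
      ∀ u, mulSeries (a.2 : Laurent N) (hilbertCoeff σ) u = a.1.coeff u
  then IsLocalization.mk' (FractionRing (Laurent N)) h.choose.1 h.choose.2
  else 0

variable [Module.Free ℤ N] [Module.Finite ℤ N]

/-- The principal part `(p / q)_∘ = p_∘ / q_∘` at `1_T` of a rational function on the torus. -/
def principalPart (F : FractionRing (Laurent N)) : RatFun N :=
  algebraMap (Poly N) (RatFun N)
      (leadingForm (IsLocalization.sec (nonZeroDivisors (Laurent N)) F).1) /
    algebraMap (Poly N) (RatFun N)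
      (leadingForm ((IsLocalization.sec (nonZeroDivisors (Laurent N)) F).2 : Laurent N))

/-- The equivariant multiplicity `e_σ = (-1)^n Hilb(σ)_∘` of a full-dimensional rational
polyhedral cone, where `n` is the rank of `N`. -/
def equivMult (σ : PointedCone ℝ (RealSpace N)) : RatFun N :=
  (-1) ^ Module.finrank ℤ N * principalPart (hilb σ)

end Multiplicity

section Quotient

/-! ### The quotient lattice `N / (N ∩ span τ)` -/

variable {N : Type*} [AddCommGroup N]

/-- The dimension of a cone. -/
def coneDim (τ : PointedCone ℝ (RealSpace N)) : ℕ :=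
  Module.finrank ℝ (Submodule.span ℝ (τ : Set (RealSpace N)))

/-- The sublattice `N ∩ span τ`. -/
def latticeSpan (τ : PointedCone ℝ (RealSpace N)) : Submodule ℤ N :=
  ((Submodule.span ℝ (τ : Set (RealSpace N))).restrictScalars ℤ).comap (latticeMap N)

/-- The lattice `N / (N ∩ span τ)`. -/
abbrev QuotLattice (τ : PointedCone ℝ (RealSpace N)) : Type _ := N ⧸ latticeSpan τ

/-- The projection `N_ℝ → (N / (N ∩ span τ))_ℝ`. -/
def realProj (τ : PointedCone ℝ (RealSpace N)) :
    RealSpace N →ₗ[ℝ] RealSpace (QuotLattice τ) :=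
  (latticeSpan τ).mkQ.baseChange ℝ

/-- The image `σ̄` of a cone `σ` in `(N / (N ∩ span τ))_ℝ`. -/
def imageCone (σ τ : PointedCone ℝ (RealSpace N)) : PointedCone ℝ (RealSpace (QuotLattice τ)) :=
  σ.map (realProj τ)

instance quotLattice_torsionFree (τ : PointedCone ℝ (RealSpace N)) :
    Module.IsTorsionFree ℤ (QuotLattice τ) := by
  refine ⟨fun m hm => ?_⟩
  have hm0 : (m : ℝ) ≠ 0 := by exact_mod_cast hm.ne_zero
  refine IsSMulRegular.of_right_eq_zero_of_smul fun x hx => ?_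
  obtain ⟨v, rfl⟩ := (latticeSpan τ).mkQ_surjective x
  rw [← map_smul, Submodule.mkQ_apply, Submodule.Quotient.mk_eq_zero] at hx
  rw [Submodule.mkQ_apply, Submodule.Quotient.mk_eq_zero]
  have h1 : latticeMap N (m • v) ∈ Submodule.span ℝ (τ : Set (RealSpace N)) := hx
  rw [map_smul, ← Int.cast_smul_eq_zsmul ℝ] at h1
  exact ((Submodule.span ℝ (τ : Set (RealSpace N))).smul_mem_iff hm0).1 h1

variable [Module.Finite ℤ N]

instance quotLattice_free (τ : PointedCone ℝ (RealSpace N)) : Module.Free ℤ (QuotLattice τ) :=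
  inferInstance

/-- The inclusion of `Sym^*(τ^⊥ ∩ M) = Sym^*(Hom(N / (N ∩ span τ), ℤ))` into `Sym^*(M)`. -/
def polyPullback (τ : PointedCone ℝ (RealSpace N)) : Poly (QuotLattice τ) →ₐ[ℤ] Poly N :=
  SymmetricAlgebra.lift
    ((SymmetricAlgebra.ι ℤ (DualLattice N)).comp (latticeSpan τ).mkQ.dualMap)

lemma polyPullback_injective (τ : PointedCone ℝ (RealSpace N)) :
    Function.Injective (polyPullback τ) := by
  obtain ⟨s, hs⟩ := Module.projective_lifting_property (latticeSpan τ).mkQ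
    (LinearMap.id : QuotLattice τ →ₗ[ℤ] QuotLattice τ) (latticeSpan τ).mkQ_surjective
  let g : Poly N →ₐ[ℤ] Poly (QuotLattice τ) :=
    SymmetricAlgebra.lift ((SymmetricAlgebra.ι ℤ (DualLattice (QuotLattice τ))).comp s.dualMap)
  have hg : g.comp (polyPullback τ) = AlgHom.id ℤ _ := by
    apply SymmetricAlgebra.algHom_ext
    ext u
    have hu : s.dualMap ((latticeSpan τ).mkQ.dualMap u) = u := by
      refine LinearMap.ext fun x => ?_
      exact congrArg u (LinearMap.congr_fun hs x)
    simp [g, polyPullback, hu]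
  exact Function.LeftInverse.injective (g := g) fun x => AlgHom.congr_fun hg x

/-- The inclusion of the rational functions on `N / (N ∩ span τ)` into those on `N`. -/
def ratPullback (τ : PointedCone ℝ (RealSpace N)) : RatFun (QuotLattice τ) →+* RatFun N :=
  IsFractionRing.map (j := (polyPullback τ).toRingHom) (polyPullback_injective τ)

/-- `e_{σ,τ}`: the equivariant multiplicity of the image of `σ` in `(N / (N ∩ span τ))_ℝ`. -/
def relMult (σ τ : PointedCone ℝ (RealSpace N)) : RatFun N :=
  ratPullback τ (equivMult (imageCone σ τ))

end Quotient

section Fans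

/-! ### Fans, piecewise polynomials and Minkowski weights -/

/-- A (finite) fan of strongly convex rational polyhedral cones in `N_ℝ`. -/
structure Fan (N : Type*) [AddCommGroup N] where
  cones : Finset (PointedCone ℝ (RealSpace N))
  rational : ∀ σ ∈ cones, ∃ s : Finset N, σ = PointedCone.hull ℝ (latticeMap N '' (s : Set N))
  stronglyConvex : ∀ σ ∈ cones, (σ : ConvexCone ℝ (RealSpace N)).Salient
  face_mem : ∀ σ ∈ cones, ∀ τ : PointedCone ℝ (RealSpace N), τ.IsFaceOf σ → τ ∈ cones
  inter_face : ∀ σ ∈ cones, ∀ σ' ∈ cones, (σ ⊓ σ').IsFaceOf σ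

variable {N : Type*} [AddCommGroup N]

namespace Fan

/-- The support `|Δ|`. -/
def support (Δ : Fan N) : Set (RealSpace N) := {v | ∃ σ ∈ Δ.cones, v ∈ σ}

/-- `Δ` is complete if its support is all of `N_ℝ`. -/
def IsComplete (Δ : Fan N) : Prop := Δ.support = Set.univ

open Classical in
/-- The maximal cones of `Δ`. -/
def maxCones (Δ : Fan N) : Finset (PointedCone ℝ (RealSpace N)) :=
  Δ.cones.filter fun σ => Maximal (fun σ' => σ' ∈ Δ.cones) σ

open Classical in
/-- The cones of `Δ` of codimension `k`. -/
def codimCones (Δ : Fan N) (k : ℕ) : Finset (PointedCone ℝ (RealSpace N)) :=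
  Δ.cones.filter fun τ => coneDim τ + k = Module.finrank ℤ N

/-- `f ∈ PP^k(Δ)`: `f` is continuous on `|Δ|` (for the standard topology of the finite-dimensional
space `N_ℝ`), and on each maximal cone it is given by a homogeneous polynomial of
degree `k` in `Sym^*(M)`. -/
def IsPiecewisePoly (Δ : Fan N) (k : ℕ) (f : RealSpace N → ℝ) : Prop :=
  letI : TopologicalSpace (RealSpace N) := moduleTopology ℝ (RealSpace N)
  ContinuousOn f Δ.support ∧
    ∀ σ ∈ Δ.maxCones, ∃ p ∈ homogeneousPoly N k, ∀ v ∈ σ, f v = evalAt v p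

end Fan

open Classical in
/-- The polynomial `f_σ ∈ Sym^*(M)` that agrees with `f` on the full-dimensional cone `σ`. -/
def restrictPoly (f : RealSpace N → ℝ) (σ : PointedCone ℝ (RealSpace N)) : Poly N :=
  if h : ∃ p : Poly N, ∀ v ∈ σ, f v = evalAt v p then h.choose else 0

open Classical in
/-- `∑_{σ ⪰ τ} e_{σ,τ} f_σ`, the sum over the maximal cones `σ` of `Δ` that have `τ` as a face. -/
def localSum [Module.Finite ℤ N] (Δ : Fan N) (f : RealSpace N → ℝ)
    (τ : PointedCone ℝ (RealSpace N)) : RatFun N :=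
  ∑ σ ∈ Δ.maxCones with τ.IsFaceOf σ,
    relMult σ τ * algebraMap (Poly N) (RatFun N) (restrictPoly f σ)

/-- `v` is the primitive generator of the ray `ρ`. -/
def IsPrimitiveGenerator (ρ : PointedCone ℝ (RealSpace N)) (v : N) : Prop :=
  ρ = PointedCone.hull ℝ {latticeMap N v} ∧ ∀ (m : ℤ) (w : N), v = m • w → IsUnit m

open Classical in
/-- The primitive generator of a rational ray `ρ`. -/
def primitiveGenerator (ρ : PointedCone ℝ (RealSpace N)) : N :=
  if h : ∃ v, IsPrimitiveGenerator ρ v then h.choose else 0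

open Classical in
/-- An integer valued function `c` on the codimension `k` cones of `Δ` is a Minkowski weight of
codimension `k` if `∑_{τ ⪰ γ} c(τ) v_{τ/γ} = 0` in `N / (N ∩ span γ)` for every cone `γ ∈ Δ` of
codimension `k + 1`, where `τ` runs over the codimension `k` cones that have `γ` as a face and
`v_{τ/γ}` is the primitive generator of the image of `τ` in `(N / (N ∩ span γ))_ℝ`. -/
def Fan.IsMinkowskiWeight (Δ : Fan N) (k : ℕ) (c : Δ.codimCones k → ℤ) : Prop :=
  ∀ γ ∈ Δ.codimCones (k + 1),
    ∑ τ : Δ.codimCones k with γ.IsFaceOf τ.1,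
      c τ • primitiveGenerator (imageCone τ.1 γ) = 0

end Fans

end Toric

end

/-!
Everything takes place in the fraction field of `Sym^*(M)`. The two assertions are that
`c(τ) = ∑ e_{σ,τ} f_σ` is an integer and that the integers are balanced; the first follows from the
cancellation of poles across walls, the second from a relation between the multiplicities of a cone
relative to a face `γ` and relative to the faces `τ` of dimension one higher.

**Multiplicities.** `HasMult S k x` says that a series `S` is represented by a quotient of Laurent
polynomials with a pole of order at most `k` at `1_T`, and that `x` is the corresponding part of the
principal part, up to the sign `(-1) ^ k`. It is additive in `S`, whereas principal parts are not.
For a full-dimensional cone, the product of the `1 - x^u` over the facet normals `u` is a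
denominator of the Hilbert series (`exists_numerator_facetProd`), so the multiplicity is a quotient
by a product of facet normals. For a strictly convex cone the pole has order exactly the rank `n`,
because the values of the series at `exp (-ε v)`, for a generic interior point `v`, grow like
`ε ^ (-n)` (`hasMult_equivMult_hull`). Pulled back along `N → N / (N ∩ span τ)`, this gives
`hasMult_relMult`: `e_{σ,τ}` is the multiplicity, for the pole order `codim τ`, of the series of the
lattice points of `σ^* ∩ τ^⊥`.

**Integrality.** The denominators of `e_{σ,τ}` are products of normals of facets of `σ` that contain
`τ`. If `σ` and `σ'` meet in a wall with normal `u`, the series of `σ` and `σ'` add up to the series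
of the wall, which is invariant under translation by `u` and therefore killed by `1 - x^u`, plus a
series whose support meets every line in the direction of `u` in a finite set, so that no factor
`1 - x^u` is needed in its denominator. Hence `e_{σ,τ} + e_{σ',τ}` has no pole along `u = 0`
(`isRegularAt_add_of_wall`). Since `f_σ` and `f_σ'` agree on the wall, `u` divides `f_σ - f_σ'`, and
`e_{σ,τ} f_σ + e_{σ',τ} f_σ'` has no pole along `u = 0` either (`isRegularAt_add`). As the fan is
complete, each wall has exactly one maximal cone on either side (`Fan.exists_wall`,
`Fan.eq_of_wall`), so all poles of the sum cancel in pairs (`isRegularAt_localSum`). The sum is thus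
a polynomial, homogeneous of degree `k - codim τ`: an integer if `codim τ = k`
(`exists_localSum_eq_intCast`), and zero if `codim τ = k + 1` (`localSum_eq_zero`).

**Balancing.** For an integral form `u` that vanishes on `γ`,
`u * e_{σ,γ} = ∑_τ ⟨u, v_{τ/γ}⟩ e_{σ,τ}`, where `τ` runs over the faces of `σ` that contain `γ` and
have dimension one higher (`ι_mul_relMult`). Indeed, if `u` is nonnegative on `σ`, the lattice
points of `σ^* ∩ γ^⊥` outside its translate by `u` are, up to lower order terms, `⟨u, v_{τ/γ}⟩`
translates of those of `σ^* ∩ τ^⊥` for each `τ` (`exists_slices`), and comparing the growth of the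
values gives the relation (`ι_mul_eq_sum`). Multiplication by `f_σ` and summation over `σ` turns the
left-hand side into `u` times the local sum at `γ`, which is zero by degree reasons, and the
right-hand side into `⟨u, ∑_τ c(τ) v_{τ/γ}⟩` (`sum_mul_localSum`).
-/

noncomputable section

namespace Toric

open Filter Topology

/-! ### Evaluation of polynomials -/

section Evaluation

variable {N : Type*} [AddCommGroup N]

@[simp] lemma evalAt_ι (v : RealSpace N) (u : DualLattice N) :
    evalAt v (SymmetricAlgebra.ι ℤ _ u) = realPairing u v := by
  simp [evalAt]

lemma realPairing_zero : realPairing (0 : DualLattice N) = 0 := by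
  ext v
  simp [realPairing]

lemma realPairing_neg (u : DualLattice N) : realPairing (-u) = -realPairing u := by
  ext v
  simp [realPairing]

lemma realPairing_sub (u w : DualLattice N) :
    realPairing (u - w) = realPairing u - realPairing w := by
  rw [sub_eq_add_neg, realPairing_add, realPairing_neg, sub_eq_add_neg]

@[simp] lemma realPairing_latticeMap (u : DualLattice N) (x : N) :
    realPairing u (latticeMap N x) = (u x : ℝ) := by
  change realPairing u ((1 : ℝ) ⊗ₜ[ℤ] x) = _
  rw [realPairing_tmul, one_mul]

/-- The polynomial `F` pulled back along the affine map `t ↦ v₀ + ∑ t_i b_i`. -/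
def affinePullback {ι : Type*} [Fintype ι] (v₀ : RealSpace N) (b : ι → RealSpace N) :
    Poly N →ₐ[ℤ] MvPolynomial ι ℝ :=
  SymmetricAlgebra.lift
    { toFun := fun u => MvPolynomial.C (realPairing u v₀) +
        ∑ i, MvPolynomial.C (realPairing u (b i)) * MvPolynomial.X i
      map_add' := fun u w => by
        simp only [realPairing_add, LinearMap.add_apply, map_add, add_mul, Finset.sum_add_distrib]
        ring
      map_smul' := fun m u => by
        simp only [realPairing_smul, LinearMap.smul_apply, zsmul_eq_mul, map_mul, map_intCast,
          RingHom.id_apply, mul_add, Finset.mul_sum, mul_assoc] }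

lemma eval_affinePullback {ι : Type*} [Fintype ι] (v₀ : RealSpace N) (b : ι → RealSpace N)
    (t : ι → ℝ) (F : Poly N) :
    MvPolynomial.eval t (affinePullback v₀ b F) = evalAt (v₀ + ∑ i, t i • b i) F := by
  have : ((MvPolynomial.aeval t : MvPolynomial ι ℝ →ₐ[ℝ] ℝ).restrictScalars ℤ).comp
      (affinePullback v₀ b) = evalAt (v₀ + ∑ i, t i • b i) := by
    apply SymmetricAlgebra.algHom_ext
    ext u
    simp [affinePullback, mul_comm]
  exact DFunLike.congr_fun this F

/-- A polynomial that vanishes on an orthant vanishes on the affine space it spans. -/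
lemma affinePullback_eq_zero {ι : Type*} [Fintype ι] (v₀ : RealSpace N) (b : ι → RealSpace N)
    (F : Poly N) (h : ∀ t : ι → ℝ, (∀ i, 0 < t i) → evalAt (v₀ + ∑ i, t i • b i) F = 0) :
    affinePullback v₀ b F = 0 := by
  refine MvPolynomial.funext_set (fun _ => Set.Ioi 0) (fun _ => Set.Ioi_infinite 0) fun t ht => ?_
  rw [eval_affinePullback, map_zero]
  exact h t fun i => ht i (Set.mem_univ i)

lemma evalAt_eq_zero_of_orthant {ι : Type*} [Fintype ι] (v₀ : RealSpace N) (b : ι → RealSpace N)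
    (F : Poly N) (h : ∀ t : ι → ℝ, (∀ i, 0 < t i) → evalAt (v₀ + ∑ i, t i • b i) F = 0)
    (t : ι → ℝ) : evalAt (v₀ + ∑ i, t i • b i) F = 0 := by
  rw [← eval_affinePullback, affinePullback_eq_zero v₀ b F h, map_zero]

/-- `F` is homogeneous of degree `k` as a function on `N_ℝ`. -/
def IsHom (k : ℕ) (F : Poly N) : Prop := ∀ (c : ℝ) (v : RealSpace N),
  evalAt (c • v) F = c ^ k * evalAt v F

lemma IsHom.mul {j k : ℕ} {F G : Poly N} (hF : IsHom j F) (hG : IsHom k G) :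
    IsHom (j + k) (F * G) := fun c v => by
  rw [map_mul, map_mul, hF, hG]; ring

lemma IsHom.add {k : ℕ} {F G : Poly N} (hF : IsHom k F) (hG : IsHom k G) :
    IsHom k (F + G) := fun c v => by
  rw [map_add, map_add, hF, hG]; ring

lemma isHom_of_mem_homogeneousPoly {k : ℕ} {F : Poly N} (h : F ∈ homogeneousPoly N k) :
    IsHom k F := by
  unfold homogeneousPoly at h
  induction k generalizing F with
  | zero =>
    rw [pow_zero, Submodule.mem_one] at h
    obtain ⟨m, rfl⟩ := h
    intro c v
    simp
  | succ k ih =>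
    rw [pow_succ] at h
    refine Submodule.mul_induction_on h (fun G hG L hL => ?_) fun _ _ h₁ h₂ => h₁.add h₂
    obtain ⟨u, rfl⟩ := hL
    refine (ih hG).mul fun c v => ?_
    simp

lemma ι_injective : Function.Injective (SymmetricAlgebra.ι ℤ (DualLattice N)) := by
  intro u w h
  ext x
  have := congrArg (evalAt (latticeMap N x)) h
  simpa using this

variable [Module.Free ℤ N] [Module.Finite ℤ N]

/-- A polynomial is determined by its values. -/
lemma eq_zero_of_evalAt (F : Poly N) (h : ∀ v, evalAt v F = 0) : F = 0 := by
  classical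
  let b := Module.Free.chooseBasis ℤ N
  let e := SymmetricAlgebra.equivMvPolynomial b.dualBasis
  have h1 : ∀ t : Module.Free.ChooseBasisIndex ℤ N → ℝ,
      MvPolynomial.eval t (MvPolynomial.map (Int.castRingHom ℝ) (e F)) = 0 := by
    intro t
    have : (((MvPolynomial.aeval t : MvPolynomial _ ℤ →ₐ[ℤ] ℝ))).comp e.toAlgHom
        = evalAt (∑ i, t i • latticeMap N (b i)) := by
      apply SymmetricAlgebra.algHom_ext
      refine b.dualBasis.ext fun i => ?_
      have h2 : e (SymmetricAlgebra.ι ℤ _ (b.dualBasis i)) = MvPolynomial.X i :=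
        SymmetricAlgebra.equivMvPolynomial_ι_apply _ _
      change MvPolynomial.aeval t (e (SymmetricAlgebra.ι ℤ _ (b.dualBasis i))) =
        evalAt _ (SymmetricAlgebra.ι ℤ _ (b.dualBasis i))
      rw [h2, evalAt_ι]
      simp [Finsupp.single_apply]
    have h2 := DFunLike.congr_fun this F
    rw [h] at h2
    rw [MvPolynomial.eval_map]
    exact h2
  have h3 : MvPolynomial.map (Int.castRingHom ℝ) (e F) = 0 :=
    MvPolynomial.funext fun t => by rw [h1, map_zero]
  have h4 : e F = 0 := MvPolynomial.map_injective _ Int.cast_injective (by rw [h3, map_zero])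
  simpa using h4

lemma evalAt_ext {F G : Poly N} (h : ∀ v, evalAt v F = evalAt v G) : F = G :=
  sub_eq_zero.1 <| eq_zero_of_evalAt _ fun v => by rw [map_sub, h, sub_self]

end Evaluation

/-! ### Leading forms of Laurent polynomials -/

section LeadingForms

variable {N : Type*} [AddCommGroup N]

/-- Substitution of `x^u - 1` for the variable indexed by `u`. -/
abbrev shiftEval (N : Type*) [AddCommGroup N] : MvPolynomial (DualLattice N) ℤ →ₐ[ℤ] Laurent N :=
  MvPolynomial.aeval fun u : DualLattice N => (AddMonoidAlgebra.single u 1 - 1 : Laurent N)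

/-- Substitution of the linear form `u` for the variable indexed by `u`. -/
abbrev symEval (N : Type*) [AddCommGroup N] : MvPolynomial (DualLattice N) ℤ →ₐ[ℤ] Poly N :=
  MvPolynomial.aeval fun u : DualLattice N => SymmetricAlgebra.ι ℤ (DualLattice N) u

/-- The Laurent polynomial `p` vanishes to order at least `d` at `1_T`, and its class in
`I ^ d / I ^ (d + 1) = Sym^d(M)` is `F`. Unlike for the leading form, `F` may be zero. -/
def HasLead (p : Laurent N) (d : ℕ) (F : Poly N) : Prop :=
  ∃ G : MvPolynomial (DualLattice N) ℤ, G.IsHomogeneous d ∧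
    p - shiftEval N G ∈ identityIdeal N ^ (d + 1) ∧ symEval N G = F

lemma isLeadingForm_iff (p : Laurent N) (F : Poly N) :
    IsLeadingForm p F ↔ (p = 0 ∧ F = 0) ∨ (F ≠ 0 ∧ ∃ d, HasLead p d F) := Iff.rfl

lemma aug_single (u : DualLattice N) (m : ℤ) :
    AddMonoidAlgebra.lift ℤ ℤ (DualLattice N) 1 (AddMonoidAlgebra.single u m) = m := by
  simp [AddMonoidAlgebra.lift_single]

lemma shift_mem (u : DualLattice N) :
    (AddMonoidAlgebra.single u 1 - 1 : Laurent N) ∈ identityIdeal N := by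
  rw [identityIdeal, RingHom.mem_ker, map_sub, aug_single, map_one, sub_self]

lemma shiftEval_mem {d : ℕ} {G : MvPolynomial (DualLattice N) ℤ} (hG : G.IsHomogeneous d) :
    shiftEval N G ∈ identityIdeal N ^ d := by
  have h : shiftEval N G ∈
      Ideal.span (Set.range fun u : DualLattice N =>
        (AddMonoidAlgebra.single u 1 - 1 : Laurent N)) ^ d := by
    rw [Ideal.mem_span_pow_iff_exists_isHomogeneous]
    exact ⟨MvPolynomial.map (algebraMap ℤ _) G, hG.map _, by
      rw [MvPolynomial.eval_map]; rfl⟩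
  refine Ideal.pow_right_mono ?_ d h
  rw [Ideal.span_le]
  rintro _ ⟨u, rfl⟩
  exact shift_mem u

lemma HasLead.mem {p : Laurent N} {d : ℕ} {F : Poly N} (h : HasLead p d F) :
    p ∈ identityIdeal N ^ d := by
  obtain ⟨G, hG, h1, -⟩ := h
  have := add_mem (Ideal.pow_le_pow_right (Nat.le_succ d) h1) (shiftEval_mem hG)
  simpa using this

lemma hasLead_zero_of_mem {p : Laurent N} {d : ℕ} (h : p ∈ identityIdeal N ^ (d + 1)) :
    HasLead p d 0 :=
  ⟨0, MvPolynomial.isHomogeneous_zero _ _ _, by simpa using h, by simp⟩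

lemma HasLead.of_lt {p : Laurent N} {d d' : ℕ} {F : Poly N} (h : HasLead p d F) (hd : d' < d) :
    HasLead p d' 0 :=
  hasLead_zero_of_mem (Ideal.pow_le_pow_right hd h.mem)

lemma HasLead.add {p q : Laurent N} {d : ℕ} {F G : Poly N} (hp : HasLead p d F)
    (hq : HasLead q d G) : HasLead (p + q) d (F + G) := by
  obtain ⟨A, hA, h1, rfl⟩ := hp
  obtain ⟨B, hB, h2, rfl⟩ := hq
  refine ⟨A + B, hA.add hB, ?_, by simp⟩
  have := add_mem h1 h2
  rw [map_add]
  convert this using 1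
  ring

lemma HasLead.mul {p q : Laurent N} {d e : ℕ} {F G : Poly N} (hp : HasLead p d F)
    (hq : HasLead q e G) : HasLead (p * q) (d + e) (F * G) := by
  have hq' := hq.mem
  obtain ⟨A, hA, h1, rfl⟩ := hp
  obtain ⟨B, hB, h2, rfl⟩ := hq
  refine ⟨A * B, hA.mul hB, ?_, by simp⟩
  have h3 := Ideal.mul_mem_mul h1 hq'
  have h4 := Ideal.mul_mem_mul (shiftEval_mem hA) h2
  rw [← pow_add] at h3 h4
  rw [map_mul]
  convert add_mem (show _ ∈ identityIdeal N ^ (d + e + 1) by convert! h3 using 2; ring)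
    (show _ ∈ identityIdeal N ^ (d + e + 1) from h4) using 1
  ring

lemma HasLead.neg {p : Laurent N} {d : ℕ} {F : Poly N} (hp : HasLead p d F) :
    HasLead (-p) d (-F) := by
  obtain ⟨A, hA, h1, rfl⟩ := hp
  refine ⟨-A, hA.neg, ?_, by simp⟩
  rw [map_neg, ← neg_sub', neg_mem_iff]
  exact h1

lemma hasLead_one : HasLead (1 : Laurent N) 0 1 :=
  ⟨1, MvPolynomial.isHomogeneous_one _ _, by simp, by simp⟩

lemma hasLead_shift (u : DualLattice N) :
    HasLead (AddMonoidAlgebra.single u 1 - 1 : Laurent N) 1 (SymmetricAlgebra.ι ℤ _ u) :=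
  ⟨MvPolynomial.X u, MvPolynomial.isHomogeneous_X _ _, by simp, by simp⟩

/-- The binomial `1 - x^u`. -/
abbrev binom (u : DualLattice N) : Laurent N := 1 - AddMonoidAlgebra.single u 1

lemma hasLead_binom (u : DualLattice N) :
    HasLead (binom u) 1 (-SymmetricAlgebra.ι ℤ _ u) := by
  simpa using (hasLead_shift u).neg

lemma hasLead_prod_binom (U : Finset (DualLattice N)) :
    HasLead (∏ u ∈ U, binom u) U.card (∏ u ∈ U, -SymmetricAlgebra.ι ℤ _ u) := by
  classical
  induction U using Finset.induction_on with
  | empty => simpa using hasLead_one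
  | insert a U ha ih =>
    rw [Finset.prod_insert ha, Finset.prod_insert ha, Finset.card_insert_of_notMem ha, add_comm]
    exact (hasLead_binom a).mul ih

/-- The value of a Laurent polynomial at the point `exp v` of the real torus. -/
def expEval (v : RealSpace N) : Laurent N →ₐ[ℤ] ℝ :=
  AddMonoidAlgebra.lift ℤ ℝ (DualLattice N)
    { toFun := fun u => Real.exp (realPairing u.toAdd v)
      map_one' := by simp [realPairing_zero]
      map_mul' := fun u w => by simp [realPairing_add, Real.exp_add] }

@[simp] lemma expEval_single (v : RealSpace N) (u : DualLattice N) (m : ℤ) :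
    expEval v (AddMonoidAlgebra.single u m) = m * Real.exp (realPairing u v) := by
  simp [expEval, AddMonoidAlgebra.lift_single]

lemma differentiable_expEval (v : RealSpace N) (p : Laurent N) :
    Differentiable ℝ fun ε : ℝ => expEval (ε • v) p := by
  induction p using AddMonoidAlgebra.induction_linear with
  | zero => simp
  | add x y hx hy =>
    simp only [map_add]
    exact hx.add hy
  | single u m =>
    simp only [expEval_single, map_smul, smul_eq_mul]
    fun_prop

lemma expEval_zero (p : Laurent N) :
    expEval 0 p = (AddMonoidAlgebra.lift ℤ ℤ (DualLattice N) 1 p : ℝ) := by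
  induction p using AddMonoidAlgebra.induction_linear with
  | zero => simp
  | add x y hx hy => simp [hx, hy]
  | single u m => rw [expEval_single, aug_single]; simp

lemma expEval_isBigO (v : RealSpace N) (d : ℕ) (p : Laurent N) (hp : p ∈ identityIdeal N ^ d) :
    (fun ε : ℝ => expEval (ε • v) p) =O[𝓝 0] fun ε => ε ^ d := by
  induction d generalizing p with
  | zero =>
    simpa using (differentiable_expEval v p).continuous.continuousAt.isBigO_one ℝ
  | succ d ih =>
    rw [pow_succ] at hp
    refine Submodule.mul_induction_on hp (fun a ha b hb => ?_) fun a b ha hb => ?_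
    · simp only [map_mul, pow_succ]
      refine (ih a ha).mul ?_
      have h := ((differentiable_expEval v b) 0).isBigO_sub
      have h0 : expEval 0 b = 0 := by
        rw [expEval_zero]
        exact_mod_cast (RingHom.mem_ker.1 hb)
      simpa [h0] using h
    · simpa using ha.add hb

lemma aeval_mul_of_isHomogeneous {σ : Type*} {G : MvPolynomial σ ℤ} {d : ℕ}
    (hG : G.IsHomogeneous d) (c : ℝ) (g : σ → ℝ) :
    MvPolynomial.aeval (fun i => c * g i) G = c ^ d * MvPolynomial.aeval g G := by
  conv_lhs => rw [G.as_sum]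
  conv_rhs => rw [G.as_sum]
  rw [map_sum, map_sum, Finset.mul_sum]
  refine Finset.sum_congr rfl fun s hs => ?_
  rw [MvPolynomial.aeval_monomial, MvPolynomial.aeval_monomial, hG.degree_eq_sum_deg_support hs]
  simp only [mul_pow, Finsupp.prod, Finset.prod_mul_distrib, Finset.prod_pow_eq_pow_sum]
  ring

lemma tendsto_aeval {σ : Type*} (G : MvPolynomial σ ℤ) {l : Filter ℝ} (g : ℝ → σ → ℝ)
    (g₀ : σ → ℝ) (h : ∀ i, Tendsto (fun ε => g ε i) l (𝓝 (g₀ i))) :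
    Tendsto (fun ε => MvPolynomial.aeval (g ε) G) l (𝓝 (MvPolynomial.aeval g₀ G)) := by
  induction G using MvPolynomial.induction_on with
  | C a => simpa using tendsto_const_nhds
  | add p q hp hq => simpa using hp.add hq
  | mul_X p i hp => simpa using hp.mul (h i)

lemma evalAt_symEval (v : RealSpace N) (G : MvPolynomial (DualLattice N) ℤ) :
    evalAt v (symEval N G) = MvPolynomial.aeval (fun u => realPairing u v) G := by
  induction G using MvPolynomial.induction_on with
  | C a => simp
  | add p q hp hq => simp [hp, hq]
  | mul_X p i hp => simp [hp]

lemma expEval_shiftEval (v : RealSpace N) (G : MvPolynomial (DualLattice N) ℤ) :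
    expEval v (shiftEval N G) =
      MvPolynomial.aeval (fun u => Real.exp (realPairing u v) - 1) G := by
  induction G using MvPolynomial.induction_on with
  | C a => simp
  | add p q hp hq => simp [hp, hq]
  | mul_X p i hp => simp [hp]

lemma HasLead.isHom {p : Laurent N} {d : ℕ} {F : Poly N} (h : HasLead p d F) : IsHom d F := by
  obtain ⟨G, hG, -, rfl⟩ := h
  intro c v
  rw [evalAt_symEval, evalAt_symEval, ← aeval_mul_of_isHomogeneous hG]
  simp

/-- The leading form at `1_T` controls the values near `1_T`. -/
lemma HasLead.tendsto {p : Laurent N} {d : ℕ} {F : Poly N} (h : HasLead p d F)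
    (v : RealSpace N) :
    Tendsto (fun ε : ℝ => expEval (ε • v) p / ε ^ d) (𝓝[>] 0) (𝓝 (evalAt v F)) := by
  obtain ⟨G, hG, h1, rfl⟩ := h
  -- The remainder lies in `I ^ (d + 1)`; for the rest, `(e^{ε⟨u, v⟩} - 1) / ε` tends to `⟨u, v⟩`.
  have hB := (expEval_isBigO v (d + 1) _ h1).mono (nhdsWithin_le_nhds (s := Set.Ioi 0))
  have hpos : ∀ᶠ ε : ℝ in 𝓝[>] 0, 0 < ε := self_mem_nhdsWithin
  have h2 : Tendsto (fun ε : ℝ => expEval (ε • v) (p - shiftEval N G) / ε ^ d) (𝓝[>] 0) (𝓝 0) := by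
    have h3 : (fun ε : ℝ => expEval (ε • v) (p - shiftEval N G) / ε ^ d) =O[𝓝[>] 0]
        fun ε => ε := by
      refine (hB.mul (Asymptotics.isBigO_refl (fun ε : ℝ => (ε ^ d)⁻¹) _)).congr' ?_ ?_
      · exact Eventually.of_forall fun ε => (div_eq_mul_inv _ _).symm
      · filter_upwards [hpos] with ε hε
        rw [pow_succ]; field_simp
    exact h3.trans_tendsto (tendsto_id.mono_left nhdsWithin_le_nhds)
  have h4 : Tendsto (fun ε : ℝ => expEval (ε • v) (shiftEval N G) / ε ^ d) (𝓝[>] 0)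
      (𝓝 (evalAt v (symEval N G))) := by
    rw [evalAt_symEval]
    have h5 := tendsto_aeval (l := 𝓝[>] (0 : ℝ)) G
      (fun ε u => (Real.exp (ε * realPairing u v) - 1) / ε) (fun u => realPairing u v) ?_
    · refine h5.congr' ?_
      filter_upwards [hpos] with ε hε
      rw [expEval_shiftEval, eq_div_iff (by positivity), mul_comm,
        ← aeval_mul_of_isHomogeneous hG]
      congr 2
      ext u
      simp only [map_smul, smul_eq_mul]
      field_simp
    · intro u
      have hd : HasDerivAt (fun ε : ℝ => Real.exp (ε * realPairing u v)) (realPairing u v) 0 := by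
        simpa using ((hasDerivAt_id (0 : ℝ)).mul_const (realPairing u v)).exp
      have := hd.tendsto_slope_zero_right
      simpa [div_eq_inv_mul] using this
  simpa [← add_div] using h2.add h4

lemma identityIdeal_ne_top : identityIdeal N ≠ ⊤ := RingHom.ker_ne_top _

/-- The ideal of `1_T` is generated by the `x^b - 1` for `b` in a basis of `M`. -/
lemma identityIdeal_le_span {κ : Type*} (b : Module.Basis κ ℤ (DualLattice N)) :
    identityIdeal N ≤ Ideal.span (Set.range fun i =>
      (AddMonoidAlgebra.single (b i) 1 - 1 : Laurent N)) := by
  set J := Ideal.span (Set.range fun i => (AddMonoidAlgebra.single (b i) 1 - 1 : Laurent N))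
  have hmul : ∀ u w : DualLattice N, (AddMonoidAlgebra.single (u + w) 1 : Laurent N) =
      AddMonoidAlgebra.single u 1 * AddMonoidAlgebra.single w 1 := fun u w => by
    rw [AddMonoidAlgebra.single_mul_single, one_mul]
  have h1 : ∀ u : DualLattice N, (AddMonoidAlgebra.single u 1 - 1 : Laurent N) ∈ J := by
    intro u
    have hu : u ∈ Submodule.span ℤ (Set.range b) := by rw [b.span_eq]; trivial
    rw [← Submodule.mem_toAddSubgroup, Submodule.span_int_eq_addSubgroupClosure] at hu
    refine AddSubgroup.closure_induction ?_ ?_ ?_ ?_ hu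
    · rintro _ ⟨i, rfl⟩
      exact Ideal.subset_span ⟨i, rfl⟩
    · rw [← AddMonoidAlgebra.one_def, sub_self]; exact zero_mem _
    · intro x y _ _ hx hy
      rw [hmul]
      convert add_mem (J.mul_mem_left (AddMonoidAlgebra.single x 1) hy) hx using 1
      ring
    · intro x _ hx
      have h0 : (AddMonoidAlgebra.single (-x) 1 : Laurent N) * AddMonoidAlgebra.single x 1 = 1 := by
        rw [← hmul, neg_add_cancel, ← AddMonoidAlgebra.one_def]
      convert neg_mem (J.mul_mem_left (AddMonoidAlgebra.single (-x) 1) hx) using 1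
      rw [mul_sub, h0]; ring
  have h2 : ∀ p : Laurent N,
      p - algebraMap ℤ _ (AddMonoidAlgebra.lift ℤ ℤ (DualLattice N) 1 p) ∈ J := by
    intro p
    induction p using AddMonoidAlgebra.induction_linear with
    | zero => simp
    | add x y hx hy =>
      convert add_mem hx hy using 1
      rw [map_add, map_add]; ring
    | single u m =>
      rw [aug_single]
      convert J.mul_mem_left (algebraMap ℤ _ m) (h1 u) using 1
      rw [mul_sub, mul_one, ← Algebra.smul_def, AddMonoidAlgebra.smul_single]
      simp
  intro p hp
  have := h2 p
  rw [RingHom.mem_ker.1 hp] at this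
  simpa using this

variable [Module.Free ℤ N] [Module.Finite ℤ N]

lemma HasLead.unique {p : Laurent N} {d : ℕ} {F G : Poly N} (h : HasLead p d F)
    (h' : HasLead p d G) : F = G :=
  evalAt_ext fun v => tendsto_nhds_unique (h.tendsto v) (h'.tendsto v)

instance : IsDomain (Laurent N) := by
  classical
  let b := Module.Free.chooseBasis ℤ (DualLattice N)
  have : UniqueSums (DualLattice N) :=
    UniqueSums.of_injective_addHom b.equivFun.toAddEquiv.toAddHom
      b.equivFun.injective inferInstance
  have : NoZeroDivisors (Laurent N) := inferInstance
  exact NoZeroDivisors.to_isDomain _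

instance : IsNoetherianRing (Laurent N) := by
  have : AddMonoid.FG (DualLattice N) :=
    AddGroup.fg_iff_addMonoid_fg.1 (Module.Finite.iff_addGroup_fg.1 inferInstance)
  exact Algebra.FiniteType.isNoetherianRing ℤ _

/-- Every nonzero Laurent polynomial has a leading form. -/
lemma exists_hasLead (p : Laurent N) (hp : p ≠ 0) : ∃ d F, F ≠ 0 ∧ HasLead p d F := by
  classical
  have h0 : ∃ d, p ∉ identityIdeal N ^ d := by
    by_contra! h
    have := Ideal.iInf_pow_eq_bot_of_isDomain (identityIdeal N) identityIdeal_ne_top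
    exact hp (by simpa using this.le (Ideal.mem_iInf.2 h))
  have hd0 : Nat.find h0 ≠ 0 := by
    intro h
    have := Nat.find_spec h0
    rw [h] at this
    simp at this
  obtain ⟨d, hd⟩ := Nat.exists_eq_succ_of_ne_zero hd0
  have h1 : p ∉ identityIdeal N ^ (d + 1) := by
    have := Nat.find_spec h0
    rwa [hd] at this
  have h2 : p ∈ identityIdeal N ^ d := by
    have := Nat.find_min h0 (m := d) (by omega)
    simpa using this
  let b := Module.Free.chooseBasis ℤ (DualLattice N)
  have h3 := Ideal.pow_right_mono (identityIdeal_le_span b) d h2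
  rw [Ideal.mem_span_pow_iff_exists_isHomogeneous] at h3
  obtain ⟨P, hP, hPp⟩ := h3
  let aug : Laurent N →+* ℤ := (AddMonoidAlgebra.lift ℤ ℤ (DualLattice N) 1).toRingHom
  let Q := MvPolynomial.map aug P
  have hQ : Q.IsHomogeneous d := hP.map _
  let y := fun i => (AddMonoidAlgebra.single (b i) 1 - 1 : Laurent N)
  have hy : ∀ i, y i ∈ identityIdeal N := fun i => shift_mem _
  -- Replacing the coefficients by their augmentations does not change the class modulo the
  -- next power of the ideal.
  have h4 : p - MvPolynomial.aeval y Q ∈ identityIdeal N ^ (d + 1) := by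
    have e1 : MvPolynomial.aeval y Q = ∑ s ∈ P.support,
        algebraMap ℤ (Laurent N) (aug (P.coeff s)) * s.prod fun i k => y i ^ k := by
      simp only [Q]
      conv_lhs => rw [P.as_sum, map_sum, map_sum]
      refine Finset.sum_congr rfl fun s _ => ?_
      rw [MvPolynomial.map_monomial, MvPolynomial.aeval_monomial]
    have e2 : p = ∑ s ∈ P.support, P.coeff s * s.prod fun i k => y i ^ k := by
      rw [← hPp]
      conv_lhs => rw [P.as_sum, map_sum]
      exact Finset.sum_congr rfl fun s _ => MvPolynomial.eval_monomial ..
    rw [e1, e2, ← Finset.sum_sub_distrib]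
    refine sum_mem fun s hs => ?_
    rw [← sub_mul, pow_succ']
    refine Ideal.mul_mem_mul ?_ ?_
    · rw [identityIdeal, RingHom.mem_ker, map_sub, sub_eq_zero]
      simp [aug]
    · rw [hP.degree_eq_sum_deg_support hs, ← Finset.prod_pow_eq_pow_sum]
      exact Ideal.prod_mem_prod fun i _ => Ideal.pow_mem_pow (hy i) _
  have hQ0 : Q ≠ 0 := by
    intro h
    rw [h, map_zero, sub_zero] at h4
    exact h1 h4
  refine ⟨d, (SymmetricAlgebra.equivMvPolynomial b).symm Q, by simpa using hQ0,
    MvPolynomial.rename b Q, hQ.rename_isHomogeneous, ?_, ?_⟩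
  · rw [MvPolynomial.aeval_rename]
    exact h4
  · rw [MvPolynomial.aeval_rename]
    have : (MvPolynomial.aeval ((fun u => SymmetricAlgebra.ι ℤ (DualLattice N) u) ∘ b) :
        MvPolynomial _ ℤ →ₐ[ℤ] Poly N) =
        ((SymmetricAlgebra.equivMvPolynomial b).symm : MvPolynomial _ ℤ →ₐ[ℤ] Poly N) := by
      ext i
      simp
    exact DFunLike.congr_fun this Q

lemma HasLead.ne_zero {p : Laurent N} {d : ℕ} {F : Poly N} (h : HasLead p d F) (hF : F ≠ 0) :
    p ≠ 0 := by
  rintro rfl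
  exact hF (h.unique (hasLead_zero_of_mem (zero_mem _)))

lemma HasLead.degree_unique {p : Laurent N} {d e : ℕ} {F G : Poly N} (h : HasLead p d F)
    (hF : F ≠ 0) (h' : HasLead p e G) (hG : G ≠ 0) : d = e := by
  rcases lt_trichotomy d e with hlt | heq | hlt
  · exact absurd (h.unique (h'.of_lt hlt)) hF
  · exact heq
  · exact absurd (h'.unique (h.of_lt hlt)) hG

lemma isLeadingForm_unique {p : Laurent N} {F G : Poly N} (h : IsLeadingForm p F)
    (h' : IsLeadingForm p G) : F = G := by
  rw [isLeadingForm_iff] at h h'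
  rcases h with ⟨h0, rfl⟩ | ⟨hF, d, hd⟩ <;> rcases h' with ⟨h0', rfl⟩ | ⟨hG, e, he⟩
  · rfl
  · exact absurd h0 (he.ne_zero hG)
  · exact absurd h0' (hd.ne_zero hF)
  · obtain rfl := hd.degree_unique hF he hG
    exact hd.unique he

lemma leadingForm_eq {p : Laurent N} {F : Poly N} (h : IsLeadingForm p F) :
    leadingForm p = F := by
  have h' : ∃ F, IsLeadingForm p F := ⟨F, h⟩
  rw [leadingForm, dif_pos h']
  exact isLeadingForm_unique h'.choose_spec h

lemma HasLead.leadingForm_eq {p : Laurent N} {d : ℕ} {F : Poly N} (h : HasLead p d F)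
    (hF : F ≠ 0) : leadingForm p = F :=
  Toric.leadingForm_eq ((isLeadingForm_iff p F).2 (Or.inr ⟨hF, d, h⟩))

/-- The principal part of `p / q` is the quotient of the leading forms. -/
lemma principalPart_mk' (p : Laurent N) (q : nonZeroDivisors (Laurent N)) {d e : ℕ}
    {F G : Poly N} (hp : HasLead p d F) (hF : F ≠ 0) (hq : HasLead (q : Laurent N) e G)
    (hG : G ≠ 0) :
    principalPart (IsLocalization.mk' (FractionRing (Laurent N)) p q) =
      algebraMap _ (RatFun N) F / algebraMap _ (RatFun N) G := by
  set x := IsLocalization.mk' (FractionRing (Laurent N)) p q with hx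
  set s := IsLocalization.sec (nonZeroDivisors (Laurent N)) x with hs
  have h1 : p * (s.2 : Laurent N) = s.1 * q := by
    have h := IsLocalization.mk'_sec (FractionRing (Laurent N)) (M := nonZeroDivisors (Laurent N)) x
    rw [← hs, hx, IsLocalization.mk'_eq_iff_eq] at h
    have := IsFractionRing.injective (Laurent N) (FractionRing (Laurent N)) h
    rw [mul_comm p, mul_comm s.1]
    exact this.symm
  have hs2 : (s.2 : Laurent N) ≠ 0 := nonZeroDivisors.coe_ne_zero _
  have hs1 : s.1 ≠ 0 := by
    intro h
    rw [h, zero_mul] at h1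
    exact mul_ne_zero (hp.ne_zero hF) hs2 h1
  obtain ⟨d', F', hF', h2⟩ := exists_hasLead s.1 hs1
  obtain ⟨e', G', hG', h3⟩ := exists_hasLead _ hs2
  have h4 := hp.mul h3
  rw [h1] at h4
  have h5 := h2.mul hq
  have hd := h4.degree_unique (mul_ne_zero hF hG') h5 (mul_ne_zero hF' hG)
  rw [hd] at h4
  have h6 := h4.unique h5
  have inj := IsFractionRing.injective (Poly N) (RatFun N)
  have z : ∀ {A : Poly N}, A ≠ 0 → algebraMap (Poly N) (RatFun N) A ≠ 0 := fun h =>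
    (map_ne_zero_iff _ inj).2 h
  rw [principalPart, ← hs, h2.leadingForm_eq hF', h3.leadingForm_eq hG',
    div_eq_div_iff (z hG') (z hG), ← map_mul, ← map_mul, h6]

end LeadingForms

/-! ### Formal series and their equivariant multiplicities -/

section Series

variable {N : Type*} [AddCommGroup N]

lemma mulSeries_zero_left (S : DualLattice N → ℤ) (u : DualLattice N) : mulSeries 0 S u = 0 := by
  simp [mulSeries]

lemma mulSeries_single (w : DualLattice N) (a : ℤ) (S : DualLattice N → ℤ) (u : DualLattice N) :
    mulSeries (AddMonoidAlgebra.single w a) S u = a * S (u - w) := by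
  simp [mulSeries, Finsupp.sum_single_index]

lemma mulSeries_add_left (q q' : Laurent N) (S : DualLattice N → ℤ) (u : DualLattice N) :
    mulSeries (q + q') S u = mulSeries q S u + mulSeries q' S u := by
  unfold mulSeries
  rw [AddMonoidAlgebra.coeff_add, Finsupp.sum_add_index'] <;> simp [add_mul]

lemma mulSeries_add_right (q : Laurent N) (S S' : DualLattice N → ℤ) (u : DualLattice N) :
    mulSeries q (S + S') u = mulSeries q S u + mulSeries q S' u := by
  simp [mulSeries, mul_add]

lemma mulSeries_neg_right (q : Laurent N) (S : DualLattice N → ℤ) (u : DualLattice N) :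
    mulSeries q (-S) u = -mulSeries q S u := by
  simp [mulSeries, Finsupp.sum]

lemma mulSeries_neg_left (q : Laurent N) (S : DualLattice N → ℤ) (u : DualLattice N) :
    mulSeries (-q) S u = -mulSeries q S u := by
  have h := mulSeries_add_left q (-q) S u
  rw [add_neg_cancel, mulSeries_zero_left] at h
  omega

lemma mulSeries_sub_left (q q' : Laurent N) (S : DualLattice N → ℤ) (u : DualLattice N) :
    mulSeries (q - q') S u = mulSeries q S u - mulSeries q' S u := by
  rw [sub_eq_add_neg, mulSeries_add_left, mulSeries_neg_left, sub_eq_add_neg]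

lemma mulSeries_mul (q q' : Laurent N) (S : DualLattice N → ℤ) (u : DualLattice N) :
    mulSeries (q * q') S u = mulSeries q (mulSeries q' S) u := by
  induction q using AddMonoidAlgebra.induction_linear with
  | zero => simp [mulSeries_zero_left]
  | add x y hx hy => rw [add_mul, mulSeries_add_left, mulSeries_add_left, hx, hy]
  | single w a =>
    induction q' using AddMonoidAlgebra.induction_linear with
    | zero => simp [mulSeries_zero_left, mulSeries_single]
    | add x y hx hy =>
      rw [mul_add, mulSeries_add_left, hx, hy]
      simp only [mulSeries_single, mulSeries_add_left]
      ring
    | single w' a' =>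
      rw [AddMonoidAlgebra.single_mul_single]
      simp only [mulSeries_single]
      rw [mul_assoc, sub_sub]

lemma mulSeries_one (S : DualLattice N → ℤ) (u : DualLattice N) : mulSeries 1 S u = S u := by
  rw [AddMonoidAlgebra.one_def, mulSeries_single]; simp

lemma mulSeries_coeff (q p : Laurent N) (u : DualLattice N) :
    mulSeries q p.coeff u = (q * p).coeff u := by
  induction q using AddMonoidAlgebra.induction_linear with
  | zero => simp [mulSeries_zero_left]
  | add x y hx hy => rw [add_mul, mulSeries_add_left, hx, hy]; simp
  | single w a =>
    rw [mulSeries_single, AddMonoidAlgebra.coeff_single_mul_apply, neg_add_eq_sub]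

lemma mulSeries_binom (w : DualLattice N) (S : DualLattice N → ℤ) (u : DualLattice N) :
    mulSeries (binom w) S u = S u - S (u - w) := by
  rw [mulSeries_sub_left, mulSeries_one, mulSeries_single, one_mul]

/-- Two fractions that represent the same series agree. -/
lemma mul_eq_mul_of_mulSeries {S : DualLattice N → ℤ} {p q p' q' : Laurent N}
    (h : ∀ u, mulSeries q S u = p.coeff u) (h' : ∀ u, mulSeries q' S u = p'.coeff u) :
    q' * p = q * p' := by
  ext u
  rw [← mulSeries_coeff, ← mulSeries_coeff, ← (funext h : mulSeries q S = _),
    ← (funext h' : mulSeries q' S = _), ← mulSeries_mul, ← mulSeries_mul, mul_comm]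

lemma algebraMap_poly_ne_zero {F : Poly N} (h : F ≠ 0) : algebraMap (Poly N) (RatFun N) F ≠ 0 :=
  (map_ne_zero_iff _ (IsFractionRing.injective _ _)).2 h

variable [Module.Free ℤ N] [Module.Finite ℤ N]

/-- The formal series `S` is a rational function on the torus with a pole of order at most `k`
at `1_T`, and `(-1) ^ k * x` is the part of degree `-k` of its principal part. -/
def HasMult (S : DualLattice N → ℤ) (k : ℕ) (x : RatFun N) : Prop :=
  ∃ (p q : Laurent N) (d : ℕ) (F G : Poly N), HasLead p d F ∧ HasLead q (d + k) G ∧ G ≠ 0 ∧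
    (∀ u, mulSeries q S u = p.coeff u) ∧
    x = (-1) ^ k * (algebraMap _ (RatFun N) F / algebraMap _ (RatFun N) G)

lemma HasMult.unique {S : DualLattice N → ℤ} {k : ℕ} {x y : RatFun N} (hx : HasMult S k x)
    (hy : HasMult S k y) : x = y := by
  obtain ⟨p, q, d, F, G, h1, h2, h3, h4, rfl⟩ := hx
  obtain ⟨p', q', d', F', G', h1', h2', h3', h4', rfl⟩ := hy
  have h5 := mul_eq_mul_of_mulSeries h4 h4'
  have h6 := h2'.mul h1
  rw [h5, show d' + k + d = d + k + d' by ring] at h6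
  have h7 := h6.unique (h2.mul h1')
  rw [(div_eq_div_iff (algebraMap_poly_ne_zero h3) (algebraMap_poly_ne_zero h3')).2]
  rw [← map_mul, ← map_mul, mul_comm F, h7, mul_comm]

lemma HasMult.add {S S' : DualLattice N → ℤ} {k : ℕ} {x y : RatFun N} (hx : HasMult S k x)
    (hy : HasMult S' k y) : HasMult (S + S') k (x + y) := by
  obtain ⟨p, q, d, F, G, h1, h2, h3, h4, rfl⟩ := hx
  obtain ⟨p', q', d', F', G', h1', h2', h3', h4', rfl⟩ := hy
  refine ⟨q' * p + q * p', q * q', d + d' + k, G' * F + G * F', G * G', ?_, ?_,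
    mul_ne_zero h3 h3', fun u => ?_, ?_⟩
  · have e1 := h2'.mul h1
    have e2 := h2.mul h1'
    rw [show d' + k + d = d + d' + k by ring] at e1
    rw [show d + k + d' = d + d' + k by ring] at e2
    exact e1.add e2
  · have e := h2.mul h2'
    rwa [show d + k + (d' + k) = d + d' + k + k by ring] at e
  · rw [mulSeries_add_right]
    conv_lhs => rw [mul_comm q q', mulSeries_mul, funext h4, mulSeries_coeff, mul_comm q' q,
      mulSeries_mul, funext h4', mulSeries_coeff]
    simp
  · have z := algebraMap_poly_ne_zero h3
    have z' := algebraMap_poly_ne_zero h3'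
    rw [← mul_add, map_add, map_mul, map_mul, map_mul]
    congr 1
    field_simp

/-- A fraction `r p / (r q)` that represents the series may be reduced, and the leading form of `q`
is then a denominator of the multiplicity. -/
lemma HasMult.exists_numerator {S : DualLattice N → ℤ} {k : ℕ} {x : RatFun N} (hx : HasMult S k x)
    {p q b : Laurent N} (hb : b ≠ 0) {r : ℕ} {G : Poly N}
    (h : ∀ u, mulSeries (b * q) S u = (b * p).coeff u) (hq : HasLead q r G) (hG : G ≠ 0) :
    ∃ A : Poly N, x * algebraMap _ (RatFun N) G = algebraMap _ (RatFun N) A := by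
  obtain ⟨p', q', d', F', G', h1', h2', h3', h4', rfl⟩ := hx
  have h5 : q * p' = q' * p := mul_left_cancel₀ hb <| by
    linear_combination mul_eq_mul_of_mulSeries h4' h
  by_cases hp : p = 0
  · have : F' = 0 := by
      rw [hp, mul_zero] at h5
      by_contra hF
      exact mul_ne_zero (hq.ne_zero hG) (h1'.ne_zero hF) h5
    exact ⟨0, by simp [this]⟩
  obtain ⟨d, F, hF, h1⟩ := exists_hasLead p hp
  have h6 := hq.mul h1'
  rw [h5] at h6
  have h7 := h2'.mul h1
  have h8 := mul_ne_zero h3' hF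
  rcases lt_trichotomy (r + d') (d' + k + d) with hlt | heq | hlt
  · have : F' = 0 := by
      have := h6.unique (h7.of_lt hlt)
      exact (mul_eq_zero.1 this).resolve_left hG
    exact ⟨0, by simp [this]⟩
  · rw [heq] at h6
    have h9 := h6.unique h7
    refine ⟨(-1) ^ k * F, ?_⟩
    have z := algebraMap_poly_ne_zero h3'
    have h10 := congrArg (algebraMap (Poly N) (RatFun N)) h9
    rw [map_mul, map_mul] at h10
    rw [map_mul, map_pow, map_neg, map_one, mul_assoc]
    congr 1
    rw [div_mul_eq_mul_div, div_eq_iff z, mul_comm, h10, mul_comm]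
  · exact absurd (h7.unique (h6.of_lt hlt)) h8

lemma hilb_eq (σ : PointedCone ℝ (RealSpace N)) {p q : Laurent N} (hq : q ≠ 0)
    (h : ∀ u, mulSeries q (hilbertCoeff σ) u = p.coeff u) :
    hilb σ = IsLocalization.mk' (FractionRing (Laurent N)) p
      ⟨q, mem_nonZeroDivisors_of_ne_zero hq⟩ := by
  have h' : ∃ a : Laurent N × nonZeroDivisors (Laurent N),
      ∀ u, mulSeries (a.2 : Laurent N) (hilbertCoeff σ) u = a.1.coeff u :=
    ⟨(p, ⟨q, mem_nonZeroDivisors_of_ne_zero hq⟩), h⟩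
  rw [hilb, dif_pos h', IsLocalization.mk'_eq_iff_eq]
  exact congrArg _ (mul_eq_mul_of_mulSeries h'.choose_spec h)

/-- The equivariant multiplicity of a cone, when the pole of its Hilbert series has order equal
to the rank of the lattice. -/
lemma hasMult_equivMult (σ : PointedCone ℝ (RealSpace N)) {p q : Laurent N} {d : ℕ} {F G : Poly N}
    (h : ∀ u, mulSeries q (hilbertCoeff σ) u = p.coeff u) (hp : HasLead p d F) (hF : F ≠ 0)
    (hq : HasLead q (d + Module.finrank ℤ N) G) (hG : G ≠ 0) :
    HasMult (hilbertCoeff σ) (Module.finrank ℤ N) (equivMult σ) := by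
  refine ⟨p, q, d, F, G, hp, hq, hG, h, ?_⟩
  rw [equivMult, hilb_eq σ (hq.ne_zero hG) h, principalPart_mk' p _ hp hF hq hG]

end Series

/-! ### Pullback along `N → N / (N ∩ span τ)` -/

section Transfer

variable {N : Type*} [AddCommGroup N] (τ : PointedCone ℝ (RealSpace N))

/-- The inclusion of `Hom(N / (N ∩ span τ), ℤ)` into `M`. -/
abbrev dualIncl : DualLattice (QuotLattice τ) →ₗ[ℤ] DualLattice N := (latticeSpan τ).mkQ.dualMap

lemma dualIncl_injective : Function.Injective (dualIncl τ) :=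
  LinearMap.dualMap_injective_of_surjective (latticeSpan τ).mkQ_surjective

/-- The inclusion of the Laurent polynomials on `N / (N ∩ span τ)` into those on `N`. -/
def laurentPullback : Laurent (QuotLattice τ) →ₐ[ℤ] Laurent N :=
  AddMonoidAlgebra.mapDomainAlgHom ℤ ℤ (dualIncl τ).toAddMonoidHom

@[simp] lemma laurentPullback_single (u : DualLattice (QuotLattice τ)) (m : ℤ) :
    laurentPullback τ (AddMonoidAlgebra.single u m) =
      AddMonoidAlgebra.single (dualIncl τ u) m := by
  simp [laurentPullback]

lemma laurentPullback_mem {d : ℕ} {p : Laurent (QuotLattice τ)}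
    (hp : p ∈ identityIdeal (QuotLattice τ) ^ d) : laurentPullback τ p ∈ identityIdeal N ^ d := by
  have h1 : ∀ p : Laurent (QuotLattice τ), AddMonoidAlgebra.lift ℤ ℤ (DualLattice N) 1
      (laurentPullback τ p) = AddMonoidAlgebra.lift ℤ ℤ (DualLattice (QuotLattice τ)) 1 p := by
    intro p
    induction p using AddMonoidAlgebra.induction_linear with
    | zero => simp
    | add x y hx hy => simp [hx, hy]
    | single u m => rw [laurentPullback_single, aug_single, aug_single]
  have h2 : (identityIdeal (QuotLattice τ)).map (laurentPullback τ).toRingHom ≤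
      identityIdeal N := by
    rw [Ideal.map_le_iff_le_comap]
    intro p hp
    rw [Ideal.mem_comap, identityIdeal, RingHom.mem_ker]
    exact (h1 p).trans (RingHom.mem_ker.1 hp)
  have h3 := Ideal.mem_map_of_mem (laurentPullback τ).toRingHom hp
  rw [Ideal.map_pow] at h3
  exact Ideal.pow_right_mono h2 d h3

lemma mulSeries_laurentPullback {S : DualLattice N → ℤ} {S' : DualLattice (QuotLattice τ) → ℤ}
    (h : ∀ u, S (dualIncl τ u) = S' u) (q : Laurent (QuotLattice τ))
    (u : DualLattice (QuotLattice τ)) :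
    mulSeries (laurentPullback τ q) S (dualIncl τ u) = mulSeries q S' u := by
  induction q using AddMonoidAlgebra.induction_linear with
  | zero => simp [mulSeries_zero_left]
  | add x y hx hy => rw [map_add, mulSeries_add_left, mulSeries_add_left, hx, hy]
  | single w a => rw [laurentPullback_single, mulSeries_single, mulSeries_single, ← map_sub, h]

lemma mulSeries_laurentPullback_of_notMem {S : DualLattice N → ℤ}
    (h : ∀ u ∉ Set.range (dualIncl τ), S u = 0) (q : Laurent (QuotLattice τ))
    (u : DualLattice N) (hu : u ∉ Set.range (dualIncl τ)) :
    mulSeries (laurentPullback τ q) S u = 0 := by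
  induction q using AddMonoidAlgebra.induction_linear with
  | zero => simp [mulSeries_zero_left]
  | add x y hx hy => rw [map_add, mulSeries_add_left, hx, hy, add_zero]
  | single w a =>
    rw [laurentPullback_single, mulSeries_single, h, mul_zero]
    rintro ⟨z, hz⟩
    exact hu ⟨z + w, by rw [map_add, hz]; simp⟩

lemma coeff_laurentPullback (q : Laurent (QuotLattice τ)) (u : DualLattice (QuotLattice τ)) :
    (laurentPullback τ q).coeff (dualIncl τ u) = q.coeff u := by
  classical
  induction q using AddMonoidAlgebra.induction_linear with
  | zero => simp
  | add x y hx hy => simp [hx, hy]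
  | single w a =>
    rw [laurentPullback_single, AddMonoidAlgebra.coeff_single, AddMonoidAlgebra.coeff_single,
      Finsupp.single_apply, Finsupp.single_apply, (dualIncl_injective τ).eq_iff]

lemma coeff_laurentPullback_of_notMem (q : Laurent (QuotLattice τ))
    (u : DualLattice N) (hu : u ∉ Set.range (dualIncl τ)) :
    (laurentPullback τ q).coeff u = 0 := by
  classical
  induction q using AddMonoidAlgebra.induction_linear with
  | zero => simp
  | add x y hx hy => simp [hx, hy]
  | single w a =>
    rw [laurentPullback_single, AddMonoidAlgebra.coeff_single, Finsupp.single_apply, if_neg]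
    exact fun h => hu ⟨w, h⟩

lemma polyPullback_ι (u : DualLattice (QuotLattice τ)) :
    polyPullback τ (SymmetricAlgebra.ι ℤ _ u) = SymmetricAlgebra.ι ℤ _ (dualIncl τ u) := by
  simp [polyPullback]

lemma HasLead.pullback {p : Laurent (QuotLattice τ)} {d : ℕ} {F : Poly (QuotLattice τ)}
    (h : HasLead p d F) : HasLead (laurentPullback τ p) d (polyPullback τ F) := by
  obtain ⟨G, hG, h1, rfl⟩ := h
  refine ⟨MvPolynomial.rename (dualIncl τ) G, hG.rename_isHomogeneous, ?_, ?_⟩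
  · have : shiftEval N (MvPolynomial.rename (dualIncl τ) G) =
        laurentPullback τ (shiftEval (QuotLattice τ) G) := by
      rw [MvPolynomial.aeval_rename, ← AlgHom.comp_apply, MvPolynomial.comp_aeval]
      congr 2
      ext1 u
      simp
    rw [this, ← map_sub]
    exact laurentPullback_mem τ h1
  · rw [MvPolynomial.aeval_rename, ← AlgHom.comp_apply, MvPolynomial.comp_aeval]
    congr 2
    ext1 u
    simp [polyPullback_ι]

lemma realPairing_dualIncl (u : DualLattice (QuotLattice τ)) (v : RealSpace N) :
    realPairing (dualIncl τ u) v = realPairing u (realProj τ v) := by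
  refine TensorProduct.induction_on v (by simp) (fun r x => ?_) fun x y hx hy => ?_
  · have : realProj τ (r ⊗ₜ[ℤ] x) = r ⊗ₜ[ℤ] ((latticeSpan τ).mkQ x) := rfl
    rw [this, realPairing_tmul, realPairing_tmul]
    rfl
  · rw [map_add, map_add, map_add, hx, hy]

variable [Module.Finite ℤ N]

lemma ratPullback_algebraMap (F : Poly (QuotLattice τ)) :
    ratPullback τ (algebraMap _ _ F) = algebraMap _ _ (polyPullback τ F) := by
  unfold ratPullback IsFractionRing.map
  rw [IsLocalization.map_eq]
  rfl

variable [Module.Free ℤ N]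

lemma HasMult.pullback {S : DualLattice N → ℤ} {S' : DualLattice (QuotLattice τ) → ℤ}
    (h : ∀ u, S (dualIncl τ u) = S' u) (h0 : ∀ u ∉ Set.range (dualIncl τ), S u = 0)
    {k : ℕ} {x : RatFun (QuotLattice τ)} (hx : HasMult S' k x) :
    HasMult S k (ratPullback τ x) := by
  obtain ⟨p, q, d, F, G, h1, h2, h3, h4, rfl⟩ := hx
  refine ⟨laurentPullback τ p, laurentPullback τ q, d, polyPullback τ F, polyPullback τ G,
    h1.pullback τ, h2.pullback τ, (map_ne_zero_iff _ (polyPullback_injective τ)).2 h3,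
    fun u => ?_, ?_⟩
  · by_cases hu : u ∈ Set.range (dualIncl τ)
    · obtain ⟨u, rfl⟩ := hu
      rw [mulSeries_laurentPullback τ h, coeff_laurentPullback, h4]
    · rw [mulSeries_laurentPullback_of_notMem τ h0 _ _ hu, coeff_laurentPullback_of_notMem τ _ _ hu]
  · rw [map_mul, map_div₀, map_pow, map_neg, map_one, ratPullback_algebraMap,
      ratPullback_algebraMap]

end Transfer

/-! ### Farkas' lemma -/

section Farkas

variable {R V : Type*} [CommRing R] [LinearOrder R] [IsStrictOrderedRing R]
  [AddCommGroup V] [Module R V]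

lemma nonneg_of_mem_hull {ℓ : V →ₗ[R] R} {s : Set V} (h : ∀ y ∈ s, 0 ≤ ℓ y) {x : V}
    (hx : x ∈ PointedCone.hull R s) : 0 ≤ ℓ x := by
  refine Submodule.span_induction h (by simp) (fun a b _ _ ha hb => ?_) (fun c a _ ha => ?_) hx
  · rw [map_add]; exact add_nonneg ha hb
  · have : c • a = (c : R) • a := rfl
    rw [this, map_smul, smul_eq_mul]
    exact mul_nonneg c.2 ha

/-- Farkas' lemma over an ordered ring. The multiple of `x` is needed when division is not
possible. The induction removes a generator by projecting along it onto a hyperplane that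
separates `x` from the remaining generators. -/
lemma farkas (hsep : ∀ x : V, x ≠ 0 → ∃ ℓ : V →ₗ[R] R, ℓ x ≠ 0) {ι : Type*} (s : Finset ι)
    (f : ι → V) (x : V) :
    (∃ m : R, 0 < m ∧ m • x ∈ PointedCone.hull R (f '' (s : Set ι))) ∨
      ∃ ℓ : V →ₗ[R] R, (∀ i ∈ s, 0 ≤ ℓ (f i)) ∧ ℓ x < 0 := by
  classical
  induction s using Finset.induction_on generalizing f x with
  | empty =>
    by_cases hx : x = 0
    · exact Or.inl ⟨1, one_pos, by simp [hx]⟩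
    · obtain ⟨ℓ, hℓ⟩ := hsep x hx
      rcases lt_or_gt_of_ne hℓ with h | h
      · exact Or.inr ⟨ℓ, by simp, h⟩
      · exact Or.inr ⟨-ℓ, by simp, by simpa using h⟩
  | insert a s ha ih =>
    have hmono : PointedCone.hull R (f '' (s : Set ι)) ≤
        PointedCone.hull R (f '' ((insert a s : Finset ι) : Set ι)) :=
      Submodule.span_mono (Set.image_mono (by simp))
    rcases ih f x with ⟨m, hm, hx⟩ | ⟨ℓ₀, h0, hx0⟩
    · exact Or.inl ⟨m, hm, hmono hx⟩
    by_cases hfa : 0 ≤ ℓ₀ (f a)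
    · refine Or.inr ⟨ℓ₀, fun i hi => ?_, hx0⟩
      rcases Finset.mem_insert.1 hi with rfl | hi
      · exact hfa
      · exact h0 i hi
    push Not at hfa
    let π : V →ₗ[R] V := -(ℓ₀ (f a)) • LinearMap.id + ℓ₀.smulRight (f a)
    have hπ : ∀ y, π y = -(ℓ₀ (f a)) • y + ℓ₀ y • f a := fun y => rfl
    rcases ih (fun i => π (f i)) (π x) with ⟨m, hm, hx⟩ | ⟨ℓ₁, h1, hx1⟩
    · have key : ∀ z ∈ PointedCone.hull R ((fun i => π (f i)) '' (s : Set ι)),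
          ∃ z' ∈ PointedCone.hull R (f '' (s : Set ι)), π z' = z := by
        intro z hz
        refine Submodule.span_induction ?_ ⟨0, zero_mem _, map_zero _⟩ ?_ ?_ hz
        · rintro _ ⟨i, hi, rfl⟩
          exact ⟨f i, Submodule.subset_span ⟨i, hi, rfl⟩, rfl⟩
        · rintro _ _ _ _ ⟨a', ha', rfl⟩ ⟨b', hb', rfl⟩
          exact ⟨a' + b', add_mem ha' hb', map_add _ _ _⟩
        · rintro c _ _ ⟨a', ha', rfl⟩
          exact ⟨c • a', Submodule.smul_mem _ c ha', map_smul π (c : R) a'⟩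
      obtain ⟨z, hz, hzx⟩ := key _ hx
      have hz0 : 0 ≤ ℓ₀ z := nonneg_of_mem_hull (by rintro _ ⟨i, hi, rfl⟩; exact h0 i hi) hz
      refine Or.inl ⟨m * -(ℓ₀ (f a)), mul_pos hm (neg_pos.2 hfa), ?_⟩
      have e : (m * -(ℓ₀ (f a))) • x = -(ℓ₀ (f a)) • z + (ℓ₀ z + m * -(ℓ₀ x)) • f a := by
        rw [hπ, hπ, smul_add, smul_smul, smul_smul] at hzx
        rw [← eq_sub_iff_add_eq] at hzx
        rw [add_smul, ← add_assoc, hzx]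
        module
      rw [e]
      refine add_mem (PointedCone.smul_mem _ (neg_pos.2 hfa).le (hmono hz))
        (PointedCone.smul_mem _ (add_nonneg hz0 (mul_nonneg hm.le (neg_pos.2 hx0).le))
          (Submodule.subset_span ⟨a, by simp, rfl⟩))
    · refine Or.inr ⟨ℓ₁.comp π, fun i hi => ?_, hx1⟩
      rcases Finset.mem_insert.1 hi with rfl | hi
      · rw [LinearMap.comp_apply, hπ, neg_smul, neg_add_cancel, map_zero]
      · exact h1 i hi

end Farkas

/-! ### Primitive vectors -/

section Primitive

/-- `u` is not a proper multiple of another vector. -/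
def IsPrim {A : Type*} [AddCommGroup A] (u : A) : Prop := ∀ (m : ℤ) (w : A), u = m • w → IsUnit m

variable {N : Type*} [AddCommGroup N]

lemma IsPrim.ne_zero {A : Type*} [AddCommGroup A] {u : A} (h : IsPrim u) : u ≠ 0 := by
  rintro rfl
  exact not_isUnit_zero (h 0 0 (by simp))

lemma IsPrim.neg {A : Type*} [AddCommGroup A] {u : A} (h : IsPrim u) : IsPrim (-u) :=
  fun m w hw => h m (-w) (by rw [smul_neg, ← hw, neg_neg])

lemma exists_eq_smul_of_ne_zero {u : DualLattice N} (hu : u ≠ 0) :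
    ∃ (d : ℤ) (w : DualLattice N), 0 < d ∧ u = d • w ∧ ∃ v, w v = 1 := by
  obtain ⟨d, hd⟩ := (IsPrincipalIdealRing.principal (LinearMap.range u)).principal
  have hdvd : ∀ y, d ∣ u y := fun y => by
    have : u y ∈ LinearMap.range u := ⟨y, rfl⟩
    rw [hd] at this
    exact Ideal.mem_span_singleton.1 this
  have hd0 : d ≠ 0 := by
    rintro rfl
    exact hu (LinearMap.ext fun y => by simpa using hdvd y)
  have main : ∀ e : ℤ, (∀ y, e ∣ u y) → 0 < e → (∃ v, u v = e) →
      ∃ w : DualLattice N, u = e • w ∧ ∃ v, w v = 1 := by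
    intro e he h0 ⟨v, hv⟩
    let w : N →+ ℤ :=
      { toFun := fun y => u y / e
        map_zero' := by simp
        map_add' := fun x y => by rw [map_add, Int.add_ediv_of_dvd_left (he x)] }
    refine ⟨w.toIntLinearMap, LinearMap.ext fun y => ?_, v, ?_⟩
    · exact (Int.mul_ediv_cancel' (he y)).symm
    · change u v / e = 1
      rw [hv, Int.ediv_self h0.ne']
  have hv : ∃ v, u v = d := by
    have : d ∈ LinearMap.range u := by rw [hd]; exact Ideal.mem_span_singleton_self d
    exact this
  rcases lt_or_gt_of_ne hd0 with h | h
  · obtain ⟨w, h1, h2⟩ := main (-d) (fun y => (neg_dvd).2 (hdvd y)) (by omega)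
      (by obtain ⟨v, hv⟩ := hv; exact ⟨-v, by rw [map_neg, hv]⟩)
    exact ⟨-d, w, by omega, h1, h2⟩
  · obtain ⟨w, h1, h2⟩ := main d hdvd h hv
    exact ⟨d, w, h, h1, h2⟩

lemma IsPrim.exists_eq_one {u : DualLattice N} (hu : IsPrim u) : ∃ v, u v = 1 := by
  obtain ⟨d, w, hd, rfl, v, hv⟩ := exists_eq_smul_of_ne_zero hu.ne_zero
  have := hu d w rfl
  rw [Int.isUnit_iff] at this
  exact ⟨v, by rcases this with rfl | rfl <;> simp [hv]; omega⟩

lemma isPrim_of_eq_one {u : DualLattice N} {v : N} (h : u v = 1) : IsPrim u := by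
  rintro m w rfl
  exact IsUnit.of_mul_eq_one _ h

/-- Primitive vectors that are multiples of each other agree up to sign. -/
lemma IsPrim.eq_or_eq_neg {u w : DualLattice N} (hu : IsPrim u) (hw : IsPrim w)
    (h : ∀ y, u y = 0 → w y = 0) : w = u ∨ w = -u := by
  obtain ⟨v, hv⟩ := hu.exists_eq_one
  have e : w = (w v) • u := LinearMap.ext fun y => by
    have := h (y - u y • v) (by simp [hv])
    rw [map_sub, map_smul, sub_eq_zero] at this
    rw [this]; simp [mul_comm]
  rcases Int.isUnit_iff.1 (hw _ _ e) with h1 | h1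
  · left; rw [e, h1, one_smul]
  · right; rw [e, h1]; simp

end Primitive

/-! ### Facet normals of polyhedral cones -/

section Facets

variable {N : Type*} [AddCommGroup N]

/-- The real span of a set of lattice vectors. -/
abbrev realSpan (s : Set N) : Submodule ℝ (RealSpace N) := Submodule.span ℝ (latticeMap N '' s)

lemma realPairing_eq_zero_of_realSpan {s : Set N} {u : DualLattice N} (h : ∀ x ∈ s, u x = 0)
    {y : RealSpace N} (hy : y ∈ realSpan s) : realPairing u y = 0 := by
  have : realSpan s ≤ LinearMap.ker (realPairing u) := by
    rw [Submodule.span_le]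
    rintro _ ⟨x, hx, rfl⟩
    simp [h x hx]
  exact this hy

lemma eq_zero_of_realSpan_eq_top {s : Set N} (hs : realSpan s = ⊤) {u : DualLattice N}
    (h : ∀ x ∈ s, u x = 0) : u = 0 := by
  ext y
  have := realPairing_eq_zero_of_realSpan h (y := latticeMap N y) (by rw [hs]; trivial)
  simpa using this

/-- The kernel of a nonzero form is spanned by the lattice vectors in it. -/
lemma ker_realPairing_le_realSpan {u : DualLattice N} (hu : u ≠ 0) :
    LinearMap.ker (realPairing u) ≤ realSpan {y | u y = 0} := by
  obtain ⟨v, hv⟩ : ∃ v, u v ≠ 0 := by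
    by_contra! h
    exact hu (LinearMap.ext h)
  have key : ∀ y : RealSpace N, (u v : ℝ) • y - realPairing u y • latticeMap N v ∈
      realSpan {y | u y = 0} := by
    intro y
    refine TensorProduct.induction_on y (by simp) (fun r x => ?_) fun a b ha hb => ?_
    · have e : (u v : ℝ) • (r ⊗ₜ[ℤ] x) - realPairing u (r ⊗ₜ[ℤ] x) • latticeMap N v =
          r • latticeMap N (u v • x - u x • v) := by
        have e1 : latticeMap N x = (1 : ℝ) ⊗ₜ[ℤ] x := rfl
        have e2 : r ⊗ₜ[ℤ] x = r • latticeMap N x := by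
          rw [e1, TensorProduct.smul_tmul', smul_eq_mul, mul_one]
        rw [e2, map_smul, realPairing_latticeMap, map_sub, map_smul, map_smul,
          ← Int.cast_smul_eq_zsmul ℝ, ← Int.cast_smul_eq_zsmul ℝ, smul_eq_mul]
        module
      rw [e]
      refine Submodule.smul_mem _ _ (Submodule.subset_span ⟨_, ?_, rfl⟩)
      simp [mul_comm]
    · convert add_mem ha hb using 1
      rw [map_add]; module
  intro y hy
  have h1 := key y
  rw [LinearMap.mem_ker.1 hy, zero_smul, sub_zero] at h1
  exact (Submodule.smul_mem_iff _ (by exact_mod_cast hv)).1 h1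

lemma span_hull (s : Set (RealSpace N)) :
    Submodule.span ℝ (PointedCone.hull ℝ s : Set (RealSpace N)) = Submodule.span ℝ s :=
  le_antisymm (Submodule.span_le.2 fun _ hx => PointedCone.hull_le_span (R := ℝ) s hx)
    (Submodule.span_mono PointedCone.subset_hull)

/-- A lattice vector outside the real span of `s` is detected by an integral form that vanishes
on `s`. -/
lemma exists_dual_ne_zero [Module.Finite ℤ N] {s : Set N} {y : N}
    (hy : latticeMap N y ∉ realSpan s) : ∃ u : DualLattice N, (∀ x ∈ s, u x = 0) ∧ u y ≠ 0 := by
  let τ := PointedCone.hull ℝ (latticeMap N '' s)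
  have hτ : ∀ x, x ∈ latticeSpan τ ↔ latticeMap N x ∈ realSpan s := fun x => by
    change latticeMap N x ∈ Submodule.span ℝ (τ : Set (RealSpace N)) ↔ _
    rw [span_hull]
  have h1 : (latticeSpan τ).mkQ y ≠ 0 := by
    rw [Submodule.mkQ_apply, ne_eq, Submodule.Quotient.mk_eq_zero, hτ]
    exact hy
  obtain ⟨w, hw⟩ : ∃ w : Module.Dual ℤ (QuotLattice τ), w ((latticeSpan τ).mkQ y) ≠ 0 := by
    by_contra! h
    exact h1 ((Module.forall_dual_apply_eq_zero_iff ℤ _).1 h)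
  refine ⟨w.comp (latticeSpan τ).mkQ, fun x hx => ?_, hw⟩
  have : (latticeSpan τ).mkQ x = 0 := by
    rw [Submodule.mkQ_apply, Submodule.Quotient.mk_eq_zero, hτ]
    exact Submodule.subset_span ⟨x, hx, rfl⟩
  rw [LinearMap.comp_apply, this, map_zero]

/-- The primitive inner facet normals of the cone generated by `s`. -/
def facets (s : Finset N) : Set (DualLattice N) :=
  {u | IsPrim u ∧ (∀ x ∈ s, 0 ≤ u x) ∧
    LinearMap.ker (realPairing u) ≤ realSpan {x | x ∈ s ∧ u x = 0}}

/-- A facet normal is determined by the generators on which it vanishes. -/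
lemma eq_of_facets {s : Finset N} (hs : realSpan (s : Set N) = ⊤) {u w : DualLattice N}
    (hu : u ∈ facets s) (hw : w ∈ facets s) (h : ∀ x ∈ s, u x = 0 → w x = 0) : w = u := by
  have h1 : ∀ y, u y = 0 → w y = 0 := by
    intro y hy
    have h2 : latticeMap N y ∈ LinearMap.ker (realPairing u) := by simp [hy]
    have h3 := realPairing_eq_zero_of_realSpan (u := w) (fun x hx => h x hx.1 hx.2) (hu.2.2 h2)
    simpa using h3
  refine (hu.1.eq_or_eq_neg hw.1 h1).resolve_right fun h2 => hu.1.ne_zero ?_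
  refine eq_zero_of_realSpan_eq_top hs fun x hx => le_antisymm ?_ (hu.2.1 x hx)
  have := hw.2.1 x hx
  rw [h2] at this
  simpa using this

lemma facets_finite {s : Finset N} (hs : realSpan (s : Set N) = ⊤) : (facets s).Finite := by
  classical
  refine Set.Finite.of_finite_image (f := fun u : DualLattice N => s.filter fun x => u x = 0)
    ((s.powerset.finite_toSet).subset ?_) ?_
  · rintro _ ⟨u, -, rfl⟩
    exact Finset.mem_coe.2 (Finset.mem_powerset.2 (Finset.filter_subset _ _))
  · intro u hu w hw h
    refine (eq_of_facets hs hu hw fun x hx h0 => ?_).symm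
    have : x ∈ s.filter fun x => u x = 0 := by simp [hx, h0]
    have h' : (s.filter fun x => u x = 0) = s.filter fun x => w x = 0 := h
    rw [h'] at this
    exact (Finset.mem_filter.1 this).2

/-- A nonzero form that is nonnegative on `s` can be tilted until it vanishes on a facet, without
losing any of its zeros on `s`. -/
lemma exists_facet [Module.Finite ℤ N] {s : Finset N} (hs : realSpan (s : Set N) = ⊤)
    {u : DualLattice N} (hu0 : u ≠ 0) (hu : ∀ x ∈ s, 0 ≤ u x) :
    ∃ w ∈ facets s, ∀ x ∈ s, u x = 0 → w x = 0 := by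
  classical
  induction hn : (s.filter fun x => u x ≠ 0).card using Nat.strong_induction_on generalizing u with
  | _ n ih =>
  -- Either the zeros of `u` on `s` span the hyperplane `u = 0`, and `u` is a multiple of a facet
  -- normal, or another form `w` vanishes on these zeros. In the latter case a multiple of `w` is
  -- added to a multiple of `u` until the sum vanishes at a further point `x₀` of `s`.
  by_cases hk : LinearMap.ker (realPairing u) ≤ realSpan {x | x ∈ s ∧ u x = 0}
  · obtain ⟨d, w, hd, rfl, v, hv⟩ := exists_eq_smul_of_ne_zero hu0
    have hz : ∀ x, (d • w) x = 0 ↔ w x = 0 := fun x => by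
      simp [hd.ne']
    refine ⟨w, ⟨isPrim_of_eq_one hv, fun x hx => ?_, ?_⟩, fun x _ h => (hz x).1 h⟩
    · have := hu x hx
      simp only [LinearMap.smul_apply, smul_eq_mul] at this
      exact nonneg_of_mul_nonneg_right this hd
    · intro y hy
      simp only [hz] at hk
      refine hk ?_
      rw [LinearMap.mem_ker] at hy ⊢
      rw [realPairing_smul, LinearMap.smul_apply, hy, smul_zero]
  · obtain ⟨y, hy0, hy⟩ : ∃ y, u y = 0 ∧ latticeMap N y ∉ realSpan {x | x ∈ s ∧ u x = 0} := by
      by_contra! h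
      refine hk ((ker_realPairing_le_realSpan hu0).trans (Submodule.span_le.2 ?_))
      rintro _ ⟨y, hy, rfl⟩
      exact h y hy
    obtain ⟨w₀, hw0, hw0y⟩ := exists_dual_ne_zero hy
    obtain ⟨w, hw, hwy, x₁, hx1, hx1'⟩ : ∃ w : DualLattice N, (∀ x ∈ s, u x = 0 → w x = 0) ∧
        w y ≠ 0 ∧ ∃ x ∈ s, w x < 0 := by
      obtain ⟨x, hx, hne⟩ : ∃ x ∈ s, w₀ x ≠ 0 := by
        by_contra! h
        exact hw0y (by rw [eq_zero_of_realSpan_eq_top hs h]; rfl)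
      rcases lt_or_gt_of_ne hne with h | h
      · exact ⟨w₀, fun x hx h0 => hw0 x ⟨hx, h0⟩, hw0y, x, hx, h⟩
      · exact ⟨-w₀, fun x hx h0 => by simp [hw0 x ⟨hx, h0⟩], by simpa using hw0y, x, hx,
          by simpa using h⟩
    obtain ⟨x₀, hx0, hmin⟩ := (s.filter fun x => w x < 0).exists_min_image
      (fun x => (u x : ℚ) / (-w x : ℤ)) ⟨x₁, by simp [hx1, hx1']⟩
    rw [Finset.mem_filter] at hx0
    have hpos : 0 < u x₀ := lt_of_le_of_ne (hu _ hx0.1) fun h => by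
      have := hw _ hx0.1 h.symm
      omega
    have hmin' : ∀ x ∈ s, w x < 0 → u x₀ * (-w x) ≤ u x * (-w x₀) := by
      intro x hx hwx
      have := hmin x (by simp [hx, hwx])
      rw [div_le_div_iff₀ (by exact_mod_cast (by omega)) (by exact_mod_cast (by omega))] at this
      exact_mod_cast this
    let u' : DualLattice N := (-w x₀) • u + u x₀ • w
    have hu' : ∀ x, u' x = (-w x₀) * u x + u x₀ * w x := fun x => rfl
    have hu'z : ∀ x ∈ s, u x = 0 → u' x = 0 := fun x hx h => by
      rw [hu', h, hw x hx h]; simp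
    have hne : u' ≠ 0 := by
      intro h
      have := hu' y
      rw [h, hy0] at this
      simp only [LinearMap.zero_apply, mul_zero, zero_add] at this
      exact (mul_ne_zero hpos.ne' hwy) this.symm
    have hnn : ∀ x ∈ s, 0 ≤ u' x := by
      intro x hx
      rw [hu']
      have h1 := hu x hx
      rcases lt_or_ge (w x) 0 with h | h
      · have := hmin' x hx h
        nlinarith
      · have h2 : 0 ≤ (-w x₀) * u x := mul_nonneg (by omega) h1
        have h3 := mul_nonneg hpos.le h
        omega
    obtain ⟨z, hz, hz'⟩ := ih _ (by
      rw [← hn]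
      refine Finset.card_lt_card ⟨fun x hx => ?_, fun hsub => ?_⟩
      · rw [Finset.mem_filter] at hx ⊢
        exact ⟨hx.1, fun h => hx.2 (hu'z x hx.1 h)⟩
      · have := hsub (x := x₀) (by simp [hx0.1, hpos.ne'])
        rw [Finset.mem_filter, hu'] at this
        exact this.2 (by ring)) hne hnn rfl
    exact ⟨z, hz, fun x hx h => hz' x hx (hu'z x hx h)⟩

end Facets

/-! ### Hilbert series of polyhedral cones are rational -/

section Rationality

variable {N : Type*} [AddCommGroup N]

lemma exists_coeff_of_finite {T : DualLattice N → ℤ} (h : (Function.support T).Finite) :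
    ∃ p : Laurent N, ∀ u, T u = p.coeff u :=
  ⟨⟨Finsupp.ofSupportFinite T h⟩, fun _ => rfl⟩

lemma mulSeries_congr {q : Laurent N} {S S' : DualLattice N → ℤ} {w w' : DualLattice N}
    (h : ∀ z ∈ q.coeff.support, S (w - z) = S' (w' - z)) :
    mulSeries q S w = mulSeries q S' w' :=
  Finset.sum_congr rfl fun z hz => by simp only [h z hz]

lemma exists_of_mulSeries_ne_zero {q : Laurent N} {S : DualLattice N → ℤ} {w : DualLattice N}
    (h : mulSeries q S w ≠ 0) : ∃ z ∈ q.coeff.support, S (w - z) ≠ 0 := by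
  by_contra! h0
  exact h (Finset.sum_eq_zero fun z hz => by simp only [h0 z hz, mul_zero])

open Classical in
/-- The indicator function of the lattice points of the cone dual to the one generated by `s`. -/
def coneInd (s : Finset N) (w : DualLattice N) : ℤ := if ∀ x ∈ s, 0 ≤ w x then 1 else 0

lemma coneInd_ne_zero {s : Finset N} {w : DualLattice N} :
    coneInd s w ≠ 0 ↔ ∀ x ∈ s, 0 ≤ w x := by
  unfold coneInd; split_ifs with h
  · exact ⟨fun _ => h, fun _ => one_ne_zero⟩
  · exact ⟨fun h0 => absurd rfl h0, fun h' => absurd h' h⟩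

lemma coneInd_congr {s : Finset N} {w w' : DualLattice N}
    (h : (∀ x ∈ s, 0 ≤ w x) ↔ ∀ x ∈ s, 0 ≤ w' x) : coneInd s w = coneInd s w' := by
  unfold coneInd; rw [if_congr h rfl rfl]

lemma support_prod_binom {s : Finset N} (U : Finset (DualLattice N))
    (hU : ∀ u ∈ U, ∀ x ∈ s, 0 ≤ u x) :
    ∀ z ∈ (∏ u ∈ U, binom u).coeff.support, ∀ x ∈ s, 0 ≤ z x ∧ z x ≤ ∑ u ∈ U, u x := by
  classical
  induction U using Finset.induction_on with
  | empty =>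
    intro z hz x _
    rw [Finset.prod_empty, AddMonoidAlgebra.one_def, Finsupp.mem_support_iff,
      AddMonoidAlgebra.coeff_single, Finsupp.single_apply] at hz
    have : 0 = z := by by_contra h; exact hz (if_neg h)
    simp [← this]
  | insert a U ha ih =>
    have ih' := ih fun u hu => hU u (Finset.mem_insert_of_mem hu)
    have hax := hU a (Finset.mem_insert_self _ _)
    intro z hz x hx
    rw [Finset.prod_insert ha, Finsupp.mem_support_iff, ← mulSeries_coeff, mulSeries_binom] at hz
    rw [Finset.sum_insert ha]
    have h0 := hax x hx
    by_cases h1 : (∏ u ∈ U, binom u).coeff z = 0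
    · have h2 : (∏ u ∈ U, binom u).coeff (z - a) ≠ 0 := fun h => hz (by rw [h1, h, sub_zero])
      have h3 := ih' _ (Finsupp.mem_support_iff.2 h2) x hx
      rw [LinearMap.sub_apply] at h3
      omega
    · have h3 := ih' _ (Finsupp.mem_support_iff.2 h1) x hx
      omega

lemma exists_dual_ne_zero_of_ne_zero [Module.Free ℤ N] [Module.Finite ℤ N] (x : N) (hx : x ≠ 0) :
    ∃ ℓ : N →ₗ[ℤ] ℤ, ℓ x ≠ 0 := by
  by_contra! h
  exact hx ((Module.forall_dual_apply_eq_zero_iff ℤ x).1 h)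

/-- The product of `1 - x^u` over the facet normals `u`, a denominator of the Hilbert series. -/
def facetProd {s : Finset N} (hs : realSpan (s : Set N) = ⊤) : Laurent N :=
  ∏ u ∈ (facets_finite hs).toFinset, binom u

/-- The leading form of the denominator of the Hilbert series. -/
def facetForm {s : Finset N} (hs : realSpan (s : Set N) = ⊤) : Poly N :=
  ∏ u ∈ (facets_finite hs).toFinset, -SymmetricAlgebra.ι ℤ _ u

lemma hasLead_facetProd {s : Finset N} (hs : realSpan (s : Set N) = ⊤) :
    HasLead (facetProd hs) (facets_finite hs).toFinset.card (facetForm hs) :=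
  hasLead_prod_binom _

lemma ι_ne_zero {u : DualLattice N} (hu : u ≠ 0) : SymmetricAlgebra.ι ℤ _ u ≠ 0 :=
  (map_ne_zero_iff _ ι_injective).2 hu

variable [Module.Free ℤ N] [Module.Finite ℤ N]

/-- If no facet normal vanishes on `J`, then a form that is nonnegative on the cone and bounded
on `J` is bounded on the cone. -/
lemma exists_bound {s J : Finset N} (hs : realSpan (s : Set N) = ⊤) (hJ : J ⊆ s)
    (hhit : ∀ u ∈ facets s, ∃ x ∈ J, u x ≠ 0) (K : N → ℤ) {y : N} (hy : y ∈ s) :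
    ∃ B : ℤ, ∀ w : DualLattice N, (∀ x ∈ s, 0 ≤ w x) → (∀ x ∈ J, w x < K x) → w y ≤ B := by
  classical
  rcases farkas exists_dual_ne_zero_of_ne_zero (s.disjSum J) (Sum.elim id Neg.neg) (-y) with
    ⟨m, hm, hmem⟩ | ⟨ℓ, h1, h2⟩
  · have key : ∃ B : ℤ, ∀ w : DualLattice N, (∀ x ∈ s, 0 ≤ w x) → (∀ x ∈ J, w x < K x) →
        -w (m • -y) ≤ B := by
      refine Submodule.span_induction
        (p := fun z _ => ∃ B : ℤ, ∀ w : DualLattice N, (∀ x ∈ s, 0 ≤ w x) →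
          (∀ x ∈ J, w x < K x) → -w z ≤ B) ?_ ⟨0, by simp⟩ ?_ ?_ hmem
      · rintro _ ⟨i | i, hi, rfl⟩
        · rw [Finset.mem_coe, Finset.inl_mem_disjSum] at hi
          exact ⟨0, fun w hw _ => by simpa using hw i hi⟩
        · rw [Finset.mem_coe, Finset.inr_mem_disjSum] at hi
          exact ⟨K i, fun w _ hw => by simpa using (hw i hi).le⟩
      · rintro a b _ _ ⟨A, hA⟩ ⟨B, hB⟩
        exact ⟨A + B, fun w h h' => by
          have := hA w h h'
          have := hB w h h'
          rw [map_add]; omega⟩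
      · rintro c a _ ⟨A, hA⟩
        refine ⟨(c : ℤ) * A, fun w h h' => ?_⟩
        have e : w (c • a) = (c : ℤ) * w a := map_smul w (c : ℤ) a
        rw [e, ← mul_neg]
        exact mul_le_mul_of_nonneg_left (hA w h h') c.2
    obtain ⟨B, hB⟩ := key
    refine ⟨B, fun w h h' => ?_⟩
    have h1 := hB w h h'
    have h2 := h y hy
    rw [map_smul, map_neg, smul_eq_mul, mul_neg, neg_neg] at h1
    nlinarith
  · exfalso
    have hs' : ∀ x ∈ s, 0 ≤ ℓ x := fun x hx => h1 (Sum.inl x) (by simpa using hx)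
    have hJ' : ∀ x ∈ J, ℓ x ≤ 0 := fun x hx => by
      simpa using h1 (Sum.inr x) (by simpa using hx)
    obtain ⟨u, hu, hu0⟩ := exists_facet hs (u := ℓ) (by rintro rfl; simp at h2) hs'
    obtain ⟨x, hx, hne⟩ := hhit u hu
    exact hne (hu0 x (hJ hx) (le_antisymm (hJ' x hx) (hs' x (hJ hx))))

/-- The support of the numerator is finite: far from a facet the factor `1 - x^u` of its normal
`u` cancels the series, and the points close to all facets form a bounded set. -/
lemma finite_support_facetProd {s : Finset N} (hs : realSpan (s : Set N) = ⊤) :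
    (Function.support (mulSeries (facetProd hs) (coneInd s))).Finite := by
  classical
  set U := (facets_finite hs).toFinset with hUdef
  have hU : ∀ u ∈ U, ∀ x ∈ s, 0 ≤ u x := fun u hu =>
    ((facets_finite hs).mem_toFinset.1 hu).2.1
  -- The exponents of the denominator take values between `0` and `K x` at a generator `x`.
  let K : N → ℤ := fun x => ∑ u ∈ U, u x
  let W : Finset N → Set (DualLattice N) := fun J =>
    {w | (∀ x ∈ s, 0 ≤ w x) ∧ ∀ x ∈ J, w x < K x}
  have hW : ∀ J ⊆ s, (∀ u ∈ facets s, ∃ x ∈ J, u x ≠ 0) → (W J).Finite := by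
    intro J hJ hhit
    choose! B hB using fun y (hy : y ∈ s) => exists_bound hs hJ hhit K hy
    let ev : DualLattice N → (s → ℤ) := fun w x => w x
    have hinj : Function.Injective ev := fun w w' h => by
      refine sub_eq_zero.1 (eq_zero_of_realSpan_eq_top hs fun x hx => ?_)
      rw [LinearMap.sub_apply, sub_eq_zero]
      exact congrFun h ⟨x, hx⟩
    refine Set.Finite.subset (Set.Finite.preimage hinj.injOn
      (Set.Finite.pi' fun x : s => Set.finite_Icc (0 : ℤ) (B x))) ?_
    intro w hw x
    exact ⟨hw.1 x x.2, hB x x.2 w hw.1 hw.2⟩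
  refine Set.Finite.subset (Set.Finite.biUnion (s := {J : Finset N | J ⊆ s ∧
    ∀ u ∈ facets s, ∃ x ∈ J, u x ≠ 0}) (s.powerset.finite_toSet.subset
      fun J hJ => by simpa using hJ.1) fun J hJ => hW J hJ.1 hJ.2) ?_
  intro w hw
  have hwK : w ∈ W (s.filter fun x => w x < K x) := by
    refine ⟨?_, fun x hx => (Finset.mem_filter.1 hx).2⟩
    obtain ⟨z, hz, hne⟩ := exists_of_mulSeries_ne_zero hw
    intro x hx
    have h1 := (support_prod_binom U hU z hz x hx).1
    have h2 := coneInd_ne_zero.1 hne x hx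
    rw [LinearMap.sub_apply] at h2
    omega
  refine Set.mem_biUnion ⟨Finset.filter_subset _ _, fun u hu => ?_⟩ hwK
  by_contra! hcon
  refine hw ?_
  -- Far from the facet with normal `u`, translation by `u` does not change the series.
  have huU : u ∈ U := (facets_finite hs).mem_toFinset.2 hu
  rw [facetProd, ← Finset.mul_prod_erase _ _ huU, mulSeries_mul, mulSeries_binom, sub_eq_zero]
  refine mulSeries_congr fun z hz => coneInd_congr ?_
  refine forall₂_congr fun x hx => ?_
  have h1 := support_prod_binom (s := s) (U.erase u)
    (fun u' hu' => hU u' (Finset.mem_of_mem_erase hu')) z hz x hx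
  have h2 : ∑ u' ∈ U.erase u, u' x + u x = K x := Finset.sum_erase_add _ _ huU
  simp only [LinearMap.sub_apply]
  by_cases h0 : u x = 0
  · rw [h0, sub_zero]
  · have h3 : K x ≤ w x := by
      by_contra! hlt
      exact h0 (hcon x (Finset.mem_filter.2 ⟨hx, hlt⟩))
    have h4 := hU u huU x hx
    constructor <;> intro <;> omega

lemma exists_numerator_facetProd {s : Finset N} (hs : realSpan (s : Set N) = ⊤) :
    ∃ p : Laurent N, ∀ u, mulSeries (facetProd hs) (coneInd s) u = p.coeff u :=
  exists_coeff_of_finite (finite_support_facetProd hs)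

lemma facetForm_ne_zero {s : Finset N} (hs : realSpan (s : Set N) = ⊤) : facetForm hs ≠ 0 := by
  rw [facetForm, Finset.prod_ne_zero_iff]
  intro u hu
  exact neg_ne_zero.2 (ι_ne_zero ((facets_finite hs).mem_toFinset.1 hu).1.ne_zero)

end Rationality

/-! ### Faces of rational cones -/

section Faces

variable {N : Type*} [AddCommGroup N]

/-- A face is generated by the generators that it contains. -/
lemma face_eq_hull {V : Type*} [AddCommGroup V] [Module ℝ V] {t : Set V} {τ : PointedCone ℝ V}
    (hτ : τ.IsFaceOf (PointedCone.hull ℝ t)) : τ = PointedCone.hull ℝ {x | x ∈ t ∧ x ∈ τ} := by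
  refine le_antisymm (fun z hz => ?_) (Submodule.span_le.2 fun x hx => hx.2)
  have key : ∀ z ∈ PointedCone.hull ℝ t, z ∈ τ → z ∈ PointedCone.hull ℝ {x | x ∈ t ∧ x ∈ τ} := by
    intro z hz
    refine Submodule.span_induction
      (p := fun z _ => z ∈ τ → z ∈ PointedCone.hull ℝ {x | x ∈ t ∧ x ∈ τ}) ?_ ?_ ?_ ?_ hz
    · exact fun x hx h => Submodule.subset_span ⟨hx, h⟩
    · exact fun _ => zero_mem _
    · exact fun a b ha hb h1 h2 h => add_mem (h1 (hτ.mem_of_add_mem_left ha hb h))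
        (h2 (hτ.mem_of_add_mem_right ha hb h))
    · intro c a ha h1 h
      rcases eq_or_lt_of_le c.2 with h0 | h0
      · have : c = 0 := Subtype.ext h0.symm
        rw [this, zero_smul]; exact zero_mem _
      · refine Submodule.smul_mem _ c (h1 (hτ.2 (a := (c : ℝ)) ha (zero_mem _) h0 ?_))
        rw [add_zero]; exact h
  exact key z (hτ.le hz) hz

variable [Module.Free ℤ N] [Module.Finite ℤ N]

/-- Faces of rational cones are exposed by integral forms. -/
lemma exists_exposing (s : Finset N) {τ : PointedCone ℝ (RealSpace N)}
    (hτ : τ.IsFaceOf (PointedCone.hull ℝ (latticeMap N '' (s : Set N)))) :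
    ∃ w : DualLattice N, (∀ x ∈ s, latticeMap N x ∈ τ → w x = 0) ∧
      ∀ x ∈ s, latticeMap N x ∉ τ → 0 < w x := by
  classical
  set σ := PointedCone.hull ℝ (latticeMap N '' (s : Set N)) with hσ
  have hsσ : ∀ x ∈ s, latticeMap N x ∈ σ := fun x hx => Submodule.subset_span ⟨x, hx, rfl⟩
  -- For each generator `y` outside `τ`, Farkas' lemma separates `-y` from the cone generated by
  -- `s` and the negatives of the generators in `τ`. The sum of the separating forms exposes `τ`.
  have key : ∀ y ∈ s, latticeMap N y ∉ τ → ∃ w : DualLattice N, (∀ x ∈ s, 0 ≤ w x) ∧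
      (∀ x ∈ s, latticeMap N x ∈ τ → w x = 0) ∧ 0 < w y := by
    intro y hy hyτ
    let J := s.filter fun x => latticeMap N x ∈ τ
    rcases farkas exists_dual_ne_zero_of_ne_zero (s.disjSum J) (Sum.elim id Neg.neg) (-y) with
      ⟨m, hm, hmem⟩ | ⟨ℓ, h1, h2⟩
    · exfalso
      have h3 : ∃ t ∈ τ, latticeMap N (m • -y) + t ∈ σ := by
        refine Submodule.span_induction
          (p := fun z _ => ∃ t ∈ τ, latticeMap N z + t ∈ σ) ?_ ⟨0, zero_mem _, by simp⟩ ?_ ?_ hmem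
        · rintro _ ⟨i | i, hi, rfl⟩
          · rw [Finset.mem_coe, Finset.inl_mem_disjSum] at hi
            exact ⟨0, zero_mem _, by simpa using hsσ i hi⟩
          · rw [Finset.mem_coe, Finset.inr_mem_disjSum] at hi
            exact ⟨latticeMap N i, (Finset.mem_filter.1 hi).2, by simp⟩
        · rintro a b _ _ ⟨t, ht, h⟩ ⟨t', ht', h'⟩
          refine ⟨t + t', add_mem ht ht', ?_⟩
          convert add_mem h h' using 1
          rw [map_add]; abel
        · rintro c a _ ⟨t, ht, h⟩
          have hc : (0 : ℝ) ≤ ((c : ℤ) : ℝ) := by exact_mod_cast c.2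
          refine ⟨((c : ℤ) : ℝ) • t, τ.smul_mem hc ht, ?_⟩
          have e : latticeMap N (c • a) = ((c : ℤ) : ℝ) • latticeMap N a := by
            rw [Int.cast_smul_eq_zsmul]
            exact map_smul (latticeMap N) (c : ℤ) a
          rw [e, ← smul_add]
          exact σ.smul_mem hc h
      obtain ⟨t, ht, h⟩ := h3
      refine hyτ (hτ.2 (a := (m : ℝ)) (hsσ y hy) h (by exact_mod_cast hm) ?_)
      convert ht using 1
      rw [map_smul, map_neg, ← Int.cast_smul_eq_zsmul ℝ]
      module
    · have hs' : ∀ x ∈ s, 0 ≤ ℓ x := fun x hx => h1 (Sum.inl x) (by simpa using hx)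
      refine ⟨ℓ, hs', fun x hx hxτ => le_antisymm ?_ (hs' x hx), by simpa using h2⟩
      simpa using h1 (Sum.inr x) (by simp [J, hx, hxτ])
  choose! w hw1 hw2 hw3 using key
  refine ⟨∑ y ∈ s.filter fun y => latticeMap N y ∉ τ, w y, fun x hx hxτ => ?_,
    fun x hx hxτ => ?_⟩
  · rw [LinearMap.sum_apply]
    refine Finset.sum_eq_zero fun y hy => ?_
    rw [Finset.mem_filter] at hy
    exact hw2 y hy.1 hy.2 x hx hxτ
  · rw [LinearMap.sum_apply]
    refine Finset.sum_pos' (fun y hy => ?_) ⟨x, by simp [hx, hxτ], hw3 x hx hxτ⟩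
    rw [Finset.mem_filter] at hy
    exact hw1 y hy.1 hy.2 x hx

end Faces

/-! ### Numerical values of Hilbert series -/

lemma dense_eval_ne_zero {ι : Type*} [Fintype ι] {P : MvPolynomial ι ℝ} (hP : P ≠ 0) :
    Dense {t : ι → ℝ | MvPolynomial.eval t P ≠ 0} := by
  rw [dense_iff_inter_open]
  rintro U hU ⟨t, ht⟩
  by_contra hcon
  obtain ⟨δ, hδ, hball⟩ := Metric.isOpen_iff.1 hU t ht
  refine hP (MvPolynomial.funext_set (fun i => Metric.ball (t i) δ) (fun i => ?_) fun x hx => ?_)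
  · rw [Real.ball_eq_Ioo]
    exact Set.Ioo_infinite (by linarith)
  · rw [map_zero]
    by_contra h
    refine hcon ⟨x, hball ?_, h⟩
    rw [ball_pi t hδ]
    exact hx

section Numeric

variable {N : Type*} [AddCommGroup N]

/-- The general term of the series `∑_w S w e^{-⟨w, v⟩}`. -/
def expTerm (S : DualLattice N → ℤ) (v : RealSpace N) (w : DualLattice N) : ℝ :=
  S w * Real.exp (-realPairing w v)

/-- The value of the series `S` at the point `exp (-v)` of the real torus. -/
def expSum (S : DualLattice N → ℤ) (v : RealSpace N) : ℝ := ∑' w, expTerm S v w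

lemma hasSum_mulSeries {S : DualLattice N → ℤ} {v : RealSpace N} (hS : Summable (expTerm S v))
    (q : Laurent N) :
    HasSum (expTerm (mulSeries q S) v) (expEval (-v) q * expSum S v) := by
  induction q using AddMonoidAlgebra.induction_linear with
  | zero =>
    have h : expTerm (mulSeries 0 S) v = fun _ => 0 := by
      funext w
      simp [expTerm, mulSeries_zero_left]
    rw [h, map_zero, zero_mul]
    exact hasSum_zero
  | add x y hx hy =>
    rw [map_add, add_mul]
    convert hx.add hy using 1
    ext w
    simp only [expTerm, mulSeries_add_left, Int.cast_add, add_mul]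
  | single z a =>
    have h1 : HasSum (fun w => expTerm S v (w - z)) (expSum S v) :=
      (Equiv.subRight z).hasSum_iff.2 hS.hasSum
    rw [expEval_single]
    rw [mul_assoc]
    have h2 := (h1.mul_left (Real.exp (realPairing z (-v)))).mul_left (a : ℝ)
    have h3 : expTerm (mulSeries (AddMonoidAlgebra.single z a) S) v =
        fun w => (a : ℝ) * (Real.exp (realPairing z (-v)) * expTerm S v (w - z)) := by
      funext w
      simp only [expTerm, mulSeries_single, realPairing_sub, LinearMap.sub_apply, map_neg,
        Int.cast_mul]
      rw [show -realPairing w v = -realPairing z v + -(realPairing w v - realPairing z v) by ring,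
        Real.exp_add]
      ring
    rw [h3]
    exact h2

lemma hasSum_coeff (p : Laurent N) (v : RealSpace N) :
    HasSum (expTerm p.coeff v) (expEval (-v) p) := by
  classical
  induction p using AddMonoidAlgebra.induction_linear with
  | zero =>
    have h : expTerm (0 : Laurent N).coeff v = fun _ => 0 := by
      funext w
      simp [expTerm]
    rw [h, map_zero]
    exact hasSum_zero
  | add x y hx hy =>
    rw [map_add]
    convert hx.add hy using 1
    ext w
    simp [expTerm, add_mul]
  | single z a =>
    rw [expEval_single]
    have := hasSum_single (f := expTerm (AddMonoidAlgebra.single z a : Laurent N).coeff v) z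
      fun w hw => by simp [expTerm, hw.symm]
    simpa [expTerm] using this

lemma expEval_eq_mul_expSum {S : DualLattice N → ℤ} {v : RealSpace N}
    (hS : Summable (expTerm S v)) {p q : Laurent N} (h : ∀ u, mulSeries q S u = p.coeff u) :
    expEval (-v) p = expEval (-v) q * expSum S v := by
  have h1 := hasSum_mulSeries hS q
  rw [show mulSeries q S = p.coeff from funext h] at h1
  exact (hasSum_coeff p v).unique h1

/-- A point of `N_ℝ` at which no nonzero polynomial with integer coefficients vanishes. -/
def IsGeneric (v : RealSpace N) : Prop := ∀ F : Poly N, F ≠ 0 → evalAt v F ≠ 0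

lemma IsGeneric.injective {v : RealSpace N} (hv : IsGeneric v) :
    Function.Injective (evalAt v).toRingHom := by
  rw [injective_iff_map_eq_zero]
  intro F hF
  by_contra h
  exact hv F h hF

lemma evalAt_neg_of_isHom {d : ℕ} {F : Poly N} (hF : IsHom d F) (v : RealSpace N) :
    evalAt (-v) F = (-1) ^ d * evalAt v F := by
  rw [← hF, neg_one_smul]

lemma coneInd_eq_one {s : Finset N} {w : DualLattice N} (h : ∀ x ∈ s, 0 ≤ w x) :
    coneInd s w = 1 := by
  unfold coneInd
  exact if_pos h

lemma coneInd_eq_zero {s : Finset N} {w : DualLattice N} (h : ¬∀ x ∈ s, 0 ≤ w x) :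
    coneInd s w = 0 := by
  unfold coneInd
  exact if_neg h

lemma expTerm_coneInd_nonneg (s : Finset N) (v : RealSpace N) (w : DualLattice N) :
    0 ≤ expTerm (coneInd s) v w := by
  unfold expTerm coneInd
  split_ifs <;> simp [Real.exp_nonneg]

lemma hilbertCoeff_hull (s : Finset N) :
    hilbertCoeff (PointedCone.hull ℝ (latticeMap N '' (s : Set N))) = coneInd s := by
  funext u
  unfold hilbertCoeff coneInd
  congr 1
  refine propext ⟨fun h x hx => ?_, fun h v hv => ?_⟩
  · have := h _ (Submodule.subset_span ⟨x, hx, rfl⟩)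
    rw [realPairing_latticeMap] at this
    exact_mod_cast this
  · refine nonneg_of_mem_hull (ℓ := realPairing u) ?_ hv
    rintro _ ⟨x, hx, rfl⟩
    rw [realPairing_latticeMap]
    exact_mod_cast h x hx

lemma finrank_realSpace [Module.Free ℤ N] :
    Module.finrank ℝ (RealSpace N) = Module.finrank ℤ N :=
  Module.finrank_baseChange

variable [Module.Free ℤ N] [Module.Finite ℤ N]

/-- The value of a rational function at a generic point. -/
def ratEval {v : RealSpace N} (hv : IsGeneric v) : RatFun N →+* ℝ :=
  IsFractionRing.lift (A := Poly N) (g := (evalAt v).toRingHom) hv.injective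

@[simp] lemma ratEval_algebraMap {v : RealSpace N} (hv : IsGeneric v) (F : Poly N) :
    ratEval hv (algebraMap _ _ F) = evalAt v F :=
  IsFractionRing.lift_algebraMap _ _

/-- The multiplicity of `S` gives the growth of the sums `∑_w S w e^{-ε⟨w, v⟩}` as `ε → 0`. -/
lemma HasMult.tendsto {S : DualLattice N → ℤ} {k : ℕ} {x : RatFun N} (hx : HasMult S k x)
    {v : RealSpace N} (hv : IsGeneric v)
    (hS : ∀ ε : ℝ, 0 < ε → Summable (expTerm S (ε • v))) :
    Tendsto (fun ε : ℝ => ε ^ k * expSum S (ε • v)) (𝓝[>] 0) (𝓝 (ratEval hv x)) := by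
  obtain ⟨p, q, d, F, G, h1, h2, h3, h4, rfl⟩ := hx
  have hG : evalAt (-v) G ≠ 0 := by
    rw [evalAt_neg_of_isHom h2.isHom]
    exact mul_ne_zero (by simp) (hv G h3)
  have t := (h1.tendsto (-v)).div (h2.tendsto (-v)) hG
  have e : ratEval hv ((-1) ^ k * (algebraMap _ (RatFun N) F / algebraMap _ (RatFun N) G)) =
      evalAt (-v) F / evalAt (-v) G := by
    rw [evalAt_neg_of_isHom h2.isHom, evalAt_neg_of_isHom h1.isHom, map_mul, map_div₀, map_pow,
      map_neg, map_one, ratEval_algebraMap, ratEval_algebraMap, pow_add]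
    have := hv G h3
    have h5 : ((-1 : ℝ) ^ k) * (-1) ^ k = 1 := by rw [← mul_pow]; simp
    have h6 : ((-1 : ℝ) ^ k) ≠ 0 := by simp
    have h7 : ((-1 : ℝ) ^ d) ≠ 0 := by simp
    field_simp
    linear_combination evalAt v F * h5
  rw [e]
  refine t.congr' ?_
  have hq : ∀ᶠ ε : ℝ in 𝓝[>] 0, expEval (ε • -v) q / ε ^ (d + k) ≠ 0 :=
    (h2.tendsto (-v)).eventually_ne hG
  filter_upwards [self_mem_nhdsWithin, hq] with ε hε hqε
  have hε' : (0 : ℝ) < ε := hε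
  have h5 := expEval_eq_mul_expSum (hS ε hε') h4
  rw [← smul_neg] at h5
  simp only [Pi.div_apply]
  have h6 : expEval (ε • -v) q ≠ 0 := fun h => hqε (by rw [h, zero_div])
  rw [h5, pow_add]
  field_simp

/-! ### Generic points in the interior of a cone -/

instance : Countable (Poly N) := by
  let e := (SymmetricAlgebra.equivMvPolynomial (Module.Free.chooseBasis ℤ (DualLattice N)))
  have : Countable (MvPolynomial (Module.Free.ChooseBasisIndex ℤ (DualLattice N)) ℤ) :=
    (AddMonoidAlgebra.coeffEquiv (R := ℤ)).injective.countable
  exact e.injective.countable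

lemma exists_basis_of_realSpan {s : Finset N} (hs : realSpan (s : Set N) = ⊤) :
    ∃ b : Fin (Module.finrank ℤ N) → N, (∀ i, b i ∈ s) ∧ Function.Injective b ∧
      Submodule.span ℝ (Set.range fun i => latticeMap N (b i)) = ⊤ := by
  obtain ⟨t, hts, hspan, hli⟩ := exists_linearIndependent ℝ (latticeMap N '' (s : Set N))
  have hspan' : Submodule.span ℝ t = ⊤ := hspan.trans hs
  let B : Module.Basis t ℝ (RealSpace N) :=
    Module.Basis.mk hli (by rw [Subtype.range_coe, hspan'])
  have : Finite t := Module.Finite.finite_basis B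
  have := Fintype.ofFinite t
  have hcard : Fintype.card t = Module.finrank ℤ N := by
    rw [← finrank_realSpace, Module.finrank_eq_card_basis B]
  let e := (Fintype.equivFinOfCardEq hcard).symm
  choose g hg hgt using fun i => hts (e i).2
  refine ⟨g, hg, fun i j h => ?_, ?_⟩
  · apply e.injective
    apply Subtype.ext
    rw [← hgt, ← hgt, h]
  · rw [eq_top_iff, ← hspan']
    refine Submodule.span_mono fun x hx => ?_
    exact ⟨e.symm ⟨x, hx⟩, by simp [hgt]⟩

/-- `v` lies in the translate of the cone generated by `s` by the sum of its generators. -/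
def IsDeep (s : Finset N) (v : RealSpace N) : Prop :=
  ∀ w : DualLattice N, (∀ x ∈ s, 0 ≤ w x) → ((∑ x ∈ s, w x : ℤ) : ℝ) ≤ realPairing w v

/-- The interior of a full-dimensional rational cone contains generic points, by Baire's
theorem. -/
lemma exists_generic {s : Finset N} (hs : realSpan (s : Set N) = ⊤) :
    ∃ v, IsDeep s v ∧ IsGeneric v := by
  obtain ⟨b, hbs, -, hb⟩ := exists_basis_of_realSpan hs
  let v₀ : RealSpace N := ∑ x ∈ s, latticeMap N x
  let b' : Fin (Module.finrank ℤ N) → RealSpace N := fun i => latticeMap N (b i)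
  have hne : ∀ F : Poly N, F ≠ 0 → affinePullback v₀ b' F ≠ 0 := by
    intro F hF h
    refine hF (eq_zero_of_evalAt F fun v => ?_)
    have hv : v - v₀ ∈ Submodule.span ℝ (Set.range b') := by rw [hb]; trivial
    obtain ⟨t, ht⟩ := (Submodule.mem_span_range_iff_exists_fun ℝ).1 hv
    have := eval_affinePullback v₀ b' t F
    rw [h, map_zero, ht] at this
    rw [this]; congr 2; abel
  have hdense : Dense (⋂ F : {F : Poly N // F ≠ 0},
      {t : Fin (Module.finrank ℤ N) → ℝ | MvPolynomial.eval t (affinePullback v₀ b' F) ≠ 0}) := by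
    refine dense_iInter_of_isOpen (fun F => ?_) fun F => dense_eval_ne_zero (hne F F.2)
    exact isOpen_ne_fun (MvPolynomial.continuous_eval _) continuous_const
  obtain ⟨t, htpos, ht⟩ := hdense.inter_open_nonempty (Set.univ.pi fun _ => Set.Ioi 0)
    (isOpen_set_pi Set.finite_univ fun _ _ => isOpen_Ioi)
    ⟨fun _ => 1, fun _ _ => Set.mem_Ioi.2 one_pos⟩
  refine ⟨v₀ + ∑ i, t i • b' i, fun w hw => ?_, fun F hF => ?_⟩
  · simp only [v₀, b', map_add, map_sum, realPairing_latticeMap, map_smul, smul_eq_mul]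
    push_cast
    refine le_add_of_nonneg_right (Finset.sum_nonneg fun i _ => mul_nonneg ?_ ?_)
    · exact (htpos i trivial).le
    · exact_mod_cast hw _ (hbs i)
  · have := Set.mem_iInter.1 ht ⟨F, hF⟩
    rwa [Set.mem_ofPred_eq, eval_affinePullback] at this

/-! ### The order of the pole of a Hilbert series -/

lemma sum_prod_pow_le {n : ℕ} (A : Finset (Fin n → ℕ)) {r : ℝ} (h0 : 0 ≤ r) (h1 : r < 1) :
    ∑ a ∈ A, ∏ i, r ^ a i ≤ ((1 - r)⁻¹) ^ n := by
  classical
  let K := A.sup (fun a => Finset.univ.sup a) + 1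
  have hA : A ⊆ Fintype.piFinset fun _ => Finset.range K := by
    intro a ha
    rw [Fintype.mem_piFinset]
    intro i
    rw [Finset.mem_range, Nat.lt_succ_iff]
    exact (Finset.le_sup (Finset.mem_univ i)).trans
      (Finset.le_sup (f := fun a : Fin n → ℕ => Finset.univ.sup a) ha)
  refine (Finset.sum_le_sum_of_subset_of_nonneg hA fun a _ _ =>
    Finset.prod_nonneg fun i _ => pow_nonneg h0 _).trans ?_
  rw [← Finset.prod_univ_sum (fun _ => Finset.range K) fun _ j => r ^ j, Finset.prod_const,
    Finset.card_univ, Fintype.card_fin]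
  refine pow_le_pow_left₀ (Finset.sum_nonneg fun i _ => pow_nonneg h0 _) ?_ n
  rw [← tsum_geometric_of_lt_one h0 h1]
  exact (summable_geometric_of_lt_one h0 h1).sum_le_tsum _ fun i _ => pow_nonneg h0 _

/-- The lattice points of the dual cone embed into an orthant. -/
lemma sum_expTerm_le {s : Finset N} (hs : realSpan (s : Set N) = ⊤) {v : RealSpace N}
    (hv : IsDeep s v) {ε : ℝ} (hε : 0 < ε) (A : Finset (DualLattice N)) :
    ∑ w ∈ A, expTerm (coneInd s) (ε • v) w ≤
      ((1 - Real.exp (-ε))⁻¹) ^ Module.finrank ℤ N := by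
  have := Classical.decEq N
  obtain ⟨b, hbs, hbinj, hb⟩ := exists_basis_of_realSpan hs
  -- A lattice point is determined by its values at `n` independent generators.
  let φ : DualLattice N → (Fin (Module.finrank ℤ N) → ℕ) := fun w i => (w (b i)).toNat
  let A' := A.filter fun w => ∀ x ∈ s, 0 ≤ w x
  have h1 : ∑ w ∈ A, expTerm (coneInd s) (ε • v) w =
      ∑ w ∈ A', expTerm (coneInd s) (ε • v) w := by
    rw [Finset.sum_filter]
    refine Finset.sum_congr rfl fun w _ => ?_
    split_ifs with h
    · rfl
    · rw [expTerm, coneInd_eq_zero h]; simp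
  have hinj : Set.InjOn φ A' := by
    intro w hw w' hw' h
    have hw := (Finset.mem_filter.1 hw).2
    have hw' := (Finset.mem_filter.1 hw').2
    have h2 : realPairing (w - w') = 0 := by
      refine LinearMap.ext_on_range hb fun i => ?_
      have := congrFun h i
      have h3 := hw _ (hbs i)
      have h4 := hw' _ (hbs i)
      rw [realPairing_latticeMap, LinearMap.sub_apply, LinearMap.zero_apply]
      simp only [φ] at this
      exact_mod_cast (by omega : w (b i) - w' (b i) = 0)
    refine sub_eq_zero.1 (LinearMap.ext fun y => ?_)
    have := LinearMap.congr_fun h2 (latticeMap N y)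
    rw [realPairing_latticeMap, LinearMap.zero_apply] at this
    exact_mod_cast this
  rw [h1]
  refine le_trans ?_ (sum_prod_pow_le (A'.image φ) (Real.exp_nonneg (-ε))
    (by rw [← Real.exp_zero]; exact Real.exp_lt_exp.2 (by linarith)))
  rw [Finset.sum_image hinj]
  refine Finset.sum_le_sum fun w hw => ?_
  have hw := (Finset.mem_filter.1 hw).2
  rw [expTerm, coneInd_eq_one hw, Int.cast_one, one_mul]
  simp only [← Real.exp_nat_mul, ← Real.exp_sum]
  rw [Real.exp_le_exp, map_smul, smul_eq_mul]
  have h2 : ∑ i, w (b i) ≤ ∑ x ∈ s, w x := by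
    rw [← Finset.sum_image (s := Finset.univ) (g := b) (f := fun x => w x) hbinj.injOn]
    refine Finset.sum_le_sum_of_subset_of_nonneg (fun x hx => ?_) fun x hx _ => hw x hx
    obtain ⟨i, -, rfl⟩ := Finset.mem_image.1 hx
    exact hbs i
  have h3 := hv w hw
  have h4 : ((∑ i, w (b i) : ℤ) : ℝ) ≤ realPairing w v := le_trans (by exact_mod_cast h2) h3
  have h5 : ∑ i, (φ w i : ℝ) * -ε = -(ε * ((∑ i, w (b i) : ℤ) : ℝ)) := by
    push_cast
    rw [Finset.mul_sum, ← Finset.sum_neg_distrib]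
    refine Finset.sum_congr rfl fun i _ => ?_
    have : ((φ w i : ℕ) : ℝ) = (w (b i) : ℝ) := by
      have h6 : ((w (b i)).toNat : ℤ) = w (b i) := Int.toNat_of_nonneg (hw _ (hbs i))
      exact_mod_cast congrArg (Int.cast : ℤ → ℝ) h6
    rw [this]; ring
  rw [h5, neg_le_neg_iff]
  exact mul_le_mul_of_nonneg_left h4 hε.le

lemma summable_coneInd {s : Finset N} (hs : realSpan (s : Set N) = ⊤) {v : RealSpace N}
    (hv : IsDeep s v) {ε : ℝ} (hε : 0 < ε) : Summable (expTerm (coneInd s) (ε • v)) :=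
  summable_of_sum_le (expTerm_coneInd_nonneg s _) (sum_expTerm_le hs hv hε)

lemma pow_mul_expSum_le {s : Finset N} (hs : realSpan (s : Set N) = ⊤) {v : RealSpace N}
    (hv : IsDeep s v) {ε : ℝ} (hε : 0 < ε) (hε1 : ε ≤ 1) :
    ε ^ Module.finrank ℤ N * expSum (coneInd s) (ε • v) ≤ 2 ^ Module.finrank ℤ N := by
  have h1 : expSum (coneInd s) (ε • v) ≤ _ :=
    (summable_coneInd hs hv hε).tsum_le_of_sum_le (sum_expTerm_le hs hv hε)
  refine (mul_le_mul_of_nonneg_left h1 (by positivity)).trans ?_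
  rw [← mul_pow]
  have h2 : Real.exp (-ε) ≤ (1 + ε)⁻¹ := by
    rw [Real.exp_neg]
    exact inv_anti₀ (by linarith) (by linarith [Real.add_one_le_exp ε])
  have h3 : ε / 2 ≤ 1 - Real.exp (-ε) := by
    have : (1 + ε)⁻¹ ≤ 1 - ε / 2 := by
      rw [inv_le_iff_one_le_mul₀ (by linarith)]
      nlinarith
    linarith
  have h4 : 0 < 1 - Real.exp (-ε) := by linarith
  refine pow_le_pow_left₀ (by positivity) ?_ _
  rw [← div_eq_mul_inv, div_le_iff₀ h4]
  linarith

/-- The dual of a strictly convex cone contains a full-dimensional orthant of lattice points. -/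
lemma exists_le_pow_mul_expSum {s : Finset N} (hs : realSpan (s : Set N) = ⊤) {v : RealSpace N}
    (hv : IsDeep s v) {w₁ : DualLattice N} (hw₁ : ∀ x ∈ s, x ≠ 0 → 0 < w₁ x) :
    ∃ c : ℝ, 0 < c ∧ ∀ ε : ℝ, 0 < ε →
      c ≤ ε ^ Module.finrank ℤ N * expSum (coneInd s) (ε • v) := by
  classical
  set n := Module.finrank ℤ N with hn
  have hdual : Module.finrank ℤ (DualLattice N) = n := by
    rw [Module.finrank_eq_card_basis (Module.Free.chooseBasis ℤ N).dualBasis, hn,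
      Module.finrank_eq_card_basis (Module.Free.chooseBasis ℤ N)]
  let e := Module.finBasisOfFinrankEq ℤ (DualLattice N) hdual
  -- The forms `m w₁ + e i`, for a basis `e` of `M`, are nonnegative on `s` if `m` is large.
  let m : ℤ := 2 + ∑ i, ∑ x ∈ s, |e i x|
  have hm2 : 2 ≤ m := le_add_of_nonneg_right
    (Finset.sum_nonneg fun i _ => Finset.sum_nonneg fun x _ => abs_nonneg _)
  let g : Fin n → DualLattice N := fun i => m • w₁ + e i
  have hg : ∀ i, ∀ x ∈ s, 0 ≤ g i x := by
    intro i x hx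
    change 0 ≤ m * w₁ x + e i x
    by_cases h0 : x = 0
    · simp [h0]
    · have h1 := hw₁ x hx h0
      have h2 : |e i x| ≤ ∑ i, ∑ x ∈ s, |e i x| :=
        (Finset.single_le_sum (f := fun x => |e i x|) (fun x _ => abs_nonneg _) hx).trans
          (Finset.single_le_sum (f := fun i => ∑ x ∈ s, |e i x|)
            (fun i _ => Finset.sum_nonneg fun x _ => abs_nonneg _) (Finset.mem_univ i))
      have h3 := neg_abs_le (e i x)
      have h4 : m ≤ m * w₁ x := le_mul_of_one_le_right (by omega) h1
      omega
  let W : (Fin n → ℕ) → DualLattice N := fun a => ∑ i, (a i : ℤ) • g i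
  -- Injectivity: `m * c = -1` is impossible for an integer `c` because `m ≥ 2`.
  have hW : Function.Injective W := by
    intro a a' h
    let c : Fin n → ℤ := fun i => (a i : ℤ) - a' i
    have h1 : ∑ i, c i • g i = 0 := by
      simp only [c, sub_smul, Finset.sum_sub_distrib]
      exact sub_eq_zero.2 h
    have h2 : ∀ j, c j + (m * ∑ i, c i) * e.repr w₁ j = 0 := by
      intro j
      have h3 : ∑ i, c i • e i + (m * ∑ i, c i) • w₁ = 0 := by
        rw [← h1]
        simp only [g, smul_add, Finset.sum_add_distrib, ← mul_smul, ← Finset.sum_smul]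
        rw [add_comm, Finset.mul_sum]
        simp only [mul_comm]
      have h4 := congrArg (fun z => e.repr z j) h3
      simpa [Finsupp.single_apply] using h4
    have h5 : (∑ i, c i) * (1 + m * ∑ j, e.repr w₁ j) = 0 := by
      have := Finset.sum_congr rfl fun j (_ : j ∈ Finset.univ) => h2 j
      rw [Finset.sum_add_distrib, ← Finset.mul_sum, Finset.sum_const_zero] at this
      linear_combination this
    have h6 : (1 + m * ∑ j, e.repr w₁ j) ≠ 0 := by
      intro h
      have : m ∣ 1 := ⟨-∑ j, e.repr w₁ j, by linarith⟩
      have := Int.le_of_dvd one_pos this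
      omega
    have h7 := (mul_eq_zero.1 h5).resolve_right h6
    funext j
    have := h2 j
    rw [h7, mul_zero, zero_mul, add_zero] at this
    simp only [c] at this
    omega
  let γ : ℝ := ∑ i, realPairing (g i) v
  have hgv : ∀ i, 0 ≤ realPairing (g i) v := fun i =>
    le_trans (by exact_mod_cast Finset.sum_nonneg (hg i)) (hv _ (hg i))
  refine ⟨Real.exp (-γ), Real.exp_pos _, fun ε hε => ?_⟩
  -- About `ε ^ (-n)` terms of the series are bounded below by `exp (-γ)`.
  let K := ⌈1 / ε⌉₊
  let box : Finset (Fin n → ℕ) := Fintype.piFinset fun _ => Finset.range K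
  have h1 : ∑ w ∈ box.image W, expTerm (coneInd s) (ε • v) w ≤ expSum (coneInd s) (ε • v) :=
    (summable_coneInd hs hv hε).sum_le_tsum _ fun w _ => expTerm_coneInd_nonneg _ _ _
  rw [Finset.sum_image hW.injOn] at h1
  have h2 : ∀ a ∈ box, Real.exp (-γ) ≤ expTerm (coneInd s) (ε • v) (W a) := by
    intro a ha
    have hWa : ∀ x ∈ s, 0 ≤ W a x := fun x hx => by
      simp only [W, LinearMap.sum_apply, LinearMap.smul_apply, smul_eq_mul]
      exact Finset.sum_nonneg fun i _ => mul_nonneg (by positivity) (hg i x hx)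
    rw [expTerm, coneInd_eq_one hWa, Int.cast_one, one_mul, Real.exp_le_exp, neg_le_neg_iff,
      map_smul, smul_eq_mul]
    have h3 : realPairing (W a) v = ∑ i, (a i : ℝ) * realPairing (g i) v := by
      have : ∀ T : Finset (Fin n), realPairing (∑ i ∈ T, (a i : ℤ) • g i) v =
          ∑ i ∈ T, (a i : ℝ) * realPairing (g i) v := by
        intro T
        induction T using Finset.induction_on with
        | empty => simp [realPairing_zero]
        | insert i T hi ih =>
          rw [Finset.sum_insert hi, Finset.sum_insert hi, realPairing_add, LinearMap.add_apply, ih,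
            realPairing_smul]
          simp
      exact this Finset.univ
    rw [h3, Finset.mul_sum]
    refine Finset.sum_le_sum fun i _ => ?_
    rw [← mul_assoc]
    refine mul_le_of_le_one_left (hgv i) ?_
    have h4 := Finset.mem_range.1 (Fintype.mem_piFinset.1 ha i)
    have h5 := Nat.lt_ceil.1 h4
    rw [lt_div_iff₀ hε] at h5
    linarith
  have h3 := Finset.card_nsmul_le_sum box _ _ h2
  rw [nsmul_eq_mul, Fintype.card_piFinset, Finset.prod_const, Finset.card_range, Finset.card_univ,
    Fintype.card_fin] at h3
  have h4 : 1 ≤ ε * K := by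
    have := Nat.le_ceil (1 / ε)
    rw [div_le_iff₀ hε] at this
    linarith
  calc Real.exp (-γ) ≤ (ε * K) ^ n * Real.exp (-γ) :=
        le_mul_of_one_le_left (Real.exp_nonneg _) (one_le_pow₀ h4)
    _ = ε ^ n * (((K ^ n : ℕ) : ℝ) * Real.exp (-γ)) := by push_cast; ring
    _ ≤ _ := mul_le_mul_of_nonneg_left (h3.trans h1) (by positivity)

/-- The Hilbert series of the dual of a full-dimensional strictly convex rational cone has a pole
of order exactly the rank of the lattice. -/
lemma hasMult_equivMult_hull {s : Finset N} (hs : realSpan (s : Set N) = ⊤)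
    {w₁ : DualLattice N} (hw₁ : ∀ x ∈ s, x ≠ 0 → 0 < w₁ x) :
    HasMult (coneInd s) (Module.finrank ℤ N)
      (equivMult (PointedCone.hull ℝ (latticeMap N '' (s : Set N)))) := by
  obtain ⟨v, hv, hgen⟩ := exists_generic hs
  obtain ⟨c, hc, hlow⟩ := exists_le_pow_mul_expSum hs hv hw₁
  obtain ⟨p, hp⟩ := exists_numerator_facetProd hs
  set n := Module.finrank ℤ N
  set q := facetProd hs
  set r := (facets_finite hs).toFinset.card
  set G := facetForm hs
  have hq : HasLead q r G := hasLead_facetProd hs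
  have hG : G ≠ 0 := facetForm_ne_zero hs
  have hneg : ∀ {d : ℕ} {F : Poly N}, IsHom d F → F ≠ 0 → evalAt (-v) F ≠ 0 := fun h1 h2 => by
    rw [evalAt_neg_of_isHom h1]
    exact mul_ne_zero (by simp) (hgen _ h2)
  let P : ℝ → ℝ := fun ε => expEval (ε • -v) p
  let Q : ℝ → ℝ := fun ε => expEval (ε • -v) q
  let H : ℝ → ℝ := fun ε => ε ^ n * expSum (coneInd s) (ε • v)
  have hPQ : ∀ ε, 0 < ε → ε ^ n * P ε = H ε * Q ε := fun ε hε => by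
    have := expEval_eq_mul_expSum (summable_coneInd hs hv hε) hp
    rw [← smul_neg] at this
    simp only [P, Q, H, this]; ring
  have hQlim : Tendsto (fun ε => Q ε / ε ^ r) (𝓝[>] 0) (𝓝 (evalAt (-v) G)) := hq.tendsto (-v)
  have hQne := hneg hq.isHom hG
  have hpos : ∀ᶠ ε : ℝ in 𝓝[>] 0, 0 < ε := self_mem_nhdsWithin
  have hle1 : ∀ᶠ ε : ℝ in 𝓝[>] 0, ε ≤ 1 :=
    nhdsWithin_le_nhds (Iic_mem_nhds one_pos)
  have hid : Tendsto (fun ε : ℝ => ε) (𝓝[>] 0) (𝓝 0) := tendsto_id.mono_left nhdsWithin_le_nhds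
  have hp0 : p ≠ 0 := by
    rintro rfl
    obtain ⟨ε, hε, hne⟩ := (hpos.and (hQlim.eventually_ne hQne)).exists
    have h1 := hPQ ε hε
    have h2 : P ε = 0 := map_zero _
    rw [h2, mul_zero] at h1
    rcases mul_eq_zero.1 h1.symm with h | h
    · have := hlow ε hε
      simp only [H] at h
      linarith
    · exact hne (by rw [h, zero_div])
  obtain ⟨d, F, hF, hpF⟩ := exists_hasLead p hp0
  have hPlim : Tendsto (fun ε => P ε / ε ^ d) (𝓝[>] 0) (𝓝 (evalAt (-v) F)) := hpF.tendsto (-v)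
  have hPne := hneg hpF.isHom hF
  -- The sum `H ε` stays between positive bounds as `ε → 0`, which forces the order of the pole.
  have hr : r = d + n := by
    rcases lt_trichotomy r (d + n) with hlt | heq | hlt
    · exfalso
      obtain ⟨j, hj⟩ := Nat.exists_eq_add_of_lt hlt
      refine hQne (tendsto_nhds_unique hQlim ?_)
      have hb : IsBoundedUnder (· ≤ ·) (𝓝[>] (0 : ℝ)) (fun ε => ‖(H ε)⁻¹‖) := by
        refine isBoundedUnder_of_eventually_le (a := c⁻¹) ?_
        filter_upwards [hpos] with ε hε
        have h1 := hlow ε hε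
        rw [norm_inv, Real.norm_of_nonneg (hc.le.trans h1)]
        exact inv_anti₀ hc h1
      have hz : Tendsto (fun ε : ℝ => ε ^ (j + 1) * (P ε / ε ^ d)) (𝓝[>] 0) (𝓝 0) := by
        simpa using (hid.pow (j + 1)).mul hPlim
      refine (hz.zero_mul_isBoundedUnder_le hb).congr' ?_
      filter_upwards [hpos] with ε hε
      have h1 := hPQ ε hε
      have h2 : H ε ≠ 0 := (hc.trans_le (hlow ε hε)).ne'
      field_simp
      have h3 : ε ^ (j + 1) * ε ^ r = ε ^ d * ε ^ n := by rw [← pow_add, ← pow_add]; congr 1; omega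
      linear_combination P ε * h3 + ε ^ d * h1
    · exact heq
    · exfalso
      obtain ⟨j, hj⟩ := Nat.exists_eq_add_of_lt hlt
      refine hPne (tendsto_nhds_unique hPlim ?_)
      have hb : IsBoundedUnder (· ≤ ·) (𝓝[>] (0 : ℝ)) (fun ε => ‖H ε‖) := by
        refine isBoundedUnder_of_eventually_le (a := 2 ^ n) ?_
        filter_upwards [hpos, hle1] with ε hε hε1
        rw [Real.norm_of_nonneg (hc.le.trans (hlow ε hε))]
        exact pow_mul_expSum_le hs hv hε hε1
      have hz : Tendsto (fun ε : ℝ => ε ^ (j + 1) * (Q ε / ε ^ r)) (𝓝[>] 0) (𝓝 0) := by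
        simpa using (hid.pow (j + 1)).mul hQlim
      refine (hz.zero_mul_isBoundedUnder_le hb).congr' ?_
      filter_upwards [hpos] with ε hε
      have h1 := hPQ ε hε
      have h3 : ε ^ r = ε ^ d * ε ^ n * ε ^ (j + 1) := by
        rw [← pow_add, ← pow_add]; congr 1
      rw [h3]
      field_simp
      linear_combination -h1
  rw [hr] at hq
  rw [← hilbertCoeff_hull] at hp ⊢
  exact hasMult_equivMult _ hp hpF hF hq hG

end Numeric

/-! ### Rational cones and complete fans -/

section RationalCones

variable {N : Type*} [AddCommGroup N]

/-- The cone generated by a finite set of lattice vectors. -/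
abbrev latticeHull (s : Finset N) : PointedCone ℝ (RealSpace N) :=
  PointedCone.hull ℝ (latticeMap N '' (s : Set N))

lemma latticeMap_mem_latticeHull {s : Finset N} {x : N} (hx : x ∈ s) :
    latticeMap N x ∈ latticeHull s :=
  Submodule.subset_span ⟨x, hx, rfl⟩

lemma latticeHull_mono {s t : Finset N} (h : s ⊆ t) : latticeHull s ≤ latticeHull t :=
  Submodule.span_mono (Set.image_mono h)

lemma span_latticeHull (s : Finset N) :
    Submodule.span ℝ (latticeHull s : Set (RealSpace N)) = realSpan (s : Set N) :=
  span_hull _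

lemma realPairing_nonneg_iff {s : Finset N} {w : DualLattice N} :
    (∀ v ∈ latticeHull s, 0 ≤ realPairing w v) ↔ ∀ x ∈ s, 0 ≤ w x := by
  refine ⟨fun h x hx => ?_, fun h v hv => ?_⟩
  · have := h _ (latticeMap_mem_latticeHull hx)
    rw [realPairing_latticeMap] at this
    exact_mod_cast this
  · refine nonneg_of_mem_hull (ℓ := realPairing w) ?_ hv
    rintro _ ⟨x, hx, rfl⟩
    rw [realPairing_latticeMap]
    exact_mod_cast h x hx

lemma realPairing_eq_zero_iff {s : Finset N} {w : DualLattice N} :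
    (∀ v ∈ latticeHull s, realPairing w v = 0) ↔ ∀ x ∈ s, w x = 0 := by
  refine ⟨fun h x hx => ?_, fun h v hv => ?_⟩
  · have := h _ (latticeMap_mem_latticeHull hx)
    rw [realPairing_latticeMap] at this
    exact_mod_cast this
  · refine realPairing_eq_zero_of_realSpan h ?_
    rw [← span_latticeHull]
    exact Submodule.subset_span hv

/-- The sum of the generators, a point in the relative interior of the cone. -/
def centre (s : Finset N) : RealSpace N := ∑ x ∈ s, latticeMap N x

lemma centre_mem (s : Finset N) : centre s ∈ latticeHull s :=
  sum_mem fun _ hx => latticeMap_mem_latticeHull hx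

lemma exists_add_smul_centre_mem {s : Finset N} {h : RealSpace N} (hh : h ∈ realSpan (s : Set N)) :
    ∃ c : ℝ, 0 ≤ c ∧ h + c • centre s ∈ latticeHull s := by
  classical
  have key : (∃ c : ℝ, 0 ≤ c ∧ h + c • centre s ∈ latticeHull s) ∧
      ∃ c : ℝ, 0 ≤ c ∧ -h + c • centre s ∈ latticeHull s := by
    refine Submodule.span_induction (p := fun h _ =>
      (∃ c : ℝ, 0 ≤ c ∧ h + c • centre s ∈ latticeHull s) ∧
      ∃ c : ℝ, 0 ≤ c ∧ -h + c • centre s ∈ latticeHull s) ?_ ?_ ?_ ?_ hh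
    · rintro _ ⟨x, hx, rfl⟩
      refine ⟨⟨0, le_rfl, by simpa using latticeMap_mem_latticeHull hx⟩, 1, zero_le_one, ?_⟩
      rw [one_smul, centre, ← Finset.add_sum_erase s _ hx, neg_add_cancel_left]
      exact sum_mem fun y hy => latticeMap_mem_latticeHull (Finset.mem_of_mem_erase hy)
    · exact ⟨⟨0, le_rfl, by simp⟩, 0, le_rfl, by simp⟩
    · rintro a b - - ⟨⟨c, hc, h1⟩, c', hc', h1'⟩ ⟨⟨d, hd, h2⟩, d', hd', h2'⟩
      refine ⟨⟨c + d, by positivity, ?_⟩, c' + d', by positivity, ?_⟩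
      · convert add_mem h1 h2 using 1
        module
      · convert add_mem h1' h2' using 1
        module
    · rintro r a - ⟨⟨c, hc, h1⟩, c', hc', h1'⟩
      rcases le_total 0 r with hr | hr
      · refine ⟨⟨r * c, by positivity, ?_⟩, r * c', by positivity, ?_⟩
        · convert PointedCone.smul_mem _ hr h1 using 1
          module
        · convert PointedCone.smul_mem _ hr h1' using 1
          module
      · have hr' : 0 ≤ -r := by linarith
        refine ⟨⟨-r * c', by positivity, ?_⟩, -r * c, by positivity, ?_⟩
        · convert PointedCone.smul_mem _ hr' h1' using 1
          module
        · convert PointedCone.smul_mem _ hr' h1 using 1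
          module
  exact key.1

/-- The part of a cone on which an integral form vanishes. -/
def cutFace (σ : PointedCone ℝ (RealSpace N)) (u : DualLattice N) : PointedCone ℝ (RealSpace N) :=
  σ ⊓ (LinearMap.ker (realPairing u)).restrictScalars _

lemma mem_cutFace {σ : PointedCone ℝ (RealSpace N)} {u : DualLattice N} {v : RealSpace N} :
    v ∈ cutFace σ u ↔ v ∈ σ ∧ realPairing u v = 0 := Iff.rfl

lemma cutFace_neg (σ : PointedCone ℝ (RealSpace N)) (u : DualLattice N) :
    cutFace σ (-u) = cutFace σ u := by
  ext v
  simp [mem_cutFace, realPairing_neg]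

lemma cutFace_isFaceOf {σ : PointedCone ℝ (RealSpace N)} {u : DualLattice N}
    (h : ∀ v ∈ σ, 0 ≤ realPairing u v) : (cutFace σ u).IsFaceOf σ := by
  refine PointedCone.IsFaceOf.of_mem_of_add_mem_left (fun v hv => hv.1) fun {x y} hx hy hxy => ?_
  have h1 := (mem_cutFace.1 hxy).2
  rw [map_add] at h1
  exact mem_cutFace.2 ⟨hx, by linarith [h x hx, h y hy]⟩

open Classical in
lemma face_eq_latticeHull {s : Finset N} {τ : PointedCone ℝ (RealSpace N)}
    (h : τ.IsFaceOf (latticeHull s)) : τ = latticeHull {x ∈ s | latticeMap N x ∈ τ} := by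
  conv_lhs => rw [face_eq_hull h]
  congr 1
  ext v
  constructor
  · rintro ⟨⟨x, hx, rfl⟩, hv⟩
    exact ⟨x, by simpa using ⟨hx, hv⟩, rfl⟩
  · rintro ⟨x, hx, rfl⟩
    have := Finset.mem_filter.1 (Finset.mem_coe.1 hx)
    exact ⟨⟨x, this.1, rfl⟩, this.2⟩

lemma cutFace_latticeHull {s : Finset N} {u : DualLattice N} (h : ∀ x ∈ s, 0 ≤ u x) :
    cutFace (latticeHull s) u = latticeHull {x ∈ s | u x = 0} := by
  classical
  refine (face_eq_latticeHull (cutFace_isFaceOf (realPairing_nonneg_iff.2 h))).trans ?_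
  refine congrArg latticeHull (Finset.filter_congr fun x hx => ?_)
  rw [mem_cutFace, realPairing_latticeMap, Int.cast_eq_zero]
  exact and_iff_right (latticeMap_mem_latticeHull hx)

/-- A face that spans the same subspace as the cone is the whole cone. -/
lemma eq_of_isFaceOf_of_le_span {t : Finset N} {φ : PointedCone ℝ (RealSpace N)}
    (h : (latticeHull t).IsFaceOf φ) (h' : ∀ v ∈ φ, v ∈ realSpan (t : Set N)) :
    latticeHull t = φ := by
  refine le_antisymm h.le fun v hv => ?_
  obtain ⟨c, hc, h1⟩ := exists_add_smul_centre_mem (h' v hv)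
  exact h.mem_of_add_mem_left hv (h.le (PointedCone.smul_mem _ hc (centre_mem t))) h1

lemma exists_pos_of_ne_zero {s : Finset N} (hs : realSpan (s : Set N) = ⊤) {u : DualLattice N}
    (hu : u ≠ 0) (h : ∀ x ∈ s, 0 ≤ u x) : ∃ x ∈ s, 0 < u x := by
  by_contra! hcon
  exact hu (eq_zero_of_realSpan_eq_top hs fun x hx => le_antisymm (hcon x hx) (h x hx))

variable [Module.Free ℤ N]

/-- A point outside a rational cone is separated from it by a linear form. -/
lemma exists_separating {s : Finset N} {x : RealSpace N} (hx : x ∉ latticeHull s) :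
    ∃ ℓ : RealSpace N →ₗ[ℝ] ℝ, (∀ y ∈ latticeHull s, 0 ≤ ℓ y) ∧ ℓ x < 0 := by
  have hsep : ∀ x : RealSpace N, x ≠ 0 → ∃ ℓ : RealSpace N →ₗ[ℝ] ℝ, ℓ x ≠ 0 := fun x hx => by
    by_contra! h
    exact hx ((Module.forall_dual_apply_eq_zero_iff ℝ x).1 h)
  rcases farkas hsep s (latticeMap N) x with ⟨m, hm, h⟩ | ⟨ℓ, h1, h2⟩
  · refine absurd ?_ hx
    have := PointedCone.smul_mem _ (inv_nonneg.2 hm.le) h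
    rwa [inv_smul_smul₀ hm.ne'] at this
  · refine ⟨ℓ, fun y hy => nonneg_of_mem_hull ?_ hy, h2⟩
    rintro _ ⟨y, hy, rfl⟩
    exact h1 y hy

end RationalCones

namespace Fan

variable {N : Type*} [AddCommGroup N] {Δ : Fan N}

lemma mem_maxCones {σ : PointedCone ℝ (RealSpace N)} :
    σ ∈ Δ.maxCones ↔ σ ∈ Δ.cones ∧ Maximal (fun σ' => σ' ∈ Δ.cones) σ := by
  simp only [maxCones, Finset.mem_filter]

lemma mem_cones_of_mem_maxCones {σ : PointedCone ℝ (RealSpace N)} (h : σ ∈ Δ.maxCones) :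
    σ ∈ Δ.cones :=
  (mem_maxCones.1 h).1

lemma eq_of_le_of_mem_maxCones {σ σ' : PointedCone ℝ (RealSpace N)} (h : σ ∈ Δ.maxCones)
    (h' : σ' ∈ Δ.cones) (hle : σ ≤ σ') : σ = σ' :=
  le_antisymm hle ((mem_maxCones.1 h).2.2 h' hle)

lemma exists_le_maxCone {σ : PointedCone ℝ (RealSpace N)} (h : σ ∈ Δ.cones) :
    ∃ σ' ∈ Δ.maxCones, σ ≤ σ' := by
  classical
  obtain ⟨σ', h1, h2⟩ := Δ.cones.exists_le_maximal h
  exact ⟨σ', mem_maxCones.2 ⟨h2.1, h2⟩, h1⟩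

lemma isFaceOf_of_le {φ σ : PointedCone ℝ (RealSpace N)} (hφ : φ ∈ Δ.cones) (hσ : σ ∈ Δ.cones)
    (h : φ ≤ σ) : φ.IsFaceOf σ := by
  have := Δ.inter_face σ hσ φ hφ
  rwa [inf_eq_right.2 h] at this

/-- A cone of the fan that contains a relative interior point of another one contains it. -/
lemma le_of_centre_mem {t : Finset N} (ht : latticeHull t ∈ Δ.cones)
    {σ : PointedCone ℝ (RealSpace N)} (hσ : σ ∈ Δ.cones) (h : centre t ∈ σ) :
    latticeHull t ≤ σ := by
  classical
  have hF := Δ.inter_face _ ht _ hσ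
  have hmem : ∀ x ∈ t, latticeMap N x ∈ latticeHull t ⊓ σ := by
    intro x hx
    have h1 : centre t ∈ latticeHull t ⊓ σ := ⟨centre_mem t, h⟩
    rw [centre, ← Finset.add_sum_erase t _ hx] at h1
    exact hF.mem_of_add_mem_left (latticeMap_mem_latticeHull hx)
      (sum_mem fun y hy => latticeMap_mem_latticeHull (Finset.mem_of_mem_erase hy)) h1
  refine Submodule.span_le.2 ?_
  rintro _ ⟨x, hx, rfl⟩
  exact (hmem x hx).2

variable [Module.Free ℤ N]

/-- In a complete fan, every tangent direction at every point enters a maximal cone that contains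
the point. -/
lemma exists_maxCone_direction (hΔ : Δ.IsComplete) (x y : RealSpace N) :
    ∃ σ ∈ Δ.maxCones, x ∈ σ ∧ ∃ ε : ℝ, 0 < ε ∧ x + ε • y ∈ σ := by
  have hcov : ∀ v : RealSpace N, ∃ σ : Δ.maxCones, v ∈ σ.1 := by
    intro v
    have hv : v ∈ Δ.support := by rw [show Δ.support = Set.univ from hΔ]; trivial
    obtain ⟨σ, hσ, hvσ⟩ := hv
    obtain ⟨σ', hσ', hle⟩ := exists_le_maxCone hσ
    exact ⟨⟨σ', hσ'⟩, hle hvσ⟩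
  choose g hg using fun n : ℕ => hcov (x + ((n : ℝ) + 1)⁻¹ • y)
  obtain ⟨σ, hσ⟩ := Finite.exists_infinite_fiber g
  have hinf : (g ⁻¹' {σ}).Infinite := Set.infinite_coe_iff.1 hσ
  have hmem : ∀ n ∈ g ⁻¹' {σ}, x + ((n : ℝ) + 1)⁻¹ • y ∈ σ.1 := fun n hn => by
    have : g n = σ := hn
    rw [← this]; exact hg n
  obtain ⟨n₀, hn₀⟩ := hinf.nonempty
  refine ⟨σ, σ.2, ?_, _, inv_pos.2 (by positivity), hmem n₀ hn₀⟩
  by_contra hx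
  obtain ⟨s, hs⟩ := Δ.rational σ.1 (mem_cones_of_mem_maxCones σ.2)
  rw [hs] at hx hmem
  obtain ⟨ℓ, h1, h2⟩ := exists_separating hx
  obtain ⟨K, hK⟩ := exists_nat_gt (ℓ y / -ℓ x)
  obtain ⟨n, hn, hKn⟩ := hinf.exists_gt K
  have h3 := h1 _ (hmem n hn)
  rw [map_add, map_smul, smul_eq_mul] at h3
  have h4 : (K : ℝ) < n := by exact_mod_cast hKn
  rw [div_lt_iff₀ (by linarith)] at hK
  have h5 : (0 : ℝ) < n + 1 := by positivity
  have h6 : 0 ≤ ((n : ℝ) + 1) * (ℓ x + ((n : ℝ) + 1)⁻¹ * ℓ y) := mul_nonneg h5.le h3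
  rw [mul_add, mul_inv_cancel_left₀ h5.ne'] at h6
  nlinarith

lemma realSpan_eq_top (hΔ : Δ.IsComplete) {s : Finset N} (hs : latticeHull s ∈ Δ.maxCones) :
    realSpan (s : Set N) = ⊤ := by
  rw [eq_top_iff]
  rintro y -
  obtain ⟨σ, hσ, hx, ε, hε, hy⟩ := exists_maxCone_direction hΔ (centre s) y
  have hle := le_of_centre_mem (mem_cones_of_mem_maxCones hs) (mem_cones_of_mem_maxCones hσ) hx
  rw [← eq_of_le_of_mem_maxCones hs (mem_cones_of_mem_maxCones hσ) hle] at hy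
  have hle' : ∀ v ∈ latticeHull s, v ∈ realSpan (s : Set N) := fun v hv => by
    rw [← span_latticeHull]; exact Submodule.subset_span hv
  have h1 := sub_mem (hle' _ hy) (hle' _ (centre_mem s))
  rw [add_sub_cancel_left] at h1
  exact (Submodule.smul_mem_iff _ hε.ne').1 h1

/-- Two maximal cones that lie on the same side of a common wall are equal. -/
lemma eq_of_wall (hΔ : Δ.IsComplete) {σ σ' : PointedCone ℝ (RealSpace N)} (hσ : σ ∈ Δ.maxCones)
    (hσ' : σ' ∈ Δ.maxCones) {u : DualLattice N} (hu : ∀ v ∈ σ, 0 ≤ realPairing u v)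
    (hker : LinearMap.ker (realPairing u) ≤ Submodule.span ℝ (cutFace σ u : Set (RealSpace N)))
    (hle : cutFace σ u ≤ σ') {z : RealSpace N} (hz : z ∈ σ') (hzu : 0 < realPairing u z) :
    σ = σ' := by
  classical
  obtain ⟨s, rfl⟩ := Δ.rational σ (mem_cones_of_mem_maxCones hσ)
  have hs := realSpan_eq_top hΔ hσ
  have hus := realPairing_nonneg_iff.1 hu
  have hu0 : u ≠ 0 := by rintro rfl; simp [realPairing_zero] at hzu
  obtain ⟨x₀, hx₀, hx₀u⟩ := exists_pos_of_ne_zero hs hu0 hus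
  have hx₀u' : (0 : ℝ) < u x₀ := by exact_mod_cast hx₀u
  rw [cutFace_latticeHull hus] at hle hker
  rw [span_latticeHull] at hker
  set t := s.filter fun x => u x = 0
  -- A point `p` with `⟨u, p⟩ > 0` in both cones: `h₁ ∈ σ` and `z ∈ σ'` have the same value under
  -- `u`, so their difference lies in the span of the wall, and both are moved far into the wall.
  let h₁ : RealSpace N := (realPairing u z / u x₀) • latticeMap N x₀
  have hh₁ : realPairing u h₁ = realPairing u z := by
    simp only [h₁, map_smul, realPairing_latticeMap, smul_eq_mul]
    field_simp
  obtain ⟨c, hc, hcm⟩ := exists_add_smul_centre_mem (s := t) (h := h₁ - z)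
    (hker (by rw [LinearMap.mem_ker, map_sub, hh₁, sub_self]))
  let p : RealSpace N := h₁ + c • centre t
  have htu : ∀ v ∈ latticeHull t, realPairing u v = 0 :=
    realPairing_eq_zero_iff.2 fun x hx => (Finset.mem_filter.1 hx).2
  have hts : latticeHull t ≤ latticeHull s := latticeHull_mono (Finset.filter_subset _ _)
  have hpu : 0 < realPairing u p := by
    rw [map_add, hh₁, map_smul, htu _ (centre_mem t), smul_zero, add_zero]
    exact hzu
  have hp : p ∈ latticeHull s ⊓ σ' := by
    refine ⟨add_mem ?_ (PointedCone.smul_mem _ hc (hts (centre_mem t))), ?_⟩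
    · exact PointedCone.smul_mem _ (by positivity) (latticeMap_mem_latticeHull hx₀)
    · have : p = z + (h₁ - z + c • centre t) := by simp only [p]; abel
      change p ∈ σ'
      rw [this]
      exact add_mem hz (hle hcm)
  have hF := Δ.inter_face _ (mem_cones_of_mem_maxCones hσ) _ (mem_cones_of_mem_maxCones hσ')
  have hF' := face_eq_latticeHull hF
  have hspan : ∀ y, y ∈ Submodule.span ℝ ((latticeHull s ⊓ σ' : PointedCone ℝ _) :
      Set (RealSpace N)) := by
    intro y
    have h1 : y - (realPairing u y / realPairing u p) • p ∈ realSpan (t : Set N) := by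
      refine hker ?_
      rw [LinearMap.mem_ker, map_sub, map_smul, smul_eq_mul]
      field_simp
      ring
    rw [← span_latticeHull] at h1
    have h2 : latticeHull t ≤ latticeHull s ⊓ σ' := le_inf hts hle
    have h3 := add_mem (Submodule.span_mono h2 h1)
      (Submodule.smul_mem _ (realPairing u y / realPairing u p) (Submodule.subset_span hp))
    rwa [sub_add_cancel] at h3
  have h4 : latticeHull s ⊓ σ' = latticeHull s := by
    rw [hF'] at hF hspan ⊢
    refine eq_of_isFaceOf_of_le_span hF fun v _ => ?_
    rw [← span_latticeHull]
    exact hspan v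
  exact eq_of_le_of_mem_maxCones hσ (mem_cones_of_mem_maxCones hσ') (inf_eq_left.1 h4)

/-- Every wall of a maximal cone of a complete fan is a wall of a maximal cone on the other
side. -/
lemma exists_wall (hΔ : Δ.IsComplete) {σ : PointedCone ℝ (RealSpace N)} (hσ : σ ∈ Δ.maxCones)
    {u : DualLattice N} (hu0 : u ≠ 0) (hu : ∀ v ∈ σ, 0 ≤ realPairing u v)
    (hker : LinearMap.ker (realPairing u) ≤ Submodule.span ℝ (cutFace σ u : Set (RealSpace N))) :
    ∃ σ' ∈ Δ.maxCones, (∀ v ∈ σ', realPairing u v ≤ 0) ∧ cutFace σ' u = cutFace σ u := by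
  classical
  obtain ⟨s, rfl⟩ := Δ.rational σ (mem_cones_of_mem_maxCones hσ)
  have hs := realSpan_eq_top hΔ hσ
  have hus := realPairing_nonneg_iff.1 hu
  obtain ⟨x₀, hx₀, hx₀u⟩ := exists_pos_of_ne_zero hs hu0 hus
  have hx₀u' : (0 : ℝ) < u x₀ := by exact_mod_cast hx₀u
  have hcut := cutFace_latticeHull hus
  have hcone : cutFace (latticeHull s) u ∈ Δ.cones :=
    Δ.face_mem _ (mem_cones_of_mem_maxCones hσ) _ (cutFace_isFaceOf hu)
  set t := s.filter fun x => u x = 0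
  have htu : ∀ v ∈ latticeHull t, realPairing u v = 0 :=
    realPairing_eq_zero_iff.2 fun x hx => (Finset.mem_filter.1 hx).2
  -- A maximal cone that is entered from the centre of the wall in the direction away from `σ`.
  obtain ⟨σ', hσ', h1, ε, hε, h2⟩ :=
    exists_maxCone_direction hΔ (centre t) (-latticeMap N x₀)
  have hle : cutFace (latticeHull s) u ≤ σ' := by
    rw [hcut] at hcone ⊢
    exact le_of_centre_mem hcone (mem_cones_of_mem_maxCones hσ') h1
  have hside : ∀ v ∈ σ', realPairing u v ≤ 0 := by
    intro z hz
    by_contra! hzu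
    have heq := eq_of_wall hΔ hσ hσ' hu hker hle hz hzu
    rw [← heq] at h2
    have h3 := hu _ h2
    rw [map_add, htu _ (centre_mem t), map_smul, map_neg, realPairing_latticeMap, smul_eq_mul] at h3
    nlinarith [mul_pos hε hx₀u']
  refine ⟨σ', hσ', hside, ?_⟩
  have hF : (cutFace σ' u).IsFaceOf σ' := by
    rw [← cutFace_neg]
    refine cutFace_isFaceOf fun v hv => ?_
    rw [realPairing_neg]
    exact neg_nonneg.2 (hside v hv)
  have hF' : (cutFace (latticeHull s) u).IsFaceOf (cutFace σ' u) :=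
    isFaceOf_of_le hcone (Δ.face_mem _ (mem_cones_of_mem_maxCones hσ') _ hF)
      fun v hv => mem_cutFace.2 ⟨hle hv, hv.2⟩
  rw [hcut] at hF' hker ⊢
  refine (eq_of_isFaceOf_of_le_span hF' fun v hv => ?_).symm
  rw [← span_latticeHull]
  exact hker hv.2

end Fan

/-! ### Hilbert series relative to a face -/

section Quotients

variable {N : Type*} [AddCommGroup N]

lemma realProj_latticeMap (τ : PointedCone ℝ (RealSpace N)) (x : N) :
    realProj τ (latticeMap N x) = latticeMap (QuotLattice τ) ((latticeSpan τ).mkQ x) := rfl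

lemma realProj_surjective (τ : PointedCone ℝ (RealSpace N)) :
    Function.Surjective (realProj τ) := by
  have : Function.Surjective ((latticeSpan τ).mkQ.lTensor ℝ) :=
    LinearMap.lTensor_surjective ℝ (latticeSpan τ).mkQ_surjective
  intro y
  obtain ⟨x, hx⟩ := this y
  exact ⟨x, hx⟩

lemma ker_realProj (t : Finset N) :
    LinearMap.ker (realProj (latticeHull t)) = realSpan (t : Set N) := by
  refine le_antisymm (fun v hv => ?_) (Submodule.span_le.2 ?_)
  · have hex : Function.Exact (latticeSpan (latticeHull t)).subtype
        (latticeSpan (latticeHull t)).mkQ := LinearMap.exact_subtype_mkQ _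
    obtain ⟨y, rfl⟩ := (lTensor_exact ℝ hex (Submodule.mkQ_surjective _) v).1 hv
    clear hv
    induction y using TensorProduct.induction_on with
    | zero => rw [map_zero]; exact zero_mem _
    | tmul r x =>
      have h1 : latticeMap N x.1 ∈ realSpan (t : Set N) := by
        rw [← span_latticeHull]; exact x.2
      have h2 : (latticeSpan (latticeHull t)).subtype.lTensor ℝ (r ⊗ₜ x) =
          r • latticeMap N x.1 := by
        change r ⊗ₜ[ℤ] x.1 = r • ((1 : ℝ) ⊗ₜ[ℤ] x.1)
        rw [TensorProduct.smul_tmul', smul_eq_mul, mul_one]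
      rw [h2]
      exact Submodule.smul_mem _ _ h1
    | add y z hy hz => rw [map_add]; exact add_mem hy hz
  · rintro _ ⟨x, hx, rfl⟩
    have h1 : (latticeSpan (latticeHull t)).mkQ x = 0 := by
      rw [Submodule.mkQ_apply, Submodule.Quotient.mk_eq_zero]
      exact Submodule.subset_span (latticeMap_mem_latticeHull hx)
    change realProj _ (latticeMap N x) = 0
    rw [realProj_latticeMap, h1, map_zero]

/-- A form that vanishes on `τ` comes from the quotient by the span of `τ`. -/
lemma exists_dualIncl_eq {τ : PointedCone ℝ (RealSpace N)} {w : DualLattice N}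
    (h : ∀ v ∈ τ, realPairing w v = 0) : ∃ w' : DualLattice (QuotLattice τ), dualIncl τ w' = w := by
  have h1 : Submodule.span ℝ (τ : Set (RealSpace N)) ≤ LinearMap.ker (realPairing w) :=
    Submodule.span_le.2 h
  refine ⟨(latticeSpan τ).liftQ w fun x hx => ?_, LinearMap.ext fun x => rfl⟩
  have h2 : realPairing w (latticeMap N x) = 0 := h1 hx
  rw [realPairing_latticeMap] at h2
  exact_mod_cast h2

lemma realPairing_dualIncl_eq_zero {t : Finset N} (w : DualLattice (QuotLattice (latticeHull t))) :
    ∀ v ∈ latticeHull t, realPairing (dualIncl (latticeHull t) w) v = 0 := by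
  intro v hv
  have h1 : v ∈ LinearMap.ker (realProj (latticeHull t)) := by
    rw [ker_realProj, ← span_latticeHull]
    exact Submodule.subset_span hv
  rw [realPairing_dualIncl, LinearMap.mem_ker.1 h1, map_zero]

open Classical in
lemma imageCone_latticeHull (s : Finset N) (τ : PointedCone ℝ (RealSpace N)) :
    imageCone (latticeHull s) τ = latticeHull (s.image (latticeSpan τ).mkQ) := by
  unfold imageCone latticeHull
  rw [PointedCone.map, PointedCone.hull, Submodule.map_span, ← Set.image_comp, Finset.coe_image,
    ← Set.image_comp]
  rfl

open Classical in
lemma realSpan_image_mkQ {s : Finset N} (hs : realSpan (s : Set N) = ⊤)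
    (τ : PointedCone ℝ (RealSpace N)) :
    realSpan ((s.image (latticeSpan τ).mkQ : Finset (QuotLattice τ)) : Set (QuotLattice τ)) =
      ⊤ := by
  have h := congrArg (Submodule.map (realProj τ)) hs
  rw [Submodule.map_top, LinearMap.range_eq_top.2 (realProj_surjective τ), Submodule.map_span,
    ← Set.image_comp] at h
  rw [← h, realSpan, Finset.coe_image, ← Set.image_comp]
  rfl

variable [Module.Free ℤ N] [Module.Finite ℤ N]

lemma finrank_quotLattice (t : Finset N) :
    Module.finrank ℤ (QuotLattice (latticeHull t)) + coneDim (latticeHull t) =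
      Module.finrank ℤ N := by
  rw [← finrank_realSpace (N := N), ← finrank_realSpace (N := QuotLattice (latticeHull t)),
    ← LinearMap.finrank_range_add_finrank_ker (realProj (latticeHull t)), ker_realProj,
    LinearMap.range_eq_top.2 (realProj_surjective _), finrank_top, coneDim, span_latticeHull]

end Quotients

section Relative

variable {N : Type*} [AddCommGroup N]

open Classical in
/-- The coefficients of the series `∑ x^w` over the lattice points `w` of `σ^* ∩ τ^⊥`. -/
def relInd (σ τ : PointedCone ℝ (RealSpace N)) (w : DualLattice N) : ℤ :=
  if (∀ v ∈ σ, 0 ≤ realPairing w v) ∧ ∀ v ∈ τ, realPairing w v = 0 then 1 else 0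

/-- The primitive inner normals of the facets of `σ` that contain `τ`. -/
def relFacets (σ τ : PointedCone ℝ (RealSpace N)) : Set (DualLattice N) :=
  {u | IsPrim u ∧ (∀ v ∈ σ, 0 ≤ realPairing u v) ∧ (∀ v ∈ τ, realPairing u v = 0) ∧
    LinearMap.ker (realPairing u) ≤ Submodule.span ℝ (cutFace σ u : Set (RealSpace N))}

open Classical in
/-- Generators of the cone `σ + span τ`, where `s` generates `σ`. -/
def relGens (s : Finset N) (τ : PointedCone ℝ (RealSpace N)) : Finset N :=
  s ∪ {x ∈ s | latticeMap N x ∈ τ}.image Neg.neg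

lemma mem_relGens {s : Finset N} {τ : PointedCone ℝ (RealSpace N)} {x : N} :
    x ∈ relGens s τ ↔ x ∈ s ∨ ∃ y ∈ s, latticeMap N y ∈ τ ∧ -y = x := by
  simp only [relGens, Finset.mem_union, Finset.mem_image, Finset.mem_filter, and_assoc]

lemma realSpan_relGens {s : Finset N} (hs : realSpan (s : Set N) = ⊤)
    (τ : PointedCone ℝ (RealSpace N)) : realSpan (relGens s τ : Set N) = ⊤ := by
  rw [eq_top_iff, ← hs]
  refine Submodule.span_mono (Set.image_mono fun x hx => ?_)
  exact Finset.mem_coe.2 (mem_relGens.2 (Or.inl hx))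

variable {s : Finset N} {τ : PointedCone ℝ (RealSpace N)}

/-- A form vanishes on a face if it vanishes on the generators in the face. -/
lemma vanish_face_iff (hτ : τ.IsFaceOf (latticeHull s)) {w : DualLattice N} :
    (∀ v ∈ τ, realPairing w v = 0) ↔ ∀ x ∈ s, latticeMap N x ∈ τ → w x = 0 := by
  classical
  have h := realPairing_eq_zero_iff (s := s.filter fun x => latticeMap N x ∈ τ) (w := w)
  rw [← face_eq_latticeHull hτ] at h
  rw [h]
  simp only [Finset.mem_filter, and_imp]

lemma relGens_nonneg_iff (hτ : τ.IsFaceOf (latticeHull s)) {w : DualLattice N} :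
    (∀ x ∈ relGens s τ, 0 ≤ w x) ↔
      (∀ v ∈ latticeHull s, 0 ≤ realPairing w v) ∧ ∀ v ∈ τ, realPairing w v = 0 := by
  rw [vanish_face_iff hτ, realPairing_nonneg_iff]
  refine ⟨fun h => ⟨fun x hx => h x (mem_relGens.2 (Or.inl hx)), fun x hx hxτ => ?_⟩, ?_⟩
  · have h1 := h x (mem_relGens.2 (Or.inl hx))
    have h2 := h (-x) (mem_relGens.2 (Or.inr ⟨x, hx, hxτ, rfl⟩))
    rw [map_neg] at h2
    omega
  · rintro ⟨h1, h2⟩ x hx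
    rcases mem_relGens.1 hx with hx | ⟨y, hy, hyτ, rfl⟩
    · exact h1 x hx
    · rw [map_neg, h2 y hy hyτ, neg_zero]

open Classical in
lemma coneInd_relGens (hτ : τ.IsFaceOf (latticeHull s)) :
    coneInd (relGens s τ) = relInd (latticeHull s) τ := by
  funext w
  unfold coneInd relInd
  exact if_congr (relGens_nonneg_iff hτ) rfl rfl

lemma realSpan_relGens_filter {u : DualLattice N} :
    realSpan {x | x ∈ relGens s τ ∧ u x = 0} = realSpan {x | x ∈ s ∧ u x = 0} := by
  refine le_antisymm (Submodule.span_le.2 ?_)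
    (Submodule.span_mono (Set.image_mono fun x hx => ⟨mem_relGens.2 (Or.inl hx.1), hx.2⟩))
  rintro _ ⟨x, ⟨hx, hu⟩, rfl⟩
  rcases mem_relGens.1 hx with hx | ⟨y, hy, -, rfl⟩
  · exact Submodule.subset_span ⟨x, ⟨hx, hu⟩, rfl⟩
  · rw [map_neg, SetLike.mem_coe, neg_mem_iff]
    rw [map_neg, neg_eq_zero] at hu
    exact Submodule.subset_span ⟨y, ⟨hy, hu⟩, rfl⟩

lemma span_cutFace {u : DualLattice N} (h : ∀ x ∈ s, 0 ≤ u x) :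
    Submodule.span ℝ (cutFace (latticeHull s) u : Set (RealSpace N)) =
      realSpan {x | x ∈ s ∧ u x = 0} := by
  rw [cutFace_latticeHull h, span_latticeHull]
  congr 2
  ext x
  simp

lemma facets_relGens (hτ : τ.IsFaceOf (latticeHull s)) :
    facets (relGens s τ) = relFacets (latticeHull s) τ := by
  ext u
  unfold facets relFacets
  simp only [Set.mem_ofPred_eq]
  rw [relGens_nonneg_iff hτ, realSpan_relGens_filter, and_assoc]
  refine and_congr_right fun _ => and_congr_right fun h => ?_
  rw [span_cutFace (realPairing_nonneg_iff.1 h)]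

lemma relGens_nonneg_of_eq_zero_iff (hτ : τ.IsFaceOf (latticeHull s)) {u : DualLattice N}
    (hu : u ∈ relFacets (latticeHull s) τ) {w : DualLattice N} :
    (∀ x ∈ relGens s τ, u x = 0 → 0 ≤ w x) ↔
      (∀ v ∈ cutFace (latticeHull s) u, 0 ≤ realPairing w v) ∧ ∀ v ∈ τ, realPairing w v = 0 := by
  classical
  have hus := realPairing_nonneg_iff.1 hu.2.1
  have huτ := (vanish_face_iff hτ).1 hu.2.2.1
  rw [vanish_face_iff hτ, cutFace_latticeHull hus, realPairing_nonneg_iff]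
  refine ⟨fun h => ⟨fun x hx => ?_, fun x hx hxτ => ?_⟩, ?_⟩
  · have hx := Finset.mem_filter.1 hx
    exact h x (mem_relGens.2 (Or.inl hx.1)) hx.2
  · have h1 := h x (mem_relGens.2 (Or.inl hx)) (huτ x hx hxτ)
    have h2 := h (-x) (mem_relGens.2 (Or.inr ⟨x, hx, hxτ, rfl⟩)) (by simp [huτ x hx hxτ])
    rw [map_neg] at h2
    omega
  · rintro ⟨h1, h2⟩ x hx hux
    rcases mem_relGens.1 hx with hx | ⟨y, hy, hyτ, rfl⟩
    · exact h1 x (Finset.mem_filter.2 ⟨hx, hux⟩)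
    · rw [map_neg, h2 y hy hyτ, neg_zero]

variable [Module.Free ℤ N] [Module.Finite ℤ N]

/-- The multiplicity `e_{σ,τ}` is that of the Hilbert series of `σ^* ∩ τ^⊥`. -/
lemma hasMult_relMult (hs : realSpan (s : Set N) = ⊤) (hτ : τ.IsFaceOf (latticeHull s)) {k : ℕ}
    (hk : coneDim τ + k = Module.finrank ℤ N) :
    HasMult (relInd (latticeHull s) τ) k (relMult (latticeHull s) τ) := by
  classical
  obtain ⟨w, hw0, hw1⟩ := exists_exposing s hτ
  obtain ⟨t, rfl⟩ : ∃ t, τ = latticeHull t := ⟨_, face_eq_latticeHull hτ⟩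
  have hw0' := (vanish_face_iff hτ).2 hw0
  obtain ⟨w', hw'⟩ := exists_dualIncl_eq hw0'
  subst hw'
  have hrank : Module.finrank ℤ (QuotLattice (latticeHull t)) = k := by
    have := finrank_quotLattice t
    omega
  have h1 := hasMult_equivMult_hull (realSpan_image_mkQ hs (latticeHull t)) (w₁ := w') (by
    intro x hx hx0
    obtain ⟨y, hy, rfl⟩ := Finset.mem_image.1 hx
    refine hw1 y hy fun hyτ => hx0 ?_
    rw [Submodule.mkQ_apply, Submodule.Quotient.mk_eq_zero]
    exact Submodule.subset_span hyτ)
  rw [hrank] at h1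
  unfold relMult
  rw [imageCone_latticeHull]
  refine h1.pullback (latticeHull t) (fun u => ?_) fun u hu => ?_
  · unfold relInd coneInd
    refine if_congr ?_ rfl rfl
    rw [realPairing_nonneg_iff, and_iff_left (realPairing_dualIncl_eq_zero u)]
    simp only [Finset.forall_mem_image]
    rfl
  · unfold relInd
    refine if_neg fun h => hu ?_
    obtain ⟨u', hu'⟩ := exists_dualIncl_eq h.2
    exact ⟨u', hu'⟩

end Relative

/-! ### Regularity of rational functions along hyperplanes -/

section Hyperplanes

variable {N : Type*} [AddCommGroup N]

/-- The polynomial map that precomposes a polynomial with `y ↦ y - ⟨u, y⟩ v`. If `⟨u, v⟩ = 1`, this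
is the projection onto the hyperplane `u = 0` along `v`. -/
def restrictForm (u : DualLattice N) (v : N) : Poly N →ₐ[ℤ] Poly N :=
  SymmetricAlgebra.lift ((SymmetricAlgebra.ι ℤ (DualLattice N)).comp
    (LinearMap.id - (LinearMap.toSpanSingleton ℤ (DualLattice N) u).comp (Module.Dual.eval ℤ N v)))

lemma restrictForm_ι (u : DualLattice N) (v : N) (w : DualLattice N) :
    restrictForm u v (SymmetricAlgebra.ι ℤ _ w) = SymmetricAlgebra.ι ℤ _ (w - w v • u) := by
  simp [restrictForm]

lemma dvd_sub_restrictForm (u : DualLattice N) (v : N) (F : Poly N) :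
    SymmetricAlgebra.ι ℤ _ u ∣ F - restrictForm u v F := by
  induction F using SymmetricAlgebra.induction with
  | algebraMap r => simp
  | ι w =>
    rw [restrictForm_ι, map_sub, sub_sub_cancel, map_smul]
    exact Dvd.intro_left (algebraMap ℤ _ (w v)) (by rw [Algebra.smul_def])
  | mul a b ha hb =>
    rw [map_mul, show a * b - restrictForm u v a * restrictForm u v b =
      (a - restrictForm u v a) * b + restrictForm u v a * (b - restrictForm u v b) by ring]
    exact dvd_add (ha.mul_right _) (hb.mul_left _)
  | add a b ha hb =>
    rw [map_add, add_sub_add_comm]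
    exact dvd_add ha hb

lemma evalAt_restrictForm (u : DualLattice N) (v : N) (y : RealSpace N) (F : Poly N) :
    evalAt y (restrictForm u v F) = evalAt (y - realPairing u y • latticeMap N v) F := by
  have : (evalAt y).comp (restrictForm u v) =
      evalAt (y - realPairing u y • latticeMap N v) := by
    apply SymmetricAlgebra.algHom_ext
    refine LinearMap.ext fun w => ?_
    change evalAt y (restrictForm u v (SymmetricAlgebra.ι ℤ _ w)) =
      evalAt _ (SymmetricAlgebra.ι ℤ _ w)
    rw [restrictForm_ι, evalAt_ι, evalAt_ι, realPairing_sub, realPairing_smul]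
    simp [mul_comm]
  exact DFunLike.congr_fun this F

lemma eq_or_eq_neg_of_ι_dvd {u w : DualLattice N} (hu : IsPrim u) (hw : IsPrim w)
    (h : SymmetricAlgebra.ι ℤ _ u ∣ SymmetricAlgebra.ι ℤ _ w) : w = u ∨ w = -u := by
  refine hu.eq_or_eq_neg hw fun y hy => ?_
  obtain ⟨G, hG⟩ := h
  have := congrArg (evalAt (latticeMap N y)) hG
  rw [map_mul, evalAt_ι, evalAt_ι, realPairing_latticeMap, realPairing_latticeMap, hy] at this
  simpa using this

/-- `x` is a polynomial divided by a product of primitive linear forms. -/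
def HasLinearDenom (x : RatFun N) : Prop :=
  ∃ m : Multiset (DualLattice N), (∀ u ∈ m, IsPrim u) ∧ ∃ A : Poly N,
    x * algebraMap _ (RatFun N) (m.map (SymmetricAlgebra.ι ℤ (DualLattice N))).prod =
      algebraMap _ (RatFun N) A

lemma HasLinearDenom.zero : HasLinearDenom (0 : RatFun N) := ⟨0, by simp, 0, by simp⟩

lemma HasLinearDenom.add {x y : RatFun N} (hx : HasLinearDenom x) (hy : HasLinearDenom y) :
    HasLinearDenom (x + y) := by
  obtain ⟨m, hm, A, h1⟩ := hx
  obtain ⟨m', hm', A', h2⟩ := hy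
  refine ⟨m + m', fun u hu => (Multiset.mem_add.1 hu).elim (hm u) (hm' u),
    A * (m'.map (SymmetricAlgebra.ι ℤ (DualLattice N))).prod +
      A' * (m.map (SymmetricAlgebra.ι ℤ (DualLattice N))).prod, ?_⟩
  rw [Multiset.map_add, Multiset.prod_add, map_mul, map_add, map_mul, map_mul, ← h1, ← h2]
  ring

lemma HasLinearDenom.mul_algebraMap {x : RatFun N} (hx : HasLinearDenom x) (F : Poly N) :
    HasLinearDenom (x * algebraMap _ (RatFun N) F) := by
  obtain ⟨m, hm, A, h1⟩ := hx
  exact ⟨m, hm, A * F, by rw [map_mul, ← h1]; ring⟩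

variable [Module.Free ℤ N] [Module.Finite ℤ N]

/-- A polynomial that vanishes on the hyperplane `u = 0` is divisible by `u`. -/
lemma ι_dvd_of_vanish {u : DualLattice N} (hu : IsPrim u) {F : Poly N}
    (h : ∀ y, realPairing u y = 0 → evalAt y F = 0) : SymmetricAlgebra.ι ℤ _ u ∣ F := by
  obtain ⟨v, hv⟩ := hu.exists_eq_one
  have h1 : restrictForm u v F = 0 := by
    refine eq_zero_of_evalAt _ fun y => ?_
    rw [evalAt_restrictForm]
    exact h _ (by simp [hv])
  have h2 := dvd_sub_restrictForm u v F
  rwa [h1, sub_zero] at h2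

lemma prime_ι {u : DualLattice N} (hu : IsPrim u) : Prime (SymmetricAlgebra.ι ℤ _ u) := by
  obtain ⟨v, hv⟩ := hu.exists_eq_one
  have hz : restrictForm u v (SymmetricAlgebra.ι ℤ _ u) = 0 := by
    rw [restrictForm_ι, hv, one_smul, sub_self, map_zero]
  have hdvd : ∀ F : Poly N, SymmetricAlgebra.ι ℤ _ u ∣ F ↔ restrictForm u v F = 0 := by
    refine fun F => ⟨?_, fun h => ?_⟩
    · rintro ⟨G, rfl⟩
      rw [map_mul, hz, zero_mul]
    · have h2 := dvd_sub_restrictForm u v F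
      rwa [h, sub_zero] at h2
  refine ⟨ι_ne_zero hu.ne_zero, fun h => ?_, fun a b h => ?_⟩
  · have := (hdvd 1).1 h.dvd
    rw [map_one] at this
    exact one_ne_zero this
  · rw [hdvd, map_mul] at h
    rw [hdvd, hdvd]
    exact mul_eq_zero.1 h

/-- The rational function `x` has no pole along the hyperplane `u = 0`. -/
def IsRegularAt (u : DualLattice N) (x : RatFun N) : Prop :=
  ∃ a b : Poly N, x * algebraMap _ (RatFun N) b = algebraMap _ (RatFun N) a ∧
    ¬SymmetricAlgebra.ι ℤ _ u ∣ b

lemma isRegularAt_algebraMap {u : DualLattice N} (hu : IsPrim u) (F : Poly N) :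
    IsRegularAt u (algebraMap _ (RatFun N) F) :=
  ⟨F, 1, by simp, fun h => (prime_ι hu).not_isUnit (isUnit_of_dvd_one h)⟩

lemma IsRegularAt.add {u : DualLattice N} (hu : IsPrim u) {x y : RatFun N} (hx : IsRegularAt u x)
    (hy : IsRegularAt u y) : IsRegularAt u (x + y) := by
  obtain ⟨a, b, h1, h2⟩ := hx
  obtain ⟨c, d, h3, h4⟩ := hy
  refine ⟨a * d + c * b, b * d, ?_, fun h => ((prime_ι hu).dvd_or_dvd h).elim h2 h4⟩
  rw [map_mul, map_add, map_mul, map_mul, ← h1, ← h3]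
  ring

lemma IsRegularAt.mul {u : DualLattice N} (hu : IsPrim u) {x y : RatFun N} (hx : IsRegularAt u x)
    (hy : IsRegularAt u y) : IsRegularAt u (x * y) := by
  obtain ⟨a, b, h1, h2⟩ := hx
  obtain ⟨c, d, h3, h4⟩ := hy
  refine ⟨a * c, b * d, ?_, fun h => ((prime_ι hu).dvd_or_dvd h).elim h2 h4⟩
  rw [map_mul, map_mul, ← h1, ← h3]
  ring

/-- The additive group of rational functions without a pole along `u = 0`. -/
def regularAt {u : DualLattice N} (hu : IsPrim u) : AddSubgroup (RatFun N) where
  carrier := {x | IsRegularAt u x}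
  add_mem' hx hy := IsRegularAt.add hu hx hy
  zero_mem' := by simpa using isRegularAt_algebraMap hu (0 : Poly N)
  neg_mem' {x} hx := by
    have h := (isRegularAt_algebraMap hu (-1 : Poly N)).mul hu hx
    rwa [map_neg, map_one, neg_one_mul] at h

lemma mem_regularAt {u : DualLattice N} (hu : IsPrim u) {x : RatFun N} :
    x ∈ regularAt hu ↔ IsRegularAt u x := Iff.rfl

/-- A rational function whose denominator is a product of primitive linear forms, and which has no
poles along hyperplanes, is a polynomial. -/
lemma exists_eq_algebraMap (m : Multiset (DualLattice N)) {x : RatFun N}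
    (hm : ∀ u ∈ m, IsPrim u) (hx : ∀ u, IsPrim u → IsRegularAt u x) {A : Poly N}
    (h : x * algebraMap _ (RatFun N) (m.map (SymmetricAlgebra.ι ℤ (DualLattice N))).prod =
      algebraMap _ (RatFun N) A) : ∃ B : Poly N, x = algebraMap _ (RatFun N) B := by
  induction m using Multiset.induction_on generalizing A with
  | empty => exact ⟨A, by simpa using h⟩
  | cons u m ih =>
    have hu := hm u (Multiset.mem_cons_self u m)
    obtain ⟨a, b, h1, h2⟩ := hx u hu
    rw [Multiset.map_cons, Multiset.prod_cons] at h
    set P := (m.map (SymmetricAlgebra.ι ℤ (DualLattice N))).prod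
    have h3 : a * (SymmetricAlgebra.ι ℤ _ u * P) = A * b := by
      apply IsFractionRing.injective (Poly N) (RatFun N)
      rw [map_mul, map_mul _ A, ← h, ← h1]
      ring
    have h4 : SymmetricAlgebra.ι ℤ _ u ∣ A * b := ⟨a * P, by rw [← h3]; ring⟩
    obtain ⟨A', rfl⟩ := ((prime_ι hu).dvd_or_dvd h4).resolve_right h2
    refine ih (A := A') (fun w hw => hm w (Multiset.mem_cons_of_mem hw)) ?_
    apply mul_left_cancel₀ (algebraMap_poly_ne_zero (ι_ne_zero hu.ne_zero))
    rw [map_mul, map_mul] at h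
    rw [← h]
    ring

lemma not_ι_dvd_prod {u : DualLattice N} (hu : IsPrim u) {U : Finset (DualLattice N)}
    (hU : ∀ a ∈ U, IsPrim a ∧ a ≠ u ∧ a ≠ -u) :
    ¬SymmetricAlgebra.ι ℤ _ u ∣ ∏ a ∈ U, -SymmetricAlgebra.ι ℤ (DualLattice N) a := by
  intro h
  obtain ⟨a, ha, hdvd⟩ := (prime_ι hu).exists_mem_finset_dvd h
  rcases eq_or_eq_neg_of_ι_dvd hu (hU a ha).1 ((dvd_neg).1 hdvd) with h1 | h1
  · exact (hU a ha).2.1 h1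
  · exact (hU a ha).2.2 h1

end Hyperplanes

/-! ### Poles of multiplicities -/

section Poles

variable {N : Type*} [AddCommGroup N]

/-- A series that is finite along every line in direction `u`, and becomes finite after
multiplication by `1 - x^u`, is finite. -/
lemma finite_support_of_binom {u : DualLattice N} {S : DualLattice N → ℤ}
    (h1 : ∀ w, {j : ℤ | S (w + j • u) ≠ 0}.Finite)
    (h2 : (Function.support (mulSeries (binom u) S)).Finite) : (Function.support S).Finite := by
  have h3 : (⋃ e ∈ Function.support (mulSeries (binom u) S),
      (fun j : ℤ => e + j • u) '' {j : ℤ | S (e + j • u) ≠ 0}).Finite :=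
    h2.biUnion fun e _ => (h1 e).image _
  refine h3.subset fun w hw => ?_
  have hne : {j : ℤ | S (w + j • u) ≠ 0}.Nonempty := ⟨0, by simpa using hw⟩
  obtain ⟨j, hj, hmax⟩ := Set.exists_max_image _ id (h1 w) hne
  have hj1 : S (w + (j + 1) • u) = 0 := by
    by_contra h
    have := hmax (j + 1) h
    simp only [id] at this
    omega
  refine Set.mem_biUnion (x := w + (j + 1) • u) ?_ ⟨-(j + 1), ?_, ?_⟩
  · rw [Function.mem_support, mulSeries_binom, hj1, add_smul, one_smul, ← add_assoc,
      add_sub_cancel_right, zero_sub, neg_ne_zero]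
    exact hj
  · have : w + (j + 1) • u + -(j + 1) • u = w := by module
    rw [Set.mem_ofPred_eq, this]
    exact hw
  · change w + (j + 1) • u + -(j + 1) • u = w
    module

lemma finite_line_mulSeries {u : DualLattice N} {S : DualLattice N → ℤ}
    (h : ∀ w, {j : ℤ | S (w + j • u) ≠ 0}.Finite) (q : Laurent N) (w : DualLattice N) :
    {j : ℤ | mulSeries q S (w + j • u) ≠ 0}.Finite := by
  refine (Set.Finite.biUnion q.coeff.support.finite_toSet fun z _ => h (w - z)).subset ?_
  intro j hj
  obtain ⟨z, hz, hne⟩ := exists_of_mulSeries_ne_zero hj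
  refine Set.mem_biUnion hz ?_
  rw [Set.mem_ofPred_eq, show w - z + j • u = w + j • u - z by abel]
  exact hne

lemma finite_support_mulSeries {q : Laurent N} {S : DualLattice N → ℤ}
    (h : (Function.support S).Finite) : (Function.support (mulSeries q S)).Finite := by
  obtain ⟨p, hp⟩ := exists_coeff_of_finite h
  rw [funext hp, show mulSeries q p.coeff = (q * p).coeff from funext (mulSeries_coeff q p)]
  exact (q * p).coeff.hasFiniteSupport

variable [Module.Free ℤ N] [Module.Finite ℤ N]

lemma HasMult.exists_numerator_facetForm {s : Finset N} (hs : realSpan (s : Set N) = ⊤) {k : ℕ}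
    {e : RatFun N} (he : HasMult (coneInd s) k e) :
    ∃ A : Poly N, e * algebraMap _ (RatFun N) (facetForm hs) = algebraMap _ (RatFun N) A := by
  obtain ⟨p, hp⟩ := exists_numerator_facetProd hs
  exact he.exists_numerator (b := 1) one_ne_zero (by simpa using hp) (hasLead_facetProd hs)
    (facetForm_ne_zero hs)

lemma HasMult.hasLinearDenom {s : Finset N} (hs : realSpan (s : Set N) = ⊤) {k : ℕ}
    {e : RatFun N} (he : HasMult (coneInd s) k e) : HasLinearDenom e := by
  obtain ⟨A, hA⟩ := he.exists_numerator_facetForm hs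
  refine ⟨(facets_finite hs).toFinset.val.map Neg.neg, fun u hu => ?_, A, ?_⟩
  · obtain ⟨a, ha, rfl⟩ := Multiset.mem_map.1 hu
    exact ((facets_finite hs).mem_toFinset.1 ha).1.neg
  · rw [← hA, facetForm, Multiset.map_map, Finset.prod_eq_multiset_prod]
    congr 4
    funext a
    exact map_neg _ _

/-- The poles of the multiplicity lie along the facet normals. -/
lemma HasMult.isRegularAt {s : Finset N} (hs : realSpan (s : Set N) = ⊤) {k : ℕ}
    {e : RatFun N} (he : HasMult (coneInd s) k e) {u : DualLattice N} (hu : IsPrim u)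
    (h1 : u ∉ facets s) (h2 : -u ∉ facets s) : IsRegularAt u e := by
  obtain ⟨A, hA⟩ := he.exists_numerator_facetForm hs
  refine ⟨A, _, hA, not_ι_dvd_prod hu fun a ha => ?_⟩
  have ha' := (facets_finite hs).mem_toFinset.1 ha
  exact ⟨ha'.1, fun h => h1 (h ▸ ha'), fun h => h2 (h ▸ ha')⟩

/-- Multiplicities of cones on opposite sides of a wall: the poles along the wall cancel. -/
lemma isRegularAt_add_of_wall {s s' : Finset N} (hs : realSpan (s : Set N) = ⊤)
    (hs' : realSpan (s' : Set N) = ⊤) {u : DualLattice N} (hu : u ∈ facets s)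
    (hu' : -u ∈ facets s')
    (hwall : ∀ w : DualLattice N,
      (∀ x ∈ s, u x = 0 → 0 ≤ w x) ↔ ∀ x ∈ s', u x = 0 → 0 ≤ w x)
    {k : ℕ} {e e' : RatFun N} (he : HasMult (coneInd s) k e) (he' : HasMult (coneInd s') k e') :
    IsRegularAt u (e + e') := by
  classical
  set U := (facets_finite hs).toFinset with hU
  set U' := (facets_finite hs').toFinset with hU'
  have huU : u ∈ U := (facets_finite hs).mem_toFinset.2 hu
  have huU' : -u ∈ U' := (facets_finite hs').mem_toFinset.2 hu'
  obtain ⟨x₀, hx₀, hx₀u⟩ := exists_pos_of_ne_zero hs hu.1.ne_zero hu.2.1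
  obtain ⟨y₀, hy₀, hy₀u⟩ := exists_pos_of_ne_zero hs' hu'.1.ne_zero hu'.2.1
  rw [LinearMap.neg_apply] at hy₀u
  let D : DualLattice N → ℤ := fun w => if ∀ x ∈ s, u x = 0 → 0 ≤ w x then 1 else 0
  have hDper : ∀ (w : DualLattice N) (j : ℤ), D (w + j • u) = D w := fun w j => by
    refine if_congr (forall₃_congr fun x _ hx => ?_) rfl rfl
    simp [hx]
  have hbD : ∀ w, mulSeries (binom u) D w = 0 := fun w => by
    rw [mulSeries_binom, sub_eq_zero, ← hDper w (-1)]
    congr 1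
    module
  -- Along the line `w + ℤ u`, for `D w = 1`, the indicator functions of the two cones are those of
  -- a half-line upwards and a half-line downwards.
  let T : DualLattice N → ℤ := coneInd s + coneInd s' + -D
  have hT : ∀ w, {j : ℤ | T (w + j • u) ≠ 0}.Finite := by
    intro w
    let B : ℤ := 1 + ∑ x ∈ s, |w x| + ∑ x ∈ s', |w x|
    have hB : ∀ x, x ∈ s ∨ x ∈ s' → |w x| < B := by
      intro x hx
      have h1 : 0 ≤ ∑ x ∈ s, |w x| := Finset.sum_nonneg fun _ _ => abs_nonneg _
      have h2 : 0 ≤ ∑ x ∈ s', |w x| := Finset.sum_nonneg fun _ _ => abs_nonneg _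
      rcases hx with hx | hx
      · have := Finset.single_le_sum (f := fun x => |w x|) (fun x _ => abs_nonneg _) hx
        simp only [B]; omega
      · have := Finset.single_le_sum (f := fun x => |w x|) (fun x _ => abs_nonneg _) hx
        simp only [B]; omega
    refine (Set.finite_Icc (-B) B).subset fun j hj => ?_
    by_contra hjB
    rw [Set.mem_Icc, not_and_or, not_le, not_le] at hjB
    refine hj ?_
    simp only [T, Pi.add_apply, Pi.neg_apply, hDper]
    by_cases hD : ∀ x ∈ s, u x = 0 → 0 ≤ w x
    · have hD' := (hwall w).1 hD
      have hD1 : D w = 1 := if_pos hD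
      have hpos : ∀ x ∈ s, u x ≠ 0 → 1 ≤ u x := fun x hx h => by
        have := hu.2.1 x hx; omega
      have hpos' : ∀ x ∈ s', u x ≠ 0 → u x ≤ -1 := fun x hx h => by
        have := hu'.2.1 x hx
        rw [LinearMap.neg_apply] at this
        omega
      rcases hjB with hjB | hjB
      · rw [hD1, coneInd_eq_zero, coneInd_eq_one]
        · norm_num
        · intro x hx
          rw [LinearMap.add_apply, LinearMap.smul_apply, smul_eq_mul]
          by_cases h0 : u x = 0
          · rw [h0, mul_zero, add_zero]; exact hD' x hx h0
          · have h1 := hpos' x hx h0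
            have h2 := abs_lt.1 (hB x (Or.inr hx))
            nlinarith
        · intro h
          have h1 := h x₀ hx₀
          rw [LinearMap.add_apply, LinearMap.smul_apply, smul_eq_mul] at h1
          have h2 := abs_lt.1 (hB x₀ (Or.inl hx₀))
          nlinarith
      · rw [hD1, coneInd_eq_one, coneInd_eq_zero]
        · norm_num
        · intro h
          have h1 := h y₀ hy₀
          rw [LinearMap.add_apply, LinearMap.smul_apply, smul_eq_mul] at h1
          have h2 := abs_lt.1 (hB y₀ (Or.inr hy₀))
          nlinarith
        · intro x hx
          rw [LinearMap.add_apply, LinearMap.smul_apply, smul_eq_mul]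
          by_cases h0 : u x = 0
          · rw [h0, mul_zero, add_zero]; exact hD x hx h0
          · have h1 := hpos x hx h0
            have h2 := abs_lt.1 (hB x (Or.inl hx))
            nlinarith
    · have hD0 : D w = 0 := if_neg hD
      have hval : ∀ x, u x = 0 → (w + j • u) x = w x := fun x hx => by simp [hx]
      rw [hD0, coneInd_eq_zero, coneInd_eq_zero]
      · norm_num
      · refine fun h => hD ((hwall w).2 fun x hx h0 => ?_)
        rw [← hval x h0]; exact h x hx
      · refine fun h => hD fun x hx h0 => ?_
        rw [← hval x h0]; exact h x hx
  let Q := ∏ a ∈ U.erase u, binom a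
  let Q' := ∏ a ∈ U'.erase (-u), binom a
  have hQ : facetProd hs = binom u * Q := (Finset.mul_prod_erase U binom huU).symm
  have hQ' : facetProd hs' = binom (-u) * Q' := (Finset.mul_prod_erase U' binom huU').symm
  have hfin : (Function.support (mulSeries (Q * Q') T)).Finite := by
    have hline := finite_line_mulSeries hT (Q * Q')
    have hline' : ∀ w, {j : ℤ | mulSeries (Q * Q') T (w + j • -u) ≠ 0}.Finite := fun w => by
      refine ((hline w).image Neg.neg).subset fun j hj => ⟨-j, ?_, neg_neg j⟩
      rw [Set.mem_ofPred_eq, neg_smul, ← smul_neg]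
      exact hj
    refine finite_support_of_binom hline ?_
    refine finite_support_of_binom (u := -u) (fun w => ?_) ?_
    · have := finite_line_mulSeries hline' (binom u) w
      exact this
    have h1 : mulSeries (binom (-u)) (mulSeries (binom u) (mulSeries (Q * Q') T)) =
        mulSeries (facetProd hs') (mulSeries (facetProd hs) (coneInd s)) +
          mulSeries (facetProd hs) (mulSeries (facetProd hs') (coneInd s')) := by
      funext w
      have hDz : mulSeries (Q * (binom (-u) * Q') * binom u) D w = 0 := by
        rw [mulSeries_mul, show mulSeries (binom u) D = (0 : Laurent N).coeff from
          funext fun w => by rw [hbD]; rfl, mulSeries_coeff, mul_zero]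
        rfl
      rw [← mulSeries_mul, ← mulSeries_mul, Pi.add_apply, ← mulSeries_mul, ← mulSeries_mul, hQ, hQ',
        show binom (-u) * binom u * (Q * Q') = Q * (binom (-u) * Q') * binom u by ring,
        show binom (-u) * Q' * (binom u * Q) = Q * (binom (-u) * Q') * binom u by ring,
        show binom u * Q * (binom (-u) * Q') = Q * (binom (-u) * Q') * binom u by ring]
      simp only [T]
      rw [mulSeries_add_right, mulSeries_add_right, mulSeries_neg_right, hDz, neg_zero, add_zero]
    rw [h1]
    exact ((finite_support_mulSeries (finite_support_facetProd hs)).union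
      (finite_support_mulSeries (finite_support_facetProd hs'))).subset (Function.support_add _ _)
  obtain ⟨p, hp⟩ := exists_coeff_of_finite hfin
  have hnum : ∀ w, mulSeries (binom u * (Q * Q')) (coneInd s + coneInd s') w =
      (binom u * p).coeff w := by
    intro w
    have h1 : coneInd s + coneInd s' = T + D := by simp [T]
    have hDz : mulSeries (binom u * (Q * Q')) D w = 0 := by
      rw [mul_comm, mulSeries_mul, show mulSeries (binom u) D = (0 : Laurent N).coeff from
        funext fun w => by rw [hbD]; rfl, mulSeries_coeff, mul_zero]
      rfl
    rw [h1, mulSeries_add_right, hDz, add_zero, mulSeries_mul, funext hp, mulSeries_coeff]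
  have hlead := (hasLead_prod_binom (U.erase u)).mul (hasLead_prod_binom (U'.erase (-u)))
  have hnd : ¬SymmetricAlgebra.ι ℤ _ u ∣ (∏ a ∈ U.erase u, -SymmetricAlgebra.ι ℤ _ a) *
      ∏ a ∈ U'.erase (-u), -SymmetricAlgebra.ι ℤ (DualLattice N) a := by
    intro h
    rcases (prime_ι hu.1).dvd_or_dvd h with h | h
    · refine not_ι_dvd_prod hu.1 (fun a ha => ?_) h
      have ha' := (facets_finite hs).mem_toFinset.1 (Finset.mem_of_mem_erase ha)
      refine ⟨ha'.1, Finset.ne_of_mem_erase ha, ?_⟩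
      rintro rfl
      have := ha'.2.1 x₀ hx₀
      rw [LinearMap.neg_apply] at this
      omega
    · refine not_ι_dvd_prod hu.1 (fun a ha => ?_) h
      have ha' := (facets_finite hs').mem_toFinset.1 (Finset.mem_of_mem_erase ha)
      refine ⟨ha'.1, ?_, Finset.ne_of_mem_erase ha⟩
      rintro rfl
      have := ha'.2.1 y₀ hy₀
      omega
  have hne : (∏ a ∈ U.erase u, -SymmetricAlgebra.ι ℤ _ a) *
      ∏ a ∈ U'.erase (-u), -SymmetricAlgebra.ι ℤ (DualLattice N) a ≠ 0 := by
    intro h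
    rw [h] at hnd
    exact hnd (dvd_zero _)
  have hb : binom u ≠ 0 :=
    (hasLead_binom u).ne_zero (neg_ne_zero.2 (ι_ne_zero hu.1.ne_zero))
  obtain ⟨A, hA⟩ := (he.add he').exists_numerator hb hnum hlead hne
  exact ⟨A, _, hA, hnd⟩

end Poles

/-! ### Local sums of piecewise polynomials are polynomials -/

section Degrees

variable {N : Type*} [AddCommGroup N]

lemma evalAt_eq_zero_of_latticeHull {t : Finset N} {F : Poly N}
    (h : ∀ v ∈ latticeHull t, evalAt v F = 0) {y : RealSpace N} (hy : y ∈ realSpan (t : Set N)) :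
    evalAt y F = 0 := by
  have hr : latticeMap N '' (t : Set N) = Set.range fun i : t => latticeMap N i := by
    rw [Set.image_eq_range]
    rfl
  rw [realSpan, hr, Submodule.mem_span_range_iff_exists_fun] at hy
  obtain ⟨c, rfl⟩ := hy
  have := evalAt_eq_zero_of_orthant 0 (fun i : t => latticeMap N i) F (fun c hc => ?_) c
  · rwa [zero_add] at this
  · rw [zero_add]
    exact h _ (sum_mem fun i _ =>
      PointedCone.smul_mem _ (hc i).le (latticeMap_mem_latticeHull i.2))

lemma evalAt_restrictPoly {Δ : Fan N} {k : ℕ} {f : RealSpace N → ℝ} (hf : Δ.IsPiecewisePoly k f)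
    {σ : PointedCone ℝ (RealSpace N)} (hσ : σ ∈ Δ.maxCones) {v : RealSpace N} (hv : v ∈ σ) :
    evalAt v (restrictPoly f σ) = f v := by
  obtain ⟨p, -, hp⟩ := hf.2 σ hσ
  have h : ∃ p : Poly N, ∀ v ∈ σ, f v = evalAt v p := ⟨p, hp⟩
  rw [restrictPoly, dif_pos h]
  exact (h.choose_spec v hv).symm

lemma IsHom.neg {k : ℕ} {F : Poly N} (hF : IsHom k F) : IsHom k (-F) := fun c v => by
  rw [map_neg, map_neg, hF]; ring

/-- `x` is zero or a quotient of homogeneous polynomials, of degree `k - m`. -/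
def HomFrac (k m : ℕ) (x : RatFun N) : Prop :=
  x = 0 ∨ ∃ (d : ℕ) (A B : Poly N), IsHom (d + k) A ∧ IsHom (d + m) B ∧ B ≠ 0 ∧
    x * algebraMap _ (RatFun N) B = algebraMap _ (RatFun N) A

lemma evalAt_zero (F : Poly N) :
    evalAt 0 F = ((SymmetricAlgebra.algebraMapInv F : ℤ) : ℝ) := by
  have : evalAt (0 : RealSpace N) = (Algebra.ofId ℤ ℝ).comp SymmetricAlgebra.algebraMapInv := by
    apply SymmetricAlgebra.algHom_ext
    refine LinearMap.ext fun u => ?_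
    change evalAt 0 (SymmetricAlgebra.ι ℤ _ u) =
      Algebra.ofId ℤ ℝ (SymmetricAlgebra.algebraMapInv (SymmetricAlgebra.ι ℤ _ u))
    rw [evalAt_ι, SymmetricAlgebra.algebraMapInv_ι, map_zero, map_zero]
  rw [this]
  rfl

lemma continuous_evalAt_smul (v : RealSpace N) (F : Poly N) :
    Continuous fun t : ℝ => evalAt (t • v) F := by
  have h : ∀ t : ℝ, evalAt (t • v) F =
      MvPolynomial.eval (fun _ : Unit => t) (affinePullback 0 (fun _ : Unit => v) F) := fun t => by
    rw [eval_affinePullback]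
    simp
  simp only [h]
  exact (MvPolynomial.continuous_eval _).comp (continuous_pi fun _ => continuous_id)

variable [Module.Free ℤ N] [Module.Finite ℤ N]

lemma HomFrac.add {k m : ℕ} {x y : RatFun N} (hx : HomFrac k m x) (hy : HomFrac k m y) :
    HomFrac k m (x + y) := by
  rcases hx with rfl | ⟨d, A, B, hA, hB, hB0, h1⟩
  · rwa [zero_add]
  rcases hy with rfl | ⟨d', A', B', hA', hB', hB0', h2⟩
  · rw [add_zero]
    exact Or.inr ⟨d, A, B, hA, hB, hB0, h1⟩
  refine Or.inr ⟨d + d' + m, A * B' + A' * B, B * B', ?_, ?_, mul_ne_zero hB0 hB0', ?_⟩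
  · have e1 := hA.mul hB'
    have e2 := hA'.mul hB
    rw [show d + k + (d' + m) = d + d' + m + k by ring] at e1
    rw [show d' + k + (d + m) = d + d' + m + k by ring] at e2
    exact e1.add e2
  · have e1 := hB.mul hB'
    rwa [show d + m + (d' + m) = d + d' + m + m by ring] at e1
  · rw [map_mul, map_add, map_mul, map_mul, ← h1, ← h2]
    ring

lemma isHom_restrictPoly {Δ : Fan N} (hΔ : Δ.IsComplete) {k : ℕ} {f : RealSpace N → ℝ}
    (hf : Δ.IsPiecewisePoly k f) {σ : PointedCone ℝ (RealSpace N)} (hσ : σ ∈ Δ.maxCones) :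
    IsHom k (restrictPoly f σ) := by
  obtain ⟨p, hpk, hp⟩ := hf.2 σ hσ
  obtain ⟨s, rfl⟩ := Δ.rational σ (Fan.mem_cones_of_mem_maxCones hσ)
  have hs := Fan.realSpan_eq_top hΔ hσ
  have : restrictPoly f (latticeHull s) = p := by
    refine sub_eq_zero.1 (eq_zero_of_evalAt _ fun y => ?_)
    refine evalAt_eq_zero_of_latticeHull (t := s) (fun v hv => ?_) (by rw [hs]; trivial)
    rw [map_sub, evalAt_restrictPoly hf hσ hv, hp v hv, sub_self]
  exact this ▸ isHom_of_mem_homogeneousPoly hpk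

lemma HasMult.homFrac {S : DualLattice N → ℤ} {k m : ℕ} {e : RatFun N} (he : HasMult S m e)
    {F : Poly N} (hF : IsHom k F) : HomFrac k m (e * algebraMap _ (RatFun N) F) := by
  obtain ⟨p, q, d, A, B, h1, h2, h3, -, rfl⟩ := he
  have hB := algebraMap_poly_ne_zero h3
  rcases neg_one_pow_eq_or (RatFun N) m with h | h
  · refine Or.inr ⟨d, A * F, B, h1.isHom.mul hF, h2.isHom, h3, ?_⟩
    rw [h, map_mul]
    field_simp
  · refine Or.inr ⟨d, -(A * F), B, (h1.isHom.mul hF).neg, h2.isHom, h3, ?_⟩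
    rw [h, map_neg, map_mul]
    field_simp

/-- A polynomial that is homogeneous of degree zero as a rational function is an integer. -/
lemma HomFrac.exists_eq_intCast {k : ℕ} {F : Poly N}
    (h : HomFrac k k (algebraMap _ (RatFun N) F)) :
    ∃ n : ℤ, algebraMap _ (RatFun N) F = n := by
  rcases h with h | ⟨d, A, B, hA, hB, hB0, h1⟩
  · exact ⟨0, by simpa using h⟩
  rw [← map_mul] at h1
  have h2 : F * B = A := IsFractionRing.injective (Poly N) (RatFun N) h1
  refine ⟨SymmetricAlgebra.algebraMapInv F, ?_⟩
  have h3 : (F - ((SymmetricAlgebra.algebraMapInv F : ℤ) : Poly N)) * B = 0 := by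
    refine eq_zero_of_evalAt _ fun v => ?_
    have h4 : Tendsto (fun t : ℝ => evalAt (t • v) F * evalAt v B) (𝓝[>] 0)
        (𝓝 (evalAt 0 F * evalAt v B)) := by
      have := ((continuous_evalAt_smul v F).mul_const (evalAt v B)).tendsto 0
      rw [zero_smul] at this
      exact this.mono_left nhdsWithin_le_nhds
    have h5 : Tendsto (fun t : ℝ => evalAt (t • v) F * evalAt v B) (𝓝[>] 0)
        (𝓝 (evalAt v A)) := by
      refine tendsto_const_nhds.congr' ?_
      filter_upwards [self_mem_nhdsWithin] with t ht
      have ht' : t ^ (d + k) ≠ 0 := (pow_pos (Set.mem_Ioi.1 ht) _).ne'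
      have h6 := congrArg (evalAt (t • v)) h2
      rw [map_mul, hB, hA] at h6
      apply mul_left_cancel₀ ht'
      linear_combination -h6
    have h7 := tendsto_nhds_unique h4 h5
    rw [evalAt_zero, ← h2, map_mul] at h7
    rw [map_mul, map_sub, map_intCast]
    linear_combination -h7
  rw [sub_eq_zero.1 ((mul_eq_zero.1 h3).resolve_right hB0), map_intCast]
  congr 1
  rw [map_intCast, Int.cast_id]

/-- A polynomial that is homogeneous of negative degree as a rational function is zero. -/
lemma HomFrac.eq_zero {k : ℕ} {F : Poly N}
    (h : HomFrac k (k + 1) (algebraMap _ (RatFun N) F)) : F = 0 := by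
  rcases h with h | ⟨d, A, B, hA, hB, hB0, h1⟩
  · by_contra hF
    exact algebraMap_poly_ne_zero hF h
  rw [← map_mul] at h1
  have h2 : F * B = A := IsFractionRing.injective (Poly N) (RatFun N) h1
  have h3 : A = 0 := by
    refine eq_zero_of_evalAt _ fun v => ?_
    have h4 : Tendsto (fun t : ℝ => t * (evalAt (t • v) F * evalAt v B)) (𝓝[>] 0)
        (𝓝 0) := by
      have hc : Continuous fun t : ℝ => t * (evalAt (t • v) F * evalAt v B) :=
        continuous_id.mul ((continuous_evalAt_smul v F).mul_const (evalAt v B))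
      have h0 := hc.tendsto 0
      simp only [zero_mul] at h0
      exact h0.mono_left nhdsWithin_le_nhds
    have h5 : Tendsto (fun t : ℝ => t * (evalAt (t • v) F * evalAt v B)) (𝓝[>] 0)
        (𝓝 (evalAt v A)) := by
      refine tendsto_const_nhds.congr' ?_
      filter_upwards [self_mem_nhdsWithin] with t ht
      have ht' : t ^ (d + k) ≠ 0 := (pow_pos (Set.mem_Ioi.1 ht) _).ne'
      have h6 := congrArg (evalAt (t • v)) h2
      rw [map_mul, hB, hA] at h6
      apply mul_left_cancel₀ ht'
      linear_combination -h6
    exact tendsto_nhds_unique h5 h4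
  rw [h3] at h2
  exact (mul_eq_zero.1 h2).resolve_right hB0

end Degrees

section LocalSum

variable {N : Type*} [AddCommGroup N]

lemma IsRegularAt.neg {u : DualLattice N} {x : RatFun N} (h : IsRegularAt (-u) x) :
    IsRegularAt u x := by
  obtain ⟨a, b, h1, h2⟩ := h
  exact ⟨a, b, h1, fun h => h2 (by rw [map_neg]; exact (neg_dvd).2 h)⟩

variable {Δ : Fan N} {k m : ℕ} {f : RealSpace N → ℝ} {τ : PointedCone ℝ (RealSpace N)}

variable [Module.Free ℤ N]

lemma neg_notMem_relFacets (hΔ : Δ.IsComplete) {σ : PointedCone ℝ (RealSpace N)}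
    (hσ : σ ∈ Δ.maxCones) {u : DualLattice N} (hu : u ∈ relFacets σ τ) : -u ∉ relFacets σ τ := by
  intro hu'
  obtain ⟨s, hsσ⟩ := Δ.rational σ (Fan.mem_cones_of_mem_maxCones hσ)
  change σ = latticeHull s at hsσ
  subst hsσ
  obtain ⟨x, hx, hxu⟩ := exists_pos_of_ne_zero (Fan.realSpan_eq_top hΔ hσ) hu.1.ne_zero
    (realPairing_nonneg_iff.1 hu.2.1)
  have := realPairing_nonneg_iff.1 hu'.2.1 x hx
  rw [LinearMap.neg_apply] at this
  omega

lemma eq_of_mem_relFacets (hΔ : Δ.IsComplete) {σ σ' : PointedCone ℝ (RealSpace N)}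
    (hσ : σ ∈ Δ.maxCones) (hσ' : σ' ∈ Δ.maxCones) {u : DualLattice N} (hu : u ∈ relFacets σ τ)
    (hu' : u ∈ relFacets σ' τ) (hcut : cutFace σ' u = cutFace σ u) : σ = σ' := by
  obtain ⟨s, hsσ⟩ := Δ.rational σ' (Fan.mem_cones_of_mem_maxCones hσ')
  change σ' = latticeHull s at hsσ
  subst hsσ
  obtain ⟨x, hx, hxu⟩ := exists_pos_of_ne_zero (Fan.realSpan_eq_top hΔ hσ') hu.1.ne_zero
    (realPairing_nonneg_iff.1 hu'.2.1)
  refine Fan.eq_of_wall hΔ hσ hσ' hu.2.1 hu.2.2.2 (fun v hv => ?_)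
    (latticeMap_mem_latticeHull hx) (by rw [realPairing_latticeMap]; exact_mod_cast hxu)
  rw [← hcut] at hv
  exact hv.1

/-- The neighbour of `σ` across the wall with normal `u`. -/
lemma exists_neighbour (hΔ : Δ.IsComplete) (hτ : τ ∈ Δ.cones)
    {σ : PointedCone ℝ (RealSpace N)} (hσ : σ ∈ Δ.maxCones) (hτσ : τ.IsFaceOf σ)
    {u : DualLattice N} (hu : u ∈ relFacets σ τ) :
    ∃ σ' ∈ Δ.maxCones, τ.IsFaceOf σ' ∧ -u ∈ relFacets σ' τ ∧ cutFace σ' u = cutFace σ u := by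
  obtain ⟨σ', hσ', hside, hcut⟩ := Fan.exists_wall hΔ hσ hu.1.ne_zero hu.2.1 hu.2.2.2
  have hle : τ ≤ σ' := fun v hv => by
    have : v ∈ cutFace σ u := mem_cutFace.2 ⟨hτσ.le hv, hu.2.2.1 v hv⟩
    rw [← hcut] at this
    exact this.1
  refine ⟨σ', hσ', Fan.isFaceOf_of_le hτ (Fan.mem_cones_of_mem_maxCones hσ') hle,
    ⟨hu.1.neg, fun v hv => ?_, fun v hv => ?_, fun v hv => ?_⟩, hcut⟩
  · rw [realPairing_neg]
    exact neg_nonneg.2 (hside v hv)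
  · rw [realPairing_neg, LinearMap.neg_apply, hu.2.2.1 v hv, neg_zero]
  · rw [LinearMap.mem_ker, realPairing_neg, LinearMap.neg_apply, neg_eq_zero] at hv
    rw [cutFace_neg, hcut]
    exact hu.2.2.2 hv

variable [Module.Finite ℤ N]

/-- The pole of a multiplicity along a wall is simple. -/
lemma HasMult.isRegularAt_mul {s : Finset N} (hs : realSpan (s : Set N) = ⊤) {k : ℕ}
    {e : RatFun N} (he : HasMult (coneInd s) k e) {u : DualLattice N} (hu : -u ∈ facets s) :
    IsRegularAt u (e * algebraMap _ (RatFun N) (SymmetricAlgebra.ι ℤ _ u)) := by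
  classical
  obtain ⟨A, hA⟩ := he.exists_numerator_facetForm hs
  have huU := (facets_finite hs).mem_toFinset.2 hu
  obtain ⟨y₀, hy₀, hy₀u⟩ := exists_pos_of_ne_zero hs hu.1.ne_zero hu.2.1
  rw [LinearMap.neg_apply] at hy₀u
  have hu' : IsPrim u := by simpa using hu.1.neg
  refine ⟨A, ∏ a ∈ (facets_finite hs).toFinset.erase (-u), -SymmetricAlgebra.ι ℤ _ a, ?_,
    not_ι_dvd_prod hu' fun a ha => ?_⟩
  · rw [← hA, facetForm, ← Finset.mul_prod_erase _ _ huU, map_neg, neg_neg, map_mul, mul_assoc]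
  · have ha' := (facets_finite hs).mem_toFinset.1 (Finset.mem_of_mem_erase ha)
    refine ⟨ha'.1, ?_, Finset.ne_of_mem_erase ha⟩
    rintro rfl
    have := ha'.2.1 y₀ hy₀
    omega

/-- The summands of the local sum on both sides of a wall have no pole along the wall in total. -/
lemma isRegularAt_add (hΔ : Δ.IsComplete) (hf : Δ.IsPiecewisePoly k f)
    (hτ : coneDim τ + m = Module.finrank ℤ N) {σ σ' : PointedCone ℝ (RealSpace N)}
    (hσ : σ ∈ Δ.maxCones) (hσ' : σ' ∈ Δ.maxCones) (hτσ : τ.IsFaceOf σ) (hτσ' : τ.IsFaceOf σ')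
    {u : DualLattice N} (hu : u ∈ relFacets σ τ) (hu' : -u ∈ relFacets σ' τ)
    (hcut : cutFace σ' u = cutFace σ u) :
    IsRegularAt u (relMult σ τ * algebraMap _ _ (restrictPoly f σ) +
      relMult σ' τ * algebraMap _ _ (restrictPoly f σ')) := by
  obtain ⟨s, hsσ⟩ := Δ.rational σ (Fan.mem_cones_of_mem_maxCones hσ)
  obtain ⟨s', hsσ'⟩ := Δ.rational σ' (Fan.mem_cones_of_mem_maxCones hσ')
  change σ = latticeHull s at hsσ
  change σ' = latticeHull s' at hsσ'
  subst hsσ hsσ'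
  have hs := Fan.realSpan_eq_top hΔ hσ
  have hs' := Fan.realSpan_eq_top hΔ hσ'
  have he := hasMult_relMult hs hτσ hτ
  have he' := hasMult_relMult hs' hτσ' hτ
  rw [← coneInd_relGens hτσ] at he
  rw [← coneInd_relGens hτσ'] at he'
  have hr := realSpan_relGens hs τ
  have hr' := realSpan_relGens hs' τ
  have h1 : IsRegularAt u (relMult (latticeHull s) τ + relMult (latticeHull s') τ) := by
    refine isRegularAt_add_of_wall hr hr' ((facets_relGens hτσ).symm ▸ hu)
      ((facets_relGens hτσ').symm ▸ hu') (fun w => ?_) he he'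
    have h2 := relGens_nonneg_of_eq_zero_iff hτσ' hu' (w := w)
    simp only [LinearMap.neg_apply, neg_eq_zero] at h2
    rw [relGens_nonneg_of_eq_zero_iff hτσ hu, h2, cutFace_neg, hcut]
  -- The two polynomials agree on the wall, which spans the hyperplane `u = 0`.
  have hdvd : SymmetricAlgebra.ι ℤ _ u ∣
      restrictPoly f (latticeHull s') - restrictPoly f (latticeHull s) := by
    have hus := realPairing_nonneg_iff.1 hu.2.1
    have hker := hu.2.2.2
    refine ι_dvd_of_vanish hu.1 fun y hy => ?_
    have hy' := hker (LinearMap.mem_ker.2 hy)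
    have hc := cutFace_latticeHull hus
    rw [hc, span_latticeHull] at hy'
    refine evalAt_eq_zero_of_latticeHull (fun v hv => ?_) hy'
    rw [← hc] at hv
    rw [map_sub, evalAt_restrictPoly hf hσ hv.1, evalAt_restrictPoly hf hσ' (hcut ▸ hv).1,
      sub_self]
  obtain ⟨G, hG⟩ := hdvd
  have h3 := (he'.isRegularAt_mul hr' ((facets_relGens hτσ').symm ▸ hu')).mul hu.1
    (isRegularAt_algebraMap hu.1 G)
  have h4 := h1.mul hu.1 (isRegularAt_algebraMap hu.1 (restrictPoly f (latticeHull s)))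
  -- `e f_σ + e' f_σ' = (e + e') f_σ + e' (f_σ' - f_σ)`
  convert h4.add hu.1 h3 using 1
  rw [mul_assoc, ← map_mul, ← hG, map_sub]
  ring

lemma isRegularAt_of_notMem (hΔ : Δ.IsComplete)
    (hτ : coneDim τ + m = Module.finrank ℤ N) {σ : PointedCone ℝ (RealSpace N)}
    (hσ : σ ∈ Δ.maxCones) (hτσ : τ.IsFaceOf σ) {u : DualLattice N} (hu : IsPrim u)
    (h1 : u ∉ relFacets σ τ) (h2 : -u ∉ relFacets σ τ) : IsRegularAt u (relMult σ τ) := by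
  obtain ⟨s, hsσ⟩ := Δ.rational σ (Fan.mem_cones_of_mem_maxCones hσ)
  change σ = latticeHull s at hsσ
  subst hsσ
  have hs := Fan.realSpan_eq_top hΔ hσ
  have he := hasMult_relMult hs hτσ hτ
  rw [← coneInd_relGens hτσ] at he
  rw [← facets_relGens hτσ] at h1 h2
  exact he.isRegularAt (realSpan_relGens hs τ) hu h1 h2

/-- The local sum has no poles, because they cancel in pairs of neighbours. -/
lemma isRegularAt_localSum (hΔ : Δ.IsComplete) (hf : Δ.IsPiecewisePoly k f) (hτ : τ ∈ Δ.cones)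
    (hm : coneDim τ + m = Module.finrank ℤ N) {u : DualLattice N} (hu : IsPrim u) :
    IsRegularAt u (localSum Δ f τ) := by
  classical
  rw [← mem_regularAt hu]
  unfold localSum
  rw [← Finset.sum_filter_add_sum_filter_not _
    (fun σ => u ∈ relFacets σ τ ∨ -u ∈ relFacets σ τ)]
  refine add_mem ?_ (sum_mem fun σ hσ => ?_)
  -- Modulo the functions that are regular along `u = 0`, exchanging the two cones at a wall is an
  -- involution under which the summands change sign.
  · rw [← QuotientAddGroup.eq_zero_iff]
    set A := (Δ.maxCones.filter fun σ => τ.IsFaceOf σ).filter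
      fun σ => u ∈ relFacets σ τ ∨ -u ∈ relFacets σ τ with hA
    have memA : ∀ {σ}, σ ∈ A ↔ (σ ∈ Δ.maxCones ∧ τ.IsFaceOf σ) ∧
        (u ∈ relFacets σ τ ∨ -u ∈ relFacets σ τ) := by
      intro σ
      rw [hA, Finset.mem_filter, Finset.mem_filter]
    have key : ∀ σ ∈ A, ∃ σ' ∈ A, cutFace σ' u = cutFace σ u ∧
        ((u ∈ relFacets σ τ ∧ -u ∈ relFacets σ' τ) ∨
          (-u ∈ relFacets σ τ ∧ u ∈ relFacets σ' τ)) := by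
      intro σ hσ
      obtain ⟨⟨h1, h2⟩, h3 | h3⟩ := memA.1 hσ
      · obtain ⟨σ', h4, h5, h6, h7⟩ := exists_neighbour hΔ hτ h1 h2 h3
        exact ⟨σ', memA.2 ⟨⟨h4, h5⟩, Or.inr h6⟩, h7, Or.inl ⟨h3, h6⟩⟩
      · obtain ⟨σ', h4, h5, h6, h7⟩ := exists_neighbour hΔ hτ h1 h2 h3
        rw [neg_neg] at h6
        rw [cutFace_neg, cutFace_neg] at h7
        exact ⟨σ', memA.2 ⟨⟨h4, h5⟩, Or.inl h6⟩, h7, Or.inr ⟨h3, h6⟩⟩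
    choose g hgA hgcut hg using key
    rw [← QuotientAddGroup.mk'_apply, map_sum]
    refine Finset.sum_involution g (fun σ hσ => ?_) (fun σ hσ _ h => ?_) hgA fun σ hσ => ?_
    · rw [← map_add, QuotientAddGroup.mk'_apply, QuotientAddGroup.eq_zero_iff, mem_regularAt]
      obtain ⟨⟨h1, h2⟩, -⟩ := memA.1 hσ
      obtain ⟨⟨h1', h2'⟩, -⟩ := memA.1 (hgA σ hσ)
      rcases hg σ hσ with ⟨h3, h4⟩ | ⟨h3, h4⟩
      · exact isRegularAt_add hΔ hf hm h1 h1' h2 h2' h3 h4 (hgcut σ hσ)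
      · refine IsRegularAt.neg (isRegularAt_add hΔ hf hm h1 h1' h2 h2' h3 (by rwa [neg_neg]) ?_)
        rw [cutFace_neg, cutFace_neg, hgcut σ hσ]
    · have h1 := (memA.1 hσ).1.1
      have h2 := hg σ hσ
      rw [h] at h2
      rcases h2 with ⟨h3, h4⟩ | ⟨h4, h3⟩ <;> exact neg_notMem_relFacets hΔ h1 h3 h4
    · have h1 := (memA.1 hσ).1.1
      have h1' := (memA.1 (hgA σ hσ)).1.1
      have h1'' := (memA.1 (hgA _ (hgA σ hσ))).1.1
      have hc : cutFace (g _ (hgA σ hσ)) u = cutFace σ u :=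
        (hgcut _ (hgA σ hσ)).trans (hgcut σ hσ)
      rcases hg σ hσ with ⟨h3, h4⟩ | ⟨h3, h4⟩ <;>
        rcases hg _ (hgA σ hσ) with ⟨h5, h6⟩ | ⟨h5, h6⟩
      · exact absurd h4 (neg_notMem_relFacets hΔ h1' h5)
      · exact (eq_of_mem_relFacets hΔ h1 h1'' h3 h6 hc).symm
      · refine (eq_of_mem_relFacets hΔ h1 h1'' h3 h6 ?_).symm
        rw [cutFace_neg, cutFace_neg, hc]
      · exact absurd h5 (neg_notMem_relFacets hΔ h1' h4)
  · obtain ⟨h1, h2⟩ := Finset.mem_filter.1 hσ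
    obtain ⟨h3, h4⟩ := Finset.mem_filter.1 h1
    rw [not_or] at h2
    exact (isRegularAt_of_notMem hΔ hm h3 h4 hu h2.1 h2.2).mul hu
      (isRegularAt_algebraMap hu _)

lemma exists_hasMult (hΔ : Δ.IsComplete)
    (hm : coneDim τ + m = Module.finrank ℤ N) {σ : PointedCone ℝ (RealSpace N)}
    (hσ : σ ∈ Δ.maxCones) (hτσ : τ.IsFaceOf σ) : ∃ s : Finset N, realSpan (s : Set N) = ⊤ ∧
    HasMult (coneInd s) m (relMult σ τ) := by
  obtain ⟨s, hsσ⟩ := Δ.rational σ (Fan.mem_cones_of_mem_maxCones hσ)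
  change σ = latticeHull s at hsσ
  subst hsσ
  have hs := Fan.realSpan_eq_top hΔ hσ
  have he := hasMult_relMult hs hτσ hm
  rw [← coneInd_relGens hτσ] at he
  exact ⟨_, realSpan_relGens hs τ, he⟩

/-- The local sum is a polynomial. -/
lemma exists_localSum_eq (hΔ : Δ.IsComplete) (hf : Δ.IsPiecewisePoly k f) (hτ : τ ∈ Δ.cones)
    (hm : coneDim τ + m = Module.finrank ℤ N) :
    ∃ B : Poly N, localSum Δ f τ = algebraMap _ (RatFun N) B := by
  have h : HasLinearDenom (localSum Δ f τ) := by
    refine Finset.sum_induction _ HasLinearDenom (fun _ _ => HasLinearDenom.add)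
      HasLinearDenom.zero fun σ hσ => ?_
    simp only [Finset.mem_filter] at hσ
    obtain ⟨h3, h4⟩ := hσ
    obtain ⟨s, hs, he⟩ := exists_hasMult hΔ hm h3 h4
    exact (he.hasLinearDenom hs).mul_algebraMap _
  obtain ⟨M, hM, A, hA⟩ := h
  exact exists_eq_algebraMap M hM (fun u hu => isRegularAt_localSum hΔ hf hτ hm hu) hA

lemma homFrac_localSum (hΔ : Δ.IsComplete) (hf : Δ.IsPiecewisePoly k f)
    (hm : coneDim τ + m = Module.finrank ℤ N) : HomFrac k m (localSum Δ f τ) := by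
  refine Finset.sum_induction _ (HomFrac k m) (fun _ _ => HomFrac.add) (Or.inl rfl) fun σ hσ => ?_
  simp only [Finset.mem_filter] at hσ
  obtain ⟨h3, h4⟩ := hσ
  obtain ⟨s, hs, he⟩ := exists_hasMult hΔ hm h3 h4
  exact he.homFrac (isHom_restrictPoly hΔ hf h3)

lemma exists_localSum_eq_intCast (hΔ : Δ.IsComplete) (hf : Δ.IsPiecewisePoly k f)
    (hτ : τ ∈ Δ.cones) (hk : coneDim τ + k = Module.finrank ℤ N) :
    ∃ n : ℤ, (n : RatFun N) = localSum Δ f τ := by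
  obtain ⟨B, hB⟩ := exists_localSum_eq hΔ hf hτ hk
  have h := homFrac_localSum hΔ hf hk
  rw [hB] at h ⊢
  obtain ⟨n, hn⟩ := h.exists_eq_intCast
  exact ⟨n, hn.symm⟩

lemma localSum_eq_zero (hΔ : Δ.IsComplete) (hf : Δ.IsPiecewisePoly k f)
    (hτ : τ ∈ Δ.cones) (hk : coneDim τ + (k + 1) = Module.finrank ℤ N) :
    localSum Δ f τ = 0 := by
  obtain ⟨B, hB⟩ := exists_localSum_eq hΔ hf hτ hk
  have h := homFrac_localSum hΔ hf hk
  rw [hB] at h ⊢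
  rw [h.eq_zero, map_zero]

end LocalSum

/-! ### Differences of series and multiplicities of facets -/

section Squeeze

variable {N : Type*} [AddCommGroup N]

/-- Cutting a cone of lattice points into slices. `C` consists of the `w ∈ K` that are nonnegative
at all `y j`, and `D j` is the facet of `C` where `w (y j) = 0`. The points of `C` outside `u + C`
are covered by translates of the `D j`, with `u (y j)` translates of `D j`; and they contain as many
disjoint translates. -/
lemma exists_slices {κ : Type*} (J : Finset κ) (y : κ → N) (K : AddSubgroup (DualLattice N))
    {C : DualLattice N → ℤ} {D : κ → DualLattice N → ℤ} (hC01 : ∀ w, C w = 0 ∨ C w = 1)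
    (hD01 : ∀ j w, D j w = 0 ∨ D j w = 1)
    (hC : ∀ w, C w ≠ 0 ↔ w ∈ K ∧ ∀ j ∈ J, 0 ≤ w (y j))
    (hD : ∀ j ∈ J, ∀ w, D j w ≠ 0 ↔ C w ≠ 0 ∧ w (y j) = 0)
    (w₀ w₁ : κ → DualLattice N) (hw₀ : ∀ j ∈ J, w₀ j ∈ K ∧ w₀ j (y j) = 1)
    (hw₁ : ∀ j ∈ J, w₁ j ∈ K ∧ w₁ j (y j) = 0 ∧ ∀ i ∈ J, i ≠ j → 0 < w₁ j (y i))
    {u : DualLattice N} (hu : C u ≠ 0) :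
    ∃ lo up : κ → Laurent N,
      (∀ j, AddMonoidAlgebra.lift ℤ ℤ (DualLattice N) 1 (lo j) = (u (y j)).toNat) ∧
      (∀ j, AddMonoidAlgebra.lift ℤ ℤ (DualLattice N) 1 (up j) = (u (y j)).toNat) ∧
      (∀ w, ∑ j ∈ J, mulSeries (lo j) (D j) w ≤ mulSeries (binom u) C w) ∧
      ∀ w, mulSeries (binom u) C w ≤ ∑ j ∈ J, mulSeries (up j) (D j) w := by
  classical
  have huK := ((hC u).1 hu).1
  have huy := ((hC u).1 hu).2
  -- The translates are moved by a large multiple of `w₁ j`, so that the other facets are avoided.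
  let m : κ → ℤ := fun j => u (y j) * ∑ i ∈ J, |w₀ j (y i)| + ∑ i ∈ J, u (y i)
  have hm : ∀ j ∈ J, ∀ a : ℕ, (a : ℤ) < u (y j) → ∀ i ∈ J, i ≠ j →
      u (y i) + |a * w₀ j (y i)| ≤ m j * w₁ j (y i) := by
    intro j hj a ha i hi hij
    have h1 : u (y i) ≤ ∑ i ∈ J, u (y i) := Finset.single_le_sum (f := fun i => u (y i)) huy hi
    have h2 : |w₀ j (y i)| ≤ ∑ i ∈ J, |w₀ j (y i)| :=
      Finset.single_le_sum (f := fun i => |w₀ j (y i)|) (fun _ _ => abs_nonneg _) hi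
    have h3 : |(a : ℤ) * w₀ j (y i)| ≤ u (y j) * ∑ i ∈ J, |w₀ j (y i)| := by
      rw [abs_mul, Nat.abs_cast]
      exact mul_le_mul ha.le h2 (abs_nonneg _) (huy j hj)
    have h4 : 1 ≤ w₁ j (y i) := (hw₁ j hj).2.2 i hi hij
    have h5 : 0 ≤ m j := by
      have := abs_nonneg ((a : ℤ) * w₀ j (y i))
      have := huy i hi
      simp only [m]; omega
    calc u (y i) + |a * w₀ j (y i)| ≤ m j := by simp only [m]; omega
      _ ≤ m j * w₁ j (y i) := le_mul_of_one_le_right h5 h4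
  let pt : ℤ → κ → ℕ → DualLattice N := fun c j a => (a : ℤ) • w₀ j + (c * m j) • w₁ j
  have hptK : ∀ c, ∀ j ∈ J, ∀ a, pt c j a ∈ K := fun c j hj a =>
    add_mem (K.zsmul_mem (hw₀ j hj).1 _) (K.zsmul_mem (hw₁ j hj).1 _)
  have hptj : ∀ c, ∀ j ∈ J, ∀ a, pt c j a (y j) = a := fun c j hj a => by
    simp [pt, (hw₀ j hj).2, (hw₁ j hj).2.1]
  have hpti : ∀ c j a i, pt c j a (y i) = a * w₀ j (y i) + c * (m j * w₁ j (y i)) :=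
    fun c j a i => by simp [pt, mul_assoc]
  let q : ℤ → κ → Laurent N := fun c j =>
    ∑ a ∈ Finset.range (u (y j)).toNat, AddMonoidAlgebra.single (pt c j a) 1
  have haug : ∀ c j, AddMonoidAlgebra.lift ℤ ℤ (DualLattice N) 1 (q c j) = (u (y j)).toNat := by
    intro c j
    simp only [q, map_sum, aug_single, Finset.sum_const, Finset.card_range, nsmul_eq_mul, mul_one]
  have hq : ∀ c j w, mulSeries (q c j) (D j) w =
      ∑ a ∈ Finset.range (u (y j)).toNat, D j (w - pt c j a) := by
    intro c j w
    have : ∀ T : Finset ℕ, mulSeries (∑ a ∈ T, AddMonoidAlgebra.single (pt c j a) 1 : Laurent N)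
        (D j) w = ∑ a ∈ T, D j (w - pt c j a) := by
      intro T
      induction T using Finset.induction_on with
      | empty => simp [mulSeries_zero_left]
      | insert a T ha ih =>
        rw [Finset.sum_insert ha, Finset.sum_insert ha, mulSeries_add_left, mulSeries_single,
          one_mul, ih]
    exact this _
  have hDnonneg : ∀ j w, 0 ≤ D j w := fun j w => by rcases hD01 j w with h | h <;> omega
  have hlt : ∀ {j a}, a ∈ Finset.range (u (y j)).toNat → (a : ℤ) < u (y j) := fun h => by
    have := Finset.mem_range.1 h; omega
  refine ⟨q 1, q (-1), haug 1, haug (-1), fun w => ?_, fun w => ?_⟩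
  · simp only [hq, mulSeries_binom]
    have hmono : C (w - u) ≤ C w := by
      rcases hC01 (w - u) with h | h
      · rcases hC01 w with h' | h' <;> omega
      · have h1 := (hC (w - u)).1 (by omega)
        have h2 : C w ≠ 0 := by
          refine (hC w).2 ⟨?_, fun j hj => ?_⟩
          · have := add_mem h1.1 huK
            rwa [sub_add_cancel] at this
          · have h3 := h1.2 j hj
            rw [LinearMap.sub_apply] at h3
            linarith [huy j hj]
        rcases hC01 w with h' | h' <;> omega
    -- A point of a translate of `D j` determines `j` and the translate.
    have key : ∀ j ∈ J, ∀ a ∈ Finset.range (u (y j)).toNat, D j (w - pt 1 j a) ≠ 0 →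
        w ∈ K ∧ w (y j) = a ∧ ∀ i ∈ J, i ≠ j → u (y i) ≤ w (y i) := by
      intro j hj a ha h
      obtain ⟨h1, h2⟩ := (hD j hj _).1 h
      obtain ⟨h3, h4⟩ := (hC _).1 h1
      refine ⟨?_, ?_, fun i hi hij => ?_⟩
      · have := add_mem h3 (hptK 1 j hj a)
        rwa [sub_add_cancel] at this
      · rw [LinearMap.sub_apply, hptj 1 j hj] at h2
        omega
      · have h5 := h4 i hi
        rw [LinearMap.sub_apply, hpti] at h5
        have h6 := hm j hj a (hlt ha) i hi hij
        have h7 := neg_abs_le ((a : ℤ) * w₀ j (y i))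
        linarith
    by_cases hex : ∃ j ∈ J, ∃ a ∈ Finset.range (u (y j)).toNat, D j (w - pt 1 j a) ≠ 0
    · obtain ⟨j, hj, a, ha, hne⟩ := hex
      obtain ⟨h1, h2, h3⟩ := key j hj a ha hne
      have h4 : C w ≠ 0 := (hC w).2 ⟨h1, fun i hi => by
        by_cases hij : i = j
        · rw [hij, h2]; positivity
        · exact (huy i hi).trans (h3 i hi hij)⟩
      have h5 : C (w - u) = 0 := by
        by_contra h
        have h6 := ((hC _).1 h).2 j hj
        rw [LinearMap.sub_apply, h2] at h6
        have := hlt ha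
        omega
      have h6 : C w = 1 := (hC01 w).resolve_left h4
      have hj' : ∀ i ∈ J, i ≠ j →
          ∑ a ∈ Finset.range (u (y i)).toNat, D i (w - pt 1 i a) = 0 := by
        intro i hi hij
        refine Finset.sum_eq_zero fun b hb => ?_
        by_contra h
        have h7 := (key i hi b hb h).2.1
        have h8 := h3 i hi hij
        have := hlt hb
        omega
      have ha' : ∀ b ∈ Finset.range (u (y j)).toNat, b ≠ a → D j (w - pt 1 j b) = 0 := by
        intro b hb hba
        by_contra h
        have h7 := (key j hj b hb h).2.1
        omega
      rw [Finset.sum_eq_single_of_mem j hj hj', Finset.sum_eq_single_of_mem a ha ha', h5, h6]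
      rcases hD01 j (w - pt 1 j a) with h | h <;> omega
    · push Not at hex
      rw [Finset.sum_eq_zero fun j hj => Finset.sum_eq_zero (hex j hj)]
      omega
  · simp only [hq, mulSeries_binom]
    have hnn : 0 ≤ ∑ j ∈ J, ∑ a ∈ Finset.range (u (y j)).toNat, D j (w - pt (-1) j a) :=
      Finset.sum_nonneg fun j _ => Finset.sum_nonneg fun a _ => hDnonneg j _
    by_cases h : C w - C (w - u) ≤ 0
    · exact h.trans hnn
    have h1 : C w = 1 := by
      rcases hC01 w with h1 | h1 <;> rcases hC01 (w - u) with h2 | h2 <;> omega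
    have h2 : C (w - u) = 0 := by rcases hC01 (w - u) with h2 | h2 <;> omega
    obtain ⟨hwK, hwy⟩ := (hC w).1 (by omega)
    obtain ⟨j, hj, hneg⟩ : ∃ j ∈ J, (w - u) (y j) < 0 := by
      by_contra! hcon
      exact (hC (w - u)).2 ⟨sub_mem hwK huK, hcon⟩ h2
    rw [LinearMap.sub_apply] at hneg
    have h3 : ((w (y j)).toNat : ℤ) = w (y j) := Int.toNat_of_nonneg (hwy j hj)
    have ha : (w (y j)).toNat ∈ Finset.range (u (y j)).toNat := by
      rw [Finset.mem_range]; omega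
    set a := (w (y j)).toNat
    have h4 : D j (w - pt (-1) j a) ≠ 0 := by
      have h5 : (w - pt (-1) j a) (y j) = 0 := by
        rw [LinearMap.sub_apply, hptj (-1) j hj, h3, sub_self]
      refine (hD j hj _).2 ⟨(hC _).2 ⟨sub_mem hwK (hptK (-1) j hj a), fun i hi => ?_⟩, h5⟩
      by_cases hij : i = j
      · rw [hij, h5]
      · rw [LinearMap.sub_apply, hpti]
        have h6 := hm j hj a (hlt ha) i hi hij
        have h7 := le_abs_self ((a : ℤ) * w₀ j (y i))
        linarith [hwy i hi, huy i hi]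
    have h5 : D j (w - pt (-1) j a) = 1 := (hD01 j _).resolve_left h4
    have h6 := Finset.single_le_sum (f := fun a => D j (w - pt (-1) j a))
      (fun a _ => hDnonneg j _) ha
    have h7 := Finset.single_le_sum
      (f := fun j => ∑ a ∈ Finset.range (u (y j)).toNat, D j (w - pt (-1) j a))
      (fun j _ => Finset.sum_nonneg fun a _ => hDnonneg j _) hj
    simp only [h5] at h6
    rw [h1, h2, sub_zero]
    exact h6.trans h7

variable [Module.Free ℤ N] [Module.Finite ℤ N]

/-- If `(1 - x^u) C` lies between two sums of translates of the series `D j`, with `n j` translates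
of `D j` each, then `u` times the multiplicity of `C` is the corresponding sum of multiplicities. -/
lemma ι_mul_eq_sum {κ : Type*} (J : Finset κ) {C : DualLattice N → ℤ} {D : κ → DualLattice N → ℤ}
    {k : ℕ} {E : RatFun N} {e : κ → RatFun N} (hE : HasMult C (k + 1) E)
    (he : ∀ j ∈ J, HasMult (D j) k (e j)) {v : RealSpace N} (hv : IsGeneric v)
    (hC : ∀ ε : ℝ, 0 < ε → Summable (expTerm C (ε • v)))
    (hD : ∀ j ∈ J, ∀ ε : ℝ, 0 < ε → Summable (expTerm (D j) (ε • v)))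
    {u : DualLattice N} {n : κ → ℤ} {lo up : κ → Laurent N}
    (hlo : ∀ j, AddMonoidAlgebra.lift ℤ ℤ (DualLattice N) 1 (lo j) = n j)
    (hup : ∀ j, AddMonoidAlgebra.lift ℤ ℤ (DualLattice N) 1 (up j) = n j)
    (h1 : ∀ w, ∑ j ∈ J, mulSeries (lo j) (D j) w ≤ mulSeries (binom u) C w)
    (h2 : ∀ w, mulSeries (binom u) C w ≤ ∑ j ∈ J, mulSeries (up j) (D j) w) :
    algebraMap _ (RatFun N) (SymmetricAlgebra.ι ℤ _ u) * E = ∑ j ∈ J, (n j : RatFun N) * e j := by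
  -- After evaluation at a generic point, both sides are limits, and the bounds squeeze them.
  apply (ratEval hv).injective
  simp only [map_mul, map_sum, map_intCast, ratEval_algebraMap, evalAt_ι]
  have tM : Tendsto (fun ε : ℝ => ε ^ k * (expEval (ε • -v) (binom u) * expSum C (ε • v)))
      (𝓝[>] 0) (𝓝 (realPairing u v * ratEval hv E)) := by
    have t1 := (hasLead_binom u).tendsto (-v)
    rw [map_neg, evalAt_ι, map_neg, neg_neg] at t1
    refine (t1.mul (hE.tendsto hv hC)).congr' ?_
    filter_upwards [self_mem_nhdsWithin] with ε hε
    have hε' : ε ≠ 0 := (Set.mem_Ioi.1 hε).ne'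
    rw [pow_one, pow_succ]
    field_simp
  have tS : ∀ q : κ → Laurent N,
      (∀ j, AddMonoidAlgebra.lift ℤ ℤ (DualLattice N) 1 (q j) = n j) →
      Tendsto (fun ε : ℝ => ∑ j ∈ J, ε ^ k * (expEval (ε • -v) (q j) * expSum (D j) (ε • v)))
        (𝓝[>] 0) (𝓝 (∑ j ∈ J, (n j : ℝ) * ratEval hv (e j))) := by
    intro q hq
    refine tendsto_finsetSum _ fun j hj => ?_
    have t1 : Tendsto (fun ε : ℝ => expEval (ε • -v) (q j)) (𝓝[>] 0) (𝓝 (n j)) := by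
      have := (differentiable_expEval (-v) (q j)).continuous.tendsto 0
      rw [zero_smul, expEval_zero, hq] at this
      exact this.mono_left nhdsWithin_le_nhds
    refine (t1.mul ((he j hj).tendsto hv (hD j hj))).congr fun ε => ?_
    ring
  have hsum : ∀ q : κ → Laurent N, ∀ ε : ℝ, 0 < ε →
      HasSum (expTerm (fun w => ∑ j ∈ J, mulSeries (q j) (D j) w) (ε • v))
        (∑ j ∈ J, expEval (ε • -v) (q j) * expSum (D j) (ε • v)) := by
    intro q ε hε
    have h := hasSum_sum fun j hj => hasSum_mulSeries (hD j hj ε hε) (q j)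
    simp only [smul_neg]
    have e : expTerm (fun w => ∑ j ∈ J, mulSeries (q j) (D j) w) (ε • v) =
        fun w => ∑ j ∈ J, expTerm (mulSeries (q j) (D j)) (ε • v) w := by
      funext w
      simp only [expTerm, Int.cast_sum, Finset.sum_mul]
    rw [e]
    exact h
  have hmono : ∀ {S S' : DualLattice N → ℤ}, (∀ w, S w ≤ S' w) → ∀ {y : RealSpace N} (w),
      expTerm S y w ≤ expTerm S' y w := fun h y w =>
    mul_le_mul_of_nonneg_right (by exact_mod_cast h w) (Real.exp_nonneg _)
  refine le_antisymm (le_of_tendsto_of_tendsto tM (tS up hup) ?_)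
    (le_of_tendsto_of_tendsto (tS lo hlo) tM ?_)
  · filter_upwards [self_mem_nhdsWithin] with ε hε
    have hε : 0 < ε := hε
    rw [← Finset.mul_sum]
    refine mul_le_mul_of_nonneg_left ?_ (pow_nonneg hε.le _)
    rw [smul_neg]
    have := hasSum_le (hmono h2) (hasSum_mulSeries (hC ε hε) (binom u)) (hsum up ε hε)
    simpa only [smul_neg] using this
  · filter_upwards [self_mem_nhdsWithin] with ε hε
    have hε : 0 < ε := hε
    rw [← Finset.mul_sum]
    refine mul_le_mul_of_nonneg_left ?_ (pow_nonneg hε.le _)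
    have := hasSum_le (hmono h1) (hsum lo ε hε) (hasSum_mulSeries (hC ε hε) (binom u))
    simpa only [smul_neg] using this

end Squeeze

/-! ### Faces of dimension one higher -/

section Edges

variable {N : Type*} [AddCommGroup N]

lemma relInd_ne_zero {σ τ : PointedCone ℝ (RealSpace N)} {w : DualLattice N} :
    relInd σ τ w ≠ 0 ↔ (∀ v ∈ σ, 0 ≤ realPairing w v) ∧ ∀ v ∈ τ, realPairing w v = 0 := by
  unfold relInd; split_ifs with h
  · exact ⟨fun _ => h, fun _ => one_ne_zero⟩
  · exact ⟨fun h0 => absurd rfl h0, fun h' => absurd h' h⟩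

lemma relInd_eq_zero_or_one (σ τ : PointedCone ℝ (RealSpace N)) (w : DualLattice N) :
    relInd σ τ w = 0 ∨ relInd σ τ w = 1 := by
  unfold relInd; split_ifs <;> simp

lemma coneDim_latticeHull (t : Finset N) :
    coneDim (latticeHull t) = Module.finrank ℝ (realSpan (t : Set N)) := by
  rw [coneDim, span_latticeHull]

lemma notMem_realSpan {t : Finset N} {w : DualLattice N} (h : ∀ x ∈ t, w x = 0) {y : N}
    (hy : w y ≠ 0) : latticeMap N y ∉ realSpan (t : Set N) := by
  intro hmem
  have := realPairing_eq_zero_of_realSpan (u := w) (s := (t : Set N)) h hmem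
  rw [realPairing_latticeMap] at this
  exact hy (by exact_mod_cast this)

lemma finrank_sup_span_singleton (W : Submodule ℝ (RealSpace N)) [Module.Finite ℝ W]
    {x : RealSpace N} (hx : x ∉ W) :
    Module.finrank ℝ (W ⊔ Submodule.span ℝ {x} : Submodule ℝ (RealSpace N)) =
      Module.finrank ℝ W + 1 := by
  have hx0 : x ≠ 0 := fun h => hx (h ▸ zero_mem W)
  have h1 := Submodule.finrank_sup_add_finrank_inf_eq W (Submodule.span ℝ {x})
  have h2 : W ⊓ Submodule.span ℝ {x} = ⊥ :=
    disjoint_iff.1 ((Submodule.disjoint_span_singleton' hx0).2 hx)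
  rwa [h2, finrank_bot, add_zero, finrank_span_singleton hx0] at h1

variable [Module.Free ℤ N] [Module.Finite ℤ N]

/-- If an integral form vanishes on a face `γ` and takes negative values on the cone, then tilting
it by a form that exposes `γ` gives a larger face on which it is negative outside `γ`. -/
lemma exists_pivot {s : Finset N} {γ : PointedCone ℝ (RealSpace N)}
    (hγ : γ.IsFaceOf (latticeHull s)) {ℓ : DualLattice N}
    (hℓ : ∀ x ∈ s, latticeMap N x ∈ γ → ℓ x = 0) (hneg : ∃ x ∈ s, ℓ x < 0) :
    ∃ w : DualLattice N, (∀ x ∈ s, 0 ≤ w x) ∧ (∀ x ∈ s, latticeMap N x ∈ γ → w x = 0) ∧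
      (∃ x ∈ s, latticeMap N x ∉ γ ∧ w x = 0) ∧
      ∀ x ∈ s, latticeMap N x ∉ γ → w x = 0 → ℓ x < 0 := by
  classical
  obtain ⟨z, hz0, hz1⟩ := exists_exposing s hγ
  obtain ⟨x₁, hx₁, hx₁ℓ⟩ := hneg
  have hx₁γ : latticeMap N x₁ ∉ γ := fun h => hx₁ℓ.ne (hℓ x₁ hx₁ h)
  -- `x₀` minimizes the ratio of `ℓ` and the exposing form.
  obtain ⟨x₀, hx₀, hmin⟩ := (s.filter fun x => latticeMap N x ∉ γ).exists_min_image
    (fun x => (ℓ x : ℚ) / z x) ⟨x₁, Finset.mem_filter.2 ⟨hx₁, hx₁γ⟩⟩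
  obtain ⟨hx₀s, hx₀γ⟩ := Finset.mem_filter.1 hx₀
  have hz₀ := hz1 x₀ hx₀s hx₀γ
  have hcmp : ∀ x ∈ s, latticeMap N x ∉ γ → ℓ x₀ * z x ≤ ℓ x * z x₀ := by
    intro x hx hxγ
    have h1 := hmin x (Finset.mem_filter.2 ⟨hx, hxγ⟩)
    have h2 : (0 : ℚ) < z x₀ := by exact_mod_cast hz₀
    have h3 : (0 : ℚ) < z x := by exact_mod_cast hz1 x hx hxγ
    rw [div_le_div_iff₀ h2 h3] at h1
    exact_mod_cast h1
  have hℓ₀ : ℓ x₀ < 0 := by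
    have h1 := hcmp x₁ hx₁ hx₁γ
    have h2 := hz1 x₁ hx₁ hx₁γ
    nlinarith [mul_neg_of_neg_of_pos hx₁ℓ hz₀]
  have hval : ∀ x, (z x₀ • ℓ - ℓ x₀ • z) x = ℓ x * z x₀ - ℓ x₀ * z x := fun x => by
    simp [mul_comm]
  refine ⟨z x₀ • ℓ - ℓ x₀ • z, fun x hx => ?_, fun x hx hxγ => ?_, ⟨x₀, hx₀s, hx₀γ, ?_⟩,
    fun x hx hxγ h0 => ?_⟩
  · rw [hval]
    by_cases hxγ : latticeMap N x ∈ γ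
    · rw [hℓ x hx hxγ, hz0 x hx hxγ]; simp
    · linarith [hcmp x hx hxγ]
  · rw [hval, hℓ x hx hxγ, hz0 x hx hxγ]; simp
  · rw [hval]; ring
  · rw [hval] at h0
    have h1 := mul_neg_of_neg_of_pos hℓ₀ (hz1 x hx hxγ)
    nlinarith

/-- Every face strictly below a rational cone lies in a face of dimension one higher. -/
lemma exists_edge (n : ℕ) {t : Finset N} (hn : t.card = n) {γ : PointedCone ℝ (RealSpace N)}
    (hγ : γ.IsFaceOf (latticeHull t)) (hne : ∃ x ∈ t, latticeMap N x ∉ γ) :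
    ∃ τ : PointedCone ℝ (RealSpace N), τ.IsFaceOf (latticeHull t) ∧ γ.IsFaceOf τ ∧
      coneDim τ = coneDim γ + 1 := by
  classical
  induction n using Nat.strong_induction_on generalizing t with
  | _ n ih =>
  by_cases hdim : coneDim (latticeHull t) = coneDim γ + 1
  · exact ⟨_, .rfl, hγ, hdim⟩
  obtain ⟨x₀, hx₀, hx₀γ⟩ := hne
  obtain ⟨z, hz0, hz1⟩ := exists_exposing t hγ
  set g := t.filter fun x => latticeMap N x ∈ γ with hg
  have hγg : γ = latticeHull g := face_eq_latticeHull hγ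
  have hx₀W : latticeMap N x₀ ∉ realSpan (g : Set N) :=
    notMem_realSpan (w := z) (fun x hx => hz0 x (Finset.mem_filter.1 hx).1
      (Finset.mem_filter.1 hx).2) (hz1 x₀ hx₀ hx₀γ).ne'
  -- Otherwise a form vanishing on `γ` and `x₀` yields a smaller face.
  obtain ⟨ℓ, hℓ0, hℓ1⟩ : ∃ ℓ : DualLattice N, (∀ x ∈ insert x₀ g, ℓ x = 0) ∧ ∃ x ∈ t, ℓ x < 0 := by
    obtain ⟨x₁, hx₁, hx₁W⟩ : ∃ x ∈ t, latticeMap N x ∉ realSpan ((insert x₀ g : Finset N) :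
        Set N) := by
      by_contra! h
      refine hdim ?_
      have h1 : realSpan (t : Set N) = realSpan ((insert x₀ g : Finset N) : Set N) := by
        refine le_antisymm (Submodule.span_le.2 ?_) (Submodule.span_mono (Set.image_mono ?_))
        · rintro _ ⟨x, hx, rfl⟩
          exact h x hx
        · exact Finset.coe_subset.2
            (Finset.insert_subset hx₀ (Finset.filter_subset _ _))
      rw [coneDim_latticeHull, hγg, coneDim_latticeHull, h1,
        ← finrank_sup_span_singleton _ hx₀W, Finset.coe_insert, realSpan, Set.image_insert_eq,
        Submodule.span_insert, sup_comm]
    obtain ⟨ℓ, h1, h2⟩ := exists_dual_ne_zero hx₁W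
    rcases lt_or_gt_of_ne h2 with h3 | h3
    · exact ⟨ℓ, h1, x₁, hx₁, h3⟩
    · exact ⟨-ℓ, fun x hx => by rw [LinearMap.neg_apply, h1 x hx, neg_zero], x₁, hx₁, by
        rw [LinearMap.neg_apply]; omega⟩
  obtain ⟨w, hw0, hw1, ⟨x₂, hx₂, hx₂γ, hx₂w⟩, hw3⟩ := exists_pivot hγ (ℓ := ℓ)
    (fun x hx hxγ => hℓ0 x (Finset.mem_insert_of_mem (Finset.mem_filter.2 ⟨hx, hxγ⟩))) hℓ1
  have hcut := cutFace_latticeHull hw0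
  have hface := cutFace_isFaceOf (realPairing_nonneg_iff.2 hw0)
  have hγφ : γ.IsFaceOf (cutFace (latticeHull t) w) :=
    (PointedCone.IsFaceOf.isFaceOf_iff_le hγ hface).2 fun v hv =>
      mem_cutFace.2 ⟨hγ.le hv, (vanish_face_iff hγ).2 hw1 v hv⟩
  rw [hcut] at hface hγφ
  have hx₀w : w x₀ ≠ 0 := fun h => by
    have := hw3 x₀ hx₀ hx₀γ h
    rw [hℓ0 x₀ (Finset.mem_insert_self _ _)] at this
    exact lt_irrefl _ this
  have hcard : (t.filter fun x => w x = 0).card < n := by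
    rw [← hn]
    refine Finset.card_lt_card (Finset.filter_ssubset.2 ⟨x₀, hx₀, hx₀w⟩)
  obtain ⟨τ, h1, h2, h3⟩ := ih _ hcard rfl hγφ ⟨x₂, Finset.mem_filter.2 ⟨hx₂, hx₂w⟩, hx₂γ⟩
  exact ⟨τ, h1.trans hface, h2, h3⟩

/-- A form that vanishes on the face `γ` is nonnegative on the cone if it is nonnegative on the
faces of dimension one more than `γ`. -/
lemma exists_edge_neg {s : Finset N} {γ : PointedCone ℝ (RealSpace N)}
    (hγ : γ.IsFaceOf (latticeHull s)) {ℓ : DualLattice N}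
    (hℓ : ∀ x ∈ s, latticeMap N x ∈ γ → ℓ x = 0) (hneg : ∃ x ∈ s, ℓ x < 0) :
    ∃ τ : PointedCone ℝ (RealSpace N), τ.IsFaceOf (latticeHull s) ∧ γ.IsFaceOf τ ∧
      coneDim τ = coneDim γ + 1 ∧ ∃ x ∈ s, latticeMap N x ∈ τ ∧ ℓ x < 0 := by
  classical
  obtain ⟨w, hw0, hw1, ⟨x₂, hx₂, hx₂γ, hx₂w⟩, hw3⟩ := exists_pivot hγ hℓ hneg
  have hcut := cutFace_latticeHull hw0
  have hface := cutFace_isFaceOf (realPairing_nonneg_iff.2 hw0)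
  have hγφ : γ.IsFaceOf (cutFace (latticeHull s) w) :=
    (PointedCone.IsFaceOf.isFaceOf_iff_le hγ hface).2 fun v hv =>
      mem_cutFace.2 ⟨hγ.le hv, (vanish_face_iff hγ).2 hw1 v hv⟩
  rw [hcut] at hface hγφ
  obtain ⟨τ, h1, h2, h3⟩ := exists_edge _ rfl hγφ
    ⟨x₂, Finset.mem_filter.2 ⟨hx₂, hx₂w⟩, hx₂γ⟩
  have hτ := h1.trans hface
  refine ⟨τ, hτ, h2, h3, ?_⟩
  obtain ⟨x, hx, hxτ, hxγ⟩ : ∃ x ∈ s, latticeMap N x ∈ τ ∧ latticeMap N x ∉ γ := by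
    by_contra! h
    have hle : τ ≤ γ := by
      rw [face_eq_latticeHull hτ]
      refine Submodule.span_le.2 ?_
      rintro _ ⟨x, hx, rfl⟩
      have hx := Finset.mem_filter.1 (Finset.mem_coe.1 hx)
      exact h x hx.1 hx.2
    rw [le_antisymm hle h2.le] at h3
    omega
  refine ⟨x, hx, hxτ, hw3 x hx hxγ ?_⟩
  have h4 := h1.le hxτ
  rw [← hcut] at h4
  have h5 := h4.2
  change realPairing w (latticeMap N x) = 0 at h5
  rw [realPairing_latticeMap] at h5
  exact_mod_cast h5

end Edges

/-! ### Primitive generators -/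

section PrimitiveGenerators

lemma exists_eq_smul_primitive {Q : Type*} [AddCommGroup Q] [Module.Free ℤ Q] [Module.Finite ℤ Q]
    {x : Q} (hx : x ≠ 0) :
    ∃ (d : ℤ) (v : Q), 0 < d ∧ x = d • v ∧ ∃ w : DualLattice Q, w v = 1 := by
  have hinj : Function.Injective (Module.Dual.eval ℤ Q) := (Module.evalEquiv ℤ Q).injective
  obtain ⟨d, W, hd, hW, w, hw⟩ := exists_eq_smul_of_ne_zero
    (u := Module.Dual.eval ℤ Q x) fun h => hx (hinj (by rw [h, map_zero]))
  obtain ⟨v, rfl⟩ := (Module.evalEquiv ℤ Q).surjective W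
  refine ⟨d, v, hd, hinj ?_, w, hw⟩
  rw [hW, map_smul]
  rfl

lemma IsPrim.exists_dual_eq_one {Q : Type*} [AddCommGroup Q] [Module.Free ℤ Q]
    [Module.Finite ℤ Q] {v : Q} (hv : IsPrim v) : ∃ w : DualLattice Q, w v = 1 := by
  obtain ⟨d, v', hd, rfl, w, hw⟩ := exists_eq_smul_primitive hv.ne_zero
  rcases Int.isUnit_iff.1 (hv d v' rfl) with rfl | rfl
  · exact ⟨w, by rw [one_smul, hw]⟩
  · omega

variable {N : Type*} [AddCommGroup N]

lemma primitiveGenerator_spec {ρ : PointedCone ℝ (RealSpace N)}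
    (h : ∃ v, IsPrimitiveGenerator ρ v) : IsPrimitiveGenerator ρ (primitiveGenerator ρ) := by
  rw [primitiveGenerator, dif_pos h]
  exact h.choose_spec

variable [Module.Free ℤ N] [Module.Finite ℤ N]

/-- The image of a cone modulo the span of a facet is a ray. -/
lemma exists_isPrimitiveGenerator {t : Finset N} {γ : PointedCone ℝ (RealSpace N)}
    (hγ : γ.IsFaceOf (latticeHull t)) (hdim : coneDim (latticeHull t) = coneDim γ + 1) :
    ∃ v, IsPrimitiveGenerator (imageCone (latticeHull t) γ) v := by
  classical
  obtain ⟨z, hz0, hz1⟩ := exists_exposing t hγ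
  obtain ⟨g, hg⟩ : ∃ g, g = t.filter fun x => latticeMap N x ∈ γ := ⟨_, rfl⟩
  have hγg : γ = latticeHull g := by rw [hg]; exact face_eq_latticeHull hγ
  obtain ⟨x₀, hx₀, hx₀γ⟩ : ∃ x ∈ t, latticeMap N x ∉ γ := by
    by_contra! h
    rw [hγg, hg, Finset.filter_true_of_mem h] at hdim
    omega
  have hzg : ∀ x ∈ g, z x = 0 := fun x hx => by
    rw [hg] at hx
    exact hz0 x (Finset.mem_filter.1 hx).1 (Finset.mem_filter.1 hx).2
  have hx₀W : latticeMap N x₀ ∉ realSpan (g : Set N) :=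
    notMem_realSpan hzg (hz1 x₀ hx₀ hx₀γ).ne'
  have hgt : g ⊆ t := by rw [hg]; exact Finset.filter_subset _ _
  have hspan : realSpan (g : Set N) ⊔ Submodule.span ℝ {latticeMap N x₀} =
      realSpan (t : Set N) := by
    refine Submodule.eq_of_le_of_finrank_eq (sup_le (Submodule.span_mono (Set.image_mono hgt))
      (Submodule.span_le.2 ?_)) ?_
    · rw [Set.singleton_subset_iff]
      exact Submodule.subset_span ⟨x₀, hx₀, rfl⟩
    · rw [finrank_sup_span_singleton _ hx₀W, ← coneDim_latticeHull, ← coneDim_latticeHull, ← hγg,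
        hdim]
  subst hγg
  have hmk : (latticeSpan (latticeHull g)).mkQ x₀ ≠ 0 := by
    rw [Submodule.mkQ_apply, Ne, Submodule.Quotient.mk_eq_zero]
    intro h
    change latticeMap N x₀ ∈ Submodule.span ℝ (latticeHull g : Set (RealSpace N)) at h
    rw [span_latticeHull] at h
    exact hx₀W h
  obtain ⟨d, v, hd, hv, w, hw⟩ := exists_eq_smul_primitive hmk
  have hproj : realProj (latticeHull g) (latticeMap N x₀) = (d : ℝ) • latticeMap _ v := by
    rw [realProj_latticeMap, hv, map_smul, Int.cast_smul_eq_zsmul]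
  have hd' : (0 : ℝ) < d := by exact_mod_cast hd
  refine ⟨v, le_antisymm ?_ ?_, fun m y hy => ?_⟩
  · rw [imageCone, PointedCone.map, Submodule.map_le_iff_le_comap]
    refine Submodule.span_le.2 ?_
    rintro _ ⟨x, hx, rfl⟩
    change realProj (latticeHull g) (latticeMap N x) ∈ PointedCone.hull ℝ {latticeMap _ v}
    by_cases hxγ : latticeMap N x ∈ latticeHull g
    · have : latticeMap N x ∈ LinearMap.ker (realProj (latticeHull g)) := by
        rw [ker_realProj, ← span_latticeHull]
        exact Submodule.subset_span hxγ
      rw [LinearMap.mem_ker.1 this]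
      exact zero_mem _
    · have h1 : latticeMap N x ∈ realSpan (g : Set N) ⊔ Submodule.span ℝ {latticeMap N x₀} := by
        rw [hspan]; exact Submodule.subset_span ⟨x, hx, rfl⟩
      obtain ⟨a, ha, b, hb, hab⟩ := Submodule.mem_sup.1 h1
      obtain ⟨r, rfl⟩ := Submodule.mem_span_singleton.1 hb
      have h2 : realPairing z (latticeMap N x) = r * realPairing z (latticeMap N x₀) := by
        rw [← hab, map_add, realPairing_eq_zero_of_realSpan (u := z) (s := (g : Set N)) hzg ha,
          map_smul, zero_add, smul_eq_mul]
      rw [realPairing_latticeMap, realPairing_latticeMap] at h2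
      have h3 : (0 : ℝ) < z x := by exact_mod_cast hz1 x hx hxγ
      have h4 : (0 : ℝ) < z x₀ := by exact_mod_cast hz1 x₀ hx₀ hx₀γ
      have hr : 0 < r := by
        by_contra! hr
        nlinarith
      have ha' : realProj (latticeHull g) a = 0 := by
        rw [← ker_realProj] at ha
        exact ha
      rw [← hab, map_add, ha', zero_add, map_smul, hproj, smul_smul]
      exact PointedCone.smul_mem _ (by positivity)
        (Submodule.subset_span (Set.mem_singleton _))
  · refine Submodule.span_le.2 ?_
    rw [Set.singleton_subset_iff]
    refine ⟨(d : ℝ)⁻¹ • latticeMap N x₀, PointedCone.smul_mem _ (by positivity)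
      (latticeMap_mem_latticeHull hx₀), ?_⟩
    change realProj (latticeHull g) ((d : ℝ)⁻¹ • latticeMap N x₀) = latticeMap _ v
    rw [map_smul, hproj, inv_smul_smul₀ hd'.ne']
  · rw [hy, map_smul, smul_eq_mul] at hw
    exact IsUnit.of_mul_eq_one _ hw

/-- A lattice vector that represents the primitive generator of a cone modulo a facet `γ`. On the
cone, a form that vanishes on `γ` is a nonnegative multiple of its value at this vector. -/
lemma exists_lift_primitiveGenerator {t g : Finset N}
    (hγ : (latticeHull g).IsFaceOf (latticeHull t))
    (hdim : coneDim (latticeHull t) = coneDim (latticeHull g) + 1) :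
    ∃ y : N, (latticeSpan (latticeHull g)).mkQ y =
        primitiveGenerator (imageCone (latticeHull t) (latticeHull g)) ∧
      (∀ w ∈ LinearMap.range (dualIncl (latticeHull g)), ∀ z ∈ latticeHull t, ∃ c : ℝ, 0 ≤ c ∧
        realPairing w z = c * w y) ∧
      (∃ z ∈ latticeHull t, ∀ w ∈ LinearMap.range (dualIncl (latticeHull g)),
        realPairing w z = w y) ∧
      ∃ w ∈ LinearMap.range (dualIncl (latticeHull g)), w y = 1 := by
  obtain ⟨h1, h2⟩ := primitiveGenerator_spec (exists_isPrimitiveGenerator hγ hdim)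
  set v := primitiveGenerator (imageCone (latticeHull t) (latticeHull g))
  obtain ⟨y, hy⟩ := (latticeSpan (latticeHull g)).mkQ_surjective v
  have hval : ∀ w' : DualLattice (QuotLattice (latticeHull g)),
      dualIncl (latticeHull g) w' y = w' v := fun w' => by
    rw [← hy]; rfl
  refine ⟨y, hy, ?_, ?_, ?_⟩
  · rintro _ ⟨w', rfl⟩ z hz
    have h3 : realProj (latticeHull g) z ∈ imageCone (latticeHull t) (latticeHull g) :=
      ⟨z, hz, rfl⟩
    rw [h1] at h3
    obtain ⟨c, hc⟩ := Submodule.mem_span_singleton.1 h3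
    refine ⟨c, c.2, ?_⟩
    rw [realPairing_dualIncl, ← hc, hval, ← realPairing_latticeMap]
    exact map_smul (realPairing w') (c : ℝ) _
  · have h3 : latticeMap _ v ∈ imageCone (latticeHull t) (latticeHull g) := by
      rw [h1]; exact Submodule.subset_span (Set.mem_singleton _)
    obtain ⟨z, hz, hzv⟩ := h3
    refine ⟨z, hz, ?_⟩
    rintro _ ⟨w', rfl⟩
    have h4 : realProj (latticeHull g) z = latticeMap _ v := hzv
    rw [realPairing_dualIncl, h4, hval, realPairing_latticeMap]
  · have h3 : IsPrim v := h2
    obtain ⟨w', hw'⟩ := h3.exists_dual_eq_one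
    exact ⟨_, ⟨w', rfl⟩, by rw [hval, hw']⟩

end PrimitiveGenerators

/-! ### Multiplicities and facets -/

section Facets

variable {N : Type*} [AddCommGroup N]

lemma eq_zero_of_intCast_ratFun {n : ℤ} (h : (n : RatFun N) = 0) : n = 0 := by
  by_contra hn
  refine algebraMap_poly_ne_zero (N := N) (F := n) (fun h0 => hn ?_) (by rw [map_intCast, h])
  have := congrArg (evalAt 0) h0
  rw [map_intCast, map_zero] at this
  exact_mod_cast this

/-- A face of a cone is contained in no other face of the same dimension. -/
lemma exists_notMem_of_ne [Module.Finite ℤ N] {s : Finset N} {τ τ' : PointedCone ℝ (RealSpace N)}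
    (hτ : τ.IsFaceOf (latticeHull s)) (hτ' : τ'.IsFaceOf (latticeHull s))
    (hdim : coneDim τ = coneDim τ') (hne : τ' ≠ τ) :
    ∃ x ∈ s, latticeMap N x ∈ τ' ∧ latticeMap N x ∉ τ := by
  classical
  by_contra! h
  have hle : τ' ≤ τ := by
    rw [face_eq_latticeHull hτ']
    refine Submodule.span_le.2 ?_
    rintro _ ⟨x, hx, rfl⟩
    have hx := Finset.mem_filter.1 (Finset.mem_coe.1 hx)
    exact h x hx.1 hx.2
  have hF : τ'.IsFaceOf τ := (PointedCone.IsFaceOf.isFaceOf_iff_le hτ' hτ).2 hle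
  obtain ⟨t', rfl⟩ : ∃ t', τ' = latticeHull t' := ⟨_, face_eq_latticeHull hτ'⟩
  refine hne (eq_of_isFaceOf_of_le_span hF fun v hv => ?_)
  have h1 : Submodule.span ℝ (latticeHull t' : Set (RealSpace N)) =
      Submodule.span ℝ (τ : Set (RealSpace N)) :=
    Submodule.eq_of_le_of_finrank_eq (Submodule.span_mono hle) hdim.symm
  rw [← span_latticeHull, h1]
  exact Submodule.subset_span hv

variable [Module.Free ℤ N] [Module.Finite ℤ N]

lemma summable_relInd {s : Finset N} (hs : realSpan (s : Set N) = ⊤) {v : RealSpace N}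
    (hv : IsDeep s v) (τ : PointedCone ℝ (RealSpace N)) {ε : ℝ} (hε : 0 < ε) :
    Summable (expTerm (relInd (latticeHull s) τ) (ε • v)) := by
  refine Summable.of_nonneg_of_le (fun w => ?_) (fun w => ?_) (summable_coneInd hs hv hε)
  · rcases relInd_eq_zero_or_one (latticeHull s) τ w with h | h <;>
      simp [expTerm, h, Real.exp_nonneg]
  · by_cases h : relInd (latticeHull s) τ w = 0
    · rw [expTerm, h, Int.cast_zero, zero_mul]
      exact expTerm_coneInd_nonneg s _ w
    · have h1 := realPairing_nonneg_iff.1 (relInd_ne_zero.1 h).1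
      rw [expTerm, expTerm, coneInd_eq_one h1,
        (relInd_eq_zero_or_one (latticeHull s) τ w).resolve_left h]

/-- The case of a form `u` in the dual cone. With a lift `y τ` of `v_{τ/γ}` for every `τ`, the
lattice points of `σ^* ∩ γ^⊥` that leave this set when `u` is subtracted lie on the slices
`w (y τ) = j` for `0 ≤ j < u (y τ)`. Up to terms with poles of lower order, the series of such a
slice is a translate of the series of `σ^* ∩ τ^⊥`. -/
lemma ι_mul_relMult_of_nonneg {s g : Finset N} (hs : realSpan (s : Set N) = ⊤)
    (hγ : (latticeHull g).IsFaceOf (latticeHull s)) {k : ℕ}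
    (hk : coneDim (latticeHull g) + (k + 1) = Module.finrank ℤ N)
    {J : Finset (PointedCone ℝ (RealSpace N))}
    (hJ : ∀ τ, τ ∈ J ↔ τ.IsFaceOf (latticeHull s) ∧ (latticeHull g).IsFaceOf τ ∧
      coneDim τ + k = Module.finrank ℤ N)
    (u : DualLattice (QuotLattice (latticeHull g)))
    (hu : ∀ x ∈ s, 0 ≤ dualIncl (latticeHull g) u x) :
    algebraMap _ (RatFun N) (SymmetricAlgebra.ι ℤ _ (dualIncl (latticeHull g) u)) *
      relMult (latticeHull s) (latticeHull g) =
    ∑ τ ∈ J, (u (primitiveGenerator (imageCone τ (latticeHull g))) : RatFun N) *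
      relMult (latticeHull s) τ := by
  classical
  let K := (LinearMap.range (dualIncl (latticeHull g))).toAddSubgroup
  -- A lift `y τ` of `v_{τ/γ}`, where `γ` is the cone generated by `g`.
  have hlift : ∀ τ ∈ J, ∃ y : N,
      (latticeSpan (latticeHull g)).mkQ y = primitiveGenerator (imageCone τ (latticeHull g)) ∧
      (∀ w ∈ K, ∀ z ∈ τ, ∃ c : ℝ, 0 ≤ c ∧ realPairing w z = c * w y) ∧
      (∃ z ∈ τ, ∀ w ∈ K, realPairing w z = w y) ∧ ∃ w ∈ K, w y = 1 := by
    intro τ hτ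
    obtain ⟨h1, h2, h3⟩ := (hJ τ).1 hτ
    have h4 := face_eq_latticeHull h1
    set t := s.filter fun x => latticeMap N x ∈ τ
    rw [h4] at h2 h3 ⊢
    exact exists_lift_primitiveGenerator h2 (by omega)
  choose! y hy hyz hyz' w₀ hw₀ hw₀y using hlift
  choose! z hz hzy using hyz'
  have hexp : ∀ τ ∈ J, ∃ w : DualLattice N, (∀ x ∈ s, latticeMap N x ∈ τ → w x = 0) ∧
      ∀ x ∈ s, latticeMap N x ∉ τ → 0 < w x := fun τ hτ => exists_exposing s ((hJ τ).1 hτ).1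
  choose! w₁ hw₁0 hw₁1 using hexp
  have hw₁τ : ∀ τ ∈ J, ∀ v ∈ τ, realPairing (w₁ τ) v = 0 := fun τ hτ =>
    (vanish_face_iff ((hJ τ).1 hτ).1).2 (hw₁0 τ hτ)
  have hmemK : ∀ {w : DualLattice N}, (∀ v ∈ latticeHull g, realPairing w v = 0) → w ∈ K := by
    intro w h
    obtain ⟨w', hw'⟩ := exists_dualIncl_eq h
    exact ⟨w', hw'⟩
  have hKvan : ∀ {w : DualLattice N}, w ∈ K → ∀ v ∈ latticeHull g, realPairing w v = 0 := by
    rintro _ ⟨w', rfl⟩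
    exact realPairing_dualIncl_eq_zero w'
  have hw₁K : ∀ τ ∈ J, w₁ τ ∈ K := fun τ hτ =>
    hmemK fun v hv => hw₁τ τ hτ v (((hJ τ).1 hτ).2.1.le hv)
  -- The lattice points of `σ^* ∩ γ^⊥` are cut out by the `y τ`, those of `σ^* ∩ τ^⊥` by `y τ = 0`.
  have hC : ∀ w, relInd (latticeHull s) (latticeHull g) w ≠ 0 ↔ w ∈ K ∧ ∀ τ ∈ J, 0 ≤ w (y τ) := by
    intro w
    rw [relInd_ne_zero]
    constructor
    · rintro ⟨h1, h2⟩
      refine ⟨hmemK h2, fun τ hτ => ?_⟩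
      have h3 := h1 _ (((hJ τ).1 hτ).1.le (hz τ hτ))
      rw [hzy τ hτ w (hmemK h2)] at h3
      exact_mod_cast h3
    · rintro ⟨h1, h2⟩
      refine ⟨realPairing_nonneg_iff.2 ?_, hKvan h1⟩
      by_contra! hneg
      obtain ⟨τ, h3, h4, h5, x, hx, hxτ, hxw⟩ :=
        exists_edge_neg hγ ((vanish_face_iff hγ).1 (hKvan h1)) hneg
      have hτ : τ ∈ J := (hJ τ).2 ⟨h3, h4, by omega⟩
      obtain ⟨c, hc, hcx⟩ := hyz τ hτ w h1 _ hxτ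
      rw [realPairing_latticeMap] at hcx
      have h6 : (0 : ℝ) ≤ w (y τ) := by exact_mod_cast h2 τ hτ
      have h7 : (w x : ℝ) < 0 := by exact_mod_cast hxw
      nlinarith [mul_nonneg hc h6]
  have hD : ∀ τ ∈ J, ∀ w, relInd (latticeHull s) τ w ≠ 0 ↔
      relInd (latticeHull s) (latticeHull g) w ≠ 0 ∧ w (y τ) = 0 := by
    intro τ hτ w
    rw [relInd_ne_zero, relInd_ne_zero]
    constructor
    · rintro ⟨h1, h2⟩
      have h3 : ∀ v ∈ latticeHull g, realPairing w v = 0 :=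
        fun v hv => h2 v (((hJ τ).1 hτ).2.1.le hv)
      refine ⟨⟨h1, h3⟩, ?_⟩
      have h4 := hzy τ hτ w (hmemK h3)
      rw [h2 _ (hz τ hτ)] at h4
      exact_mod_cast h4.symm
    · rintro ⟨⟨h1, h2⟩, h3⟩
      refine ⟨h1, fun v hv => ?_⟩
      obtain ⟨c, -, hcv⟩ := hyz τ hτ w (hmemK h2) v hv
      rw [hcv, h3, Int.cast_zero, mul_zero]
  have hw₁' : ∀ τ ∈ J, w₁ τ ∈ K ∧ w₁ τ (y τ) = 0 ∧ ∀ τ' ∈ J, τ' ≠ τ → 0 < w₁ τ (y τ') := by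
    intro τ hτ
    refine ⟨hw₁K τ hτ, ?_, fun τ' hτ' hne => ?_⟩
    · have h1 := hzy τ hτ _ (hw₁K τ hτ)
      rw [hw₁τ τ hτ _ (hz τ hτ)] at h1
      exact_mod_cast h1.symm
    · have hdim := ((hJ τ).1 hτ).2.2
      have hdim' := ((hJ τ').1 hτ').2.2
      obtain ⟨x, hx, hxτ', hxτ⟩ :=
        exists_notMem_of_ne ((hJ τ).1 hτ).1 ((hJ τ').1 hτ').1 (by omega) hne
      obtain ⟨c, hc, hcx⟩ := hyz τ' hτ' _ (hw₁K τ hτ) _ hxτ'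
      rw [realPairing_latticeMap] at hcx
      have h1 : (0 : ℝ) < w₁ τ x := by exact_mod_cast hw₁1 τ hτ x hx hxτ
      rw [hcx] at h1
      have h2 : (0 : ℝ) < w₁ τ (y τ') := by
        by_contra! h
        linarith [mul_nonpos_of_nonneg_of_nonpos hc h]
      exact_mod_cast h2
  have hu' : relInd (latticeHull s) (latticeHull g) (dualIncl (latticeHull g) u) ≠ 0 :=
    relInd_ne_zero.2 ⟨realPairing_nonneg_iff.2 hu, realPairing_dualIncl_eq_zero u⟩
  obtain ⟨lo, up, hlo, hup, h1, h2⟩ := exists_slices J y K (relInd_eq_zero_or_one _ (latticeHull g))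
    (fun τ => relInd_eq_zero_or_one _ τ) hC hD w₀ w₁ (fun τ hτ => ⟨hw₀ τ hτ, hw₀y τ hτ⟩) hw₁' hu'
  obtain ⟨v, hv, hgen⟩ := exists_generic hs
  rw [ι_mul_eq_sum J (hasMult_relMult hs hγ hk)
    (fun τ hτ => hasMult_relMult hs ((hJ τ).1 hτ).1 ((hJ τ).1 hτ).2.2) hgen
    (fun ε hε => summable_relInd hs hv (latticeHull g) hε)
    (fun τ _ ε hε => summable_relInd hs hv τ hε)
    hlo hup h1 h2]
  refine Finset.sum_congr rfl fun τ hτ => ?_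
  have h3 : 0 ≤ dualIncl (latticeHull g) u (y τ) := ((hC _).1 hu').2 τ hτ
  rw [Int.toNat_of_nonneg h3, ← hy τ hτ]
  rfl

/-- Multiplication of `e_{σ,γ}` by a linear form that vanishes on `γ` gives a combination of the
multiplicities `e_{σ,τ}` of the faces `τ` of dimension one higher. -/
lemma ι_mul_relMult {s g : Finset N} (hs : realSpan (s : Set N) = ⊤)
    (hγ : (latticeHull g).IsFaceOf (latticeHull s)) {k : ℕ}
    (hk : coneDim (latticeHull g) + (k + 1) = Module.finrank ℤ N)
    {J : Finset (PointedCone ℝ (RealSpace N))}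
    (hJ : ∀ τ, τ ∈ J ↔ τ.IsFaceOf (latticeHull s) ∧ (latticeHull g).IsFaceOf τ ∧
      coneDim τ + k = Module.finrank ℤ N)
    (u : DualLattice (QuotLattice (latticeHull g))) :
    algebraMap _ (RatFun N) (SymmetricAlgebra.ι ℤ _ (dualIncl (latticeHull g) u)) *
      relMult (latticeHull s) (latticeHull g) =
    ∑ τ ∈ J, (u (primitiveGenerator (imageCone τ (latticeHull g))) : RatFun N) *
      relMult (latticeHull s) τ := by
  -- Both sides are additive, and every form is a difference of two nonnegative ones.
  obtain ⟨w, hw0, hw1⟩ := exists_exposing s hγ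
  obtain ⟨w, rfl⟩ := exists_dualIncl_eq ((vanish_face_iff hγ).2 hw0)
  have hu0 := (vanish_face_iff hγ).1 (realPairing_dualIncl_eq_zero u)
  set m : ℤ := ∑ x ∈ s, |dualIncl (latticeHull g) u x|
  have hm : 0 ≤ m := Finset.sum_nonneg fun _ _ => abs_nonneg _
  have hnn : ∀ x ∈ s, 0 ≤ dualIncl (latticeHull g) w x := fun x hx => by
    by_cases h : latticeMap N x ∈ latticeHull g
    · exact (hw0 x hx h).ge
    · exact (hw1 x hx h).le
  have h1 := ι_mul_relMult_of_nonneg hs hγ hk hJ (m • w) fun x hx => by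
    rw [map_smul]
    exact mul_nonneg hm (hnn x hx)
  have h2 := ι_mul_relMult_of_nonneg hs hγ hk hJ (u + m • w) fun x hx => by
    rw [map_add, map_smul]
    change 0 ≤ dualIncl (latticeHull g) u x + m * dualIncl (latticeHull g) w x
    by_cases h : latticeMap N x ∈ latticeHull g
    · rw [hu0 x hx h, hw0 x hx h]; simp
    · have h3 : |dualIncl (latticeHull g) u x| ≤ m :=
        Finset.single_le_sum (f := fun x => |dualIncl (latticeHull g) u x|)
          (fun _ _ => abs_nonneg _) hx
      have h4 := neg_abs_le (dualIncl (latticeHull g) u x)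
      have h5 : m ≤ m * dualIncl (latticeHull g) w x :=
        le_mul_of_one_le_right hm (hw1 x hx h)
      linarith
  rw [map_add, map_add, map_add, add_mul, h1] at h2
  have h3 : ∀ v, (((u + m • w) v : ℤ) : RatFun N) = (u v : RatFun N) + ((m • w) v : ℤ) :=
    fun v => by rw [LinearMap.add_apply, Int.cast_add]
  simp only [h3, add_mul, Finset.sum_add_distrib] at h2
  exact add_right_cancel h2

/-- The balancing condition, tested by an integral form `u`: after multiplication by `u` the sum of
the `e_{σ,γ} f_σ`, which is zero, becomes the sum over the `τ` in question of `⟨u, v_{τ/γ}⟩` times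
the local sum at `τ`. -/
lemma sum_mul_localSum {Δ : Fan N} (hΔ : Δ.IsComplete) {k : ℕ} {f : RealSpace N → ℝ}
    (hf : Δ.IsPiecewisePoly k f) {γ : PointedCone ℝ (RealSpace N)} (hγ : γ ∈ Δ.codimCones (k + 1))
    (u : DualLattice (QuotLattice γ)) {S : Finset (PointedCone ℝ (RealSpace N))}
    (hS : ∀ τ, τ ∈ S ↔ τ ∈ Δ.codimCones k ∧ γ.IsFaceOf τ) :
    ∑ τ ∈ S, (u (primitiveGenerator (imageCone τ γ)) : RatFun N) * localSum Δ f τ = 0 := by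
  classical
  simp only [Fan.codimCones, Finset.mem_filter] at hγ hS
  obtain ⟨hγΔ, hγk⟩ := hγ
  have h0 : algebraMap _ (RatFun N) (SymmetricAlgebra.ι ℤ _ (dualIncl γ u)) *
      localSum Δ f γ = 0 := by
    rw [localSum_eq_zero hΔ hf hγΔ hγk, mul_zero]
  rw [← h0]
  unfold localSum
  simp only [Finset.mul_sum]
  rw [Finset.sum_comm' (t' := Δ.maxCones.filter fun σ => γ.IsFaceOf σ)
    (s' := fun σ => S.filter fun τ => τ.IsFaceOf σ)]
  · refine Finset.sum_congr rfl fun σ hσ => ?_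
    obtain ⟨hσm, hγσ⟩ := Finset.mem_filter.1 hσ
    clear hσ
    have hσΔ := Fan.mem_cones_of_mem_maxCones hσm
    simp only [← mul_assoc]
    rw [← Finset.sum_mul]
    congr 1
    obtain ⟨s, hs⟩ := Δ.rational σ hσΔ
    change σ = latticeHull s at hs
    subst hs
    obtain ⟨g, rfl⟩ : ∃ g, γ = latticeHull g := ⟨_, face_eq_latticeHull hγσ⟩
    refine (ι_mul_relMult (Fan.realSpan_eq_top hΔ hσm) hγσ hγk (fun τ => ?_) u).symm
    rw [Finset.mem_filter, hS]
    exact ⟨fun h => ⟨h.2, h.1.2, h.1.1.2⟩,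
      fun h => ⟨⟨⟨Δ.face_mem _ hσΔ _ h.1, h.2.2⟩, h.2.1⟩, h.1⟩⟩
  · intro τ σ
    simp only [Finset.mem_filter, hS]
    exact ⟨fun h => ⟨⟨h.1, h.2.2⟩, h.2.1, h.1.2.trans h.2.2⟩,
      fun h => ⟨h.1.1, h.2.1, h.1.2⟩⟩

end Facets

end Toric

end

theorem mainTheorem5 {N : Type*} [AddCommGroup N] [Module.Free ℤ N] [Module.Finite ℤ N]
    (Δ : Toric.Fan N) (hΔ : Δ.IsComplete) (k : ℕ) (f : Toric.RealSpace N → ℝ)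
    (hf : Δ.IsPiecewisePoly k f) :
    ∃ c : Δ.codimCones k → ℤ,
      (∀ τ : Δ.codimCones k, (c τ : Toric.RatFun N) = Toric.localSum Δ f τ) ∧
      Δ.IsMinkowskiWeight k c := by
  classical
  have hint : ∀ τ : Δ.codimCones k, ∃ n : ℤ, (n : Toric.RatFun N) = Toric.localSum Δ f τ := by
    rintro ⟨τ, hτ⟩
    simp only [Toric.Fan.codimCones, Finset.mem_filter] at hτ
    exact Toric.exists_localSum_eq_intCast hΔ hf hτ.1 hτ.2
  choose c hc using hint
  refine ⟨c, hc, fun γ hγ => ?_⟩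
  -- An element of a lattice is zero if all integral forms vanish on it.
  refine (Module.forall_dual_apply_eq_zero_iff ℤ _).1 fun u => ?_
  have h := Toric.sum_mul_localSum hΔ hf hγ u
    (S := (Δ.codimCones k).filter fun τ => γ.IsFaceOf τ) fun τ => Finset.mem_filter
  rw [Finset.sum_filter, ← Finset.sum_coe_sort, ← Finset.sum_filter] at h
  have h2 : ((u (∑ τ : Δ.codimCones k with γ.IsFaceOf τ.1,
      c τ • Toric.primitiveGenerator (Toric.imageCone τ.1 γ)) : ℤ) : Toric.RatFun N) = 0 := by
    rw [← h, map_sum, Int.cast_sum]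
    refine Finset.sum_congr rfl fun τ _ => ?_
    rw [map_smul, smul_eq_mul, Int.cast_mul, hc, mul_comm]
  convert Toric.eq_zero_of_intCast_ratFun h2
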